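/- Let $V$ be a four-dimensional real vector space with a Lorentzian metric $g$ of signature $(-,+,+,+)$ (the tangent space at a point of a spacetime), oriented by a volume form, and let $W$ be a Weyl tensor on $V$, i.e. a covariant 4-tensor with $W_{abcd}=-W_{bacd}=-W_{abdc}$, $W_{a[bcd]}=0$ and $W^{a}{}_{bad}=0$. Let $*W_{abcd}=\frac12\epsilon_{ab}{}^{ef}W_{efcd}$, and let $$T_{\alpha\mu\beta\nu}=\tfrac14\left(W_\alpha{}^\rho{}_\beta{}^\sigma W_{\mu\rho\nu\sigma}+{*W}_\alpha{}^\rho{}_\beta{}^\sigma\,{*W}_{\mu\rho\nu\sigma}\right)$$ be the Bel–Robinson tensor. In an orthonormal frame $e_0,e_1,e_2,e_3$ put $E_{ij}=W(e_i,e_0,e_j,e_0)$, $H_{ij}={*W}(e_i,e_0,e_j,e_0)$ ($i,j=1,2,3$). The eigenvalues $\rho_1,\rho_2,\rho_3$ (with multiplicity) and the minimal polynomial of the complex $3\times 3$ matrix $E+\mathrm{i}H$ do not depend on the frame, up to complex conjugation if the orientation is reversed. The tensor $W$ is of Petrov–Bel type I, D, II, III or N if this minimal polynomial is, respectively, $(x-a)(x-b)(x-c)$,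 $(x-a)(x-b)$, $(x-a)^2(x-b)$, $x^3$ or $x^2$, with $a,b,c$ different complex numbers. Set $$\alpha=\tfrac12\sqrt{(T,T)},\quad (T,T)=T_{\alpha\beta\lambda\mu}T^{\alpha\beta\lambda\mu},\qquad \xi=\tfrac14\left(|\rho_1|^2+|\rho_2|^2+|\rho_3|^2\right).$$ An observer is a vector $u$ with $g(u,u)=-1$; put $q=-T(u,u,u)$ and $(q,q)=q_aq^a$. A principal observer is an observer $e_0$ that belongs to an orthonormal frame $e_0,e_1,e_2,e_3$ in which $E$ and $H$ are both diagonal. A fundamental vector is a null vector $\ell\neq0$ with $W_{abc[d}\,\ell_{f]}\,\ell^b\ell^c=0$ (a multiple Debever vector). Then, for every observer $u$: - for type N, $(q,q)=-\xi^2=-\frac14\alpha^2=0$; - for type III, $(q,q)<-\xi^2=-\frac14\alpha^2=0$; - for type II, $(q,q)<-\xi^2=-\frac14\alpha^2<0$; - for type D, $(q,q)\le-\xi^2=-\frac14\alpha^2<0$; - for type I, $(q,q)\le-\xi^2\le-\frac14\alpha^2\le0$. Moreover: (i) for types I and D, principal observers exist, and $(q_0,q_0)=-\xi^2$ for $q_0=-T(e_0,e_0,e_0)$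 with any principal observer $e_0$; (ii) for types III and II, there is a fundamental vector $\ell$, unique up to a scalar factor, and $(q,q)\to-\xi^2$ as the velocity vector $u$ of the observer approaches the line $\mathbb{R}\ell$, i.e. $(q_n,q_n)\to-\xi^2$, where $q_n=-T(u_n,u_n,u_n)$, for all sequences of observers $u_n$ such that $u_n-a_n\ell\to0$ for some real numbers $a_n$. -/

import Mathlib

/-!
Pointwise Bel-Robinson algebra.  `V` is the tangent space at a point of a spacetime, `g` the metric
at that point (signature `(-,+,+,+)`), `e` an orthonormal frame used to contract indices and to fix
the orientation, and `W` the covariant Weyl tensor at the point.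
-/

namespace BelRobinson

noncomputable section

variable {V : Type*} [AddCommGroup V] [Module ℝ V]

/-- The diagonal entries of the Minkowski metric `diag(-1,1,1,1)`. -/
def eta (a : Fin 4) : ℝ := if a = 0 then -1 else 1

/-- `e` is an orthonormal frame for `g`; its existence says that `g` is a Lorentzian metric on a
four-dimensional space. -/
def IsOrthonormalFrame (g : V →ₗ[ℝ] V →ₗ[ℝ] ℝ) (e : Module.Basis (Fin 4) ℝ V) : Prop :=
  ∀ a b, g (e a) (e b) = if a = b then eta a else 0

/-- The algebraic properties of the Weyl tensor: skew in each pair, the cyclic identity, and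
vanishing trace. -/
structure IsWeylTensor (e : Module.Basis (Fin 4) ℝ V)
    (W : V →ₗ[ℝ] V →ₗ[ℝ] V →ₗ[ℝ] V →ₗ[ℝ] ℝ) : Prop where
  skew_left : ∀ x y z w, W x y z w = -W y x z w
  skew_right : ∀ x y z w, W x y z w = -W x y w z
  cyclic : ∀ x y z w, W x y z w + W x z w y + W x w y z = 0
  trace_zero : ∀ x y, ∑ a, eta a * W (e a) x (e a) y = 0

/-- The Hodge dual on the first pair, `(*W)_{abcd} = (1/2) ε_{ab}^{ef} W_{efcd}`, where
`ε = e.det` is the volume form. -/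
def dualWeyl (e : Module.Basis (Fin 4) ℝ V) (W : V →ₗ[ℝ] V →ₗ[ℝ] V →ₗ[ℝ] V →ₗ[ℝ] ℝ)
    (x y z w : V) : ℝ :=
  (1 / 2) * ∑ a, ∑ b, eta a * eta b * e.det ![x, y, e a, e b] * W (e a) (e b) z w

/-- The Bel-Robinson tensor
`T_{ambn} = (1/4) (W_a^r_b^s W_{mrns} + *W_a^r_b^s *W_{mrns})`, as `belRobinson e W x_a x_m x_b x_n`. -/
def belRobinson (e : Module.Basis (Fin 4) ℝ V) (W : V →ₗ[ℝ] V →ₗ[ℝ] V →ₗ[ℝ] V →ₗ[ℝ] ℝ)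
    (x y z w : V) : ℝ :=
  (1 / 4) * ∑ r, ∑ s, eta r * eta s *
    (W x (e r) z (e s) * W y (e r) w (e s)
      + dualWeyl e W x (e r) z (e s) * dualWeyl e W y (e r) w (e s))

/-- The full contraction `(T,T) = T_{abcd} T^{abcd}`. -/
def belRobinsonSq (e : Module.Basis (Fin 4) ℝ V)
    (W : V →ₗ[ℝ] V →ₗ[ℝ] V →ₗ[ℝ] V →ₗ[ℝ] ℝ) : ℝ :=
  ∑ a, ∑ b, ∑ c, ∑ d, eta a * eta b * eta c * eta d *
    belRobinson e W (e a) (e b) (e c) (e d) ^ 2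

/-- The invariant `α = (1/2) √(T,T)`. -/
def alpha (e : Module.Basis (Fin 4) ℝ V) (W : V →ₗ[ℝ] V →ₗ[ℝ] V →ₗ[ℝ] V →ₗ[ℝ] ℝ) : ℝ :=
  (1 / 2) * Real.sqrt (belRobinsonSq e W)

/-- The complex Weyl matrix `E + iH`, where `E_{ij} = W(e_i,e_0,e_j,e_0)` and
`H_{ij} = *W(e_i,e_0,e_j,e_0)` are the electric and magnetic parts of `W`, `i, j = 1, 2, 3`.
It represents `W` acting on self-dual bivectors. -/
def weylMatrix (e : Module.Basis (Fin 4) ℝ V) (W : V →ₗ[ℝ] V →ₗ[ℝ] V →ₗ[ℝ] V →ₗ[ℝ] ℝ) :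
    Matrix (Fin 3) (Fin 3) ℂ :=
  Matrix.of fun i j =>
    ((W (e i.succ) (e 0) (e j.succ) (e 0) : ℝ) : ℂ)
      + Complex.I * ((dualWeyl e W (e i.succ) (e 0) (e j.succ) (e 0) : ℝ) : ℂ)

/-- The proper super-energy density `ξ = (1/4) (t₁ + t₂ + t₃)`, where `t_k = |ρ_k|²` and
`ρ₁, ρ₂, ρ₃` are the Weyl eigenvalues with multiplicity. -/
def xi (e : Module.Basis (Fin 4) ℝ V) (W : V →ₗ[ℝ] V →ₗ[ℝ] V →ₗ[ℝ] V →ₗ[ℝ] ℝ) : ℝ :=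
  (1 / 4) * ((weylMatrix e W).charpoly.roots.map fun ρ => ‖ρ‖ ^ 2).sum

section Petrov

open Polynomial

/-- Petrov-Bel type I: three different Weyl eigenvalues. -/
def IsTypeI (e : Module.Basis (Fin 4) ℝ V)
    (W : V →ₗ[ℝ] V →ₗ[ℝ] V →ₗ[ℝ] V →ₗ[ℝ] ℝ) : Prop :=
  ∃ a b c : ℂ, a ≠ b ∧ a ≠ c ∧ b ≠ c ∧
    minpoly ℂ (weylMatrix e W) = (X - C a) * (X - C b) * (X - C c)

/-- Petrov-Bel type D: two different Weyl eigenvalues, diagonalizable. -/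
def IsTypeD (e : Module.Basis (Fin 4) ℝ V)
    (W : V →ₗ[ℝ] V →ₗ[ℝ] V →ₗ[ℝ] V →ₗ[ℝ] ℝ) : Prop :=
  ∃ a b : ℂ, a ≠ b ∧ minpoly ℂ (weylMatrix e W) = (X - C a) * (X - C b)

/-- Petrov-Bel type II: two different Weyl eigenvalues, not diagonalizable. -/
def IsTypeII (e : Module.Basis (Fin 4) ℝ V)
    (W : V →ₗ[ℝ] V →ₗ[ℝ] V →ₗ[ℝ] V →ₗ[ℝ] ℝ) : Prop :=
  ∃ a b : ℂ, a ≠ b ∧ minpoly ℂ (weylMatrix e W) = (X - C a) ^ 2 * (X - C b)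

/-- Petrov-Bel type III: nilpotent of index three. -/
def IsTypeIII (e : Module.Basis (Fin 4) ℝ V)
    (W : V →ₗ[ℝ] V →ₗ[ℝ] V →ₗ[ℝ] V →ₗ[ℝ] ℝ) : Prop :=
  minpoly ℂ (weylMatrix e W) = X ^ 3

/-- Petrov-Bel type N: nilpotent of index two. -/
def IsTypeN (e : Module.Basis (Fin 4) ℝ V)
    (W : V →ₗ[ℝ] V →ₗ[ℝ] V →ₗ[ℝ] V →ₗ[ℝ] ℝ) : Prop :=
  minpoly ℂ (weylMatrix e W) = X ^ 2

end Petrov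

/-- An observer is a unit timelike vector (of either time orientation). -/
def IsObserver (g : V →ₗ[ℝ] V →ₗ[ℝ] ℝ) (u : V) : Prop := g u u = -1

/-- The covector `q = -T(u,u,u)`. -/
def superMomentum (e : Module.Basis (Fin 4) ℝ V)
    (W : V →ₗ[ℝ] V →ₗ[ℝ] V →ₗ[ℝ] V →ₗ[ℝ] ℝ) (u x : V) : ℝ :=
  -belRobinson e W x u u u

/-- The scalar `(q,q) = q_a q^a` for `q = -T(u,u,u)`. -/
def qq (e : Module.Basis (Fin 4) ℝ V) (W : V →ₗ[ℝ] V →ₗ[ℝ] V →ₗ[ℝ] V →ₗ[ℝ] ℝ) (u : V) : ℝ :=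
  ∑ a, eta a * superMomentum e W u (e a) ^ 2

/-- A principal observer: the timelike vector of an orthonormal frame in which the electric and
magnetic Weyl tensors of that observer are simultaneously diagonal. -/
def IsPrincipalObserver (g : V →ₗ[ℝ] V →ₗ[ℝ] ℝ) (e : Module.Basis (Fin 4) ℝ V)
    (W : V →ₗ[ℝ] V →ₗ[ℝ] V →ₗ[ℝ] V →ₗ[ℝ] ℝ) (u : V) : Prop :=
  ∃ f : Module.Basis (Fin 4) ℝ V, IsOrthonormalFrame g f ∧ f 0 = u ∧
    ∀ i j : Fin 3, i ≠ j →
      W (f i.succ) u (f j.succ) u = 0 ∧ dualWeyl e W (f i.succ) u (f j.succ) u = 0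

/-- `ℓ` spans a fundamental direction: a multiple Debever (principal null) direction, that is,
a nonzero null vector with `W_{abc[d} ℓ_{f]} ℓ^b ℓ^c = 0`. -/
def IsFundamental (g : V →ₗ[ℝ] V →ₗ[ℝ] ℝ) (W : V →ₗ[ℝ] V →ₗ[ℝ] V →ₗ[ℝ] V →ₗ[ℝ] ℝ)
    (l : V) : Prop :=
  l ≠ 0 ∧ g l l = 0 ∧ ∀ x y z, W x l l y * g l z = W x l l z * g l y

/-- The vectors `u n` approach the line spanned by `l`: some `u n - a n • l` tend to zero (written
in components, which for a finite-dimensional space is convergence in its only vector topology). -/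
def ApproachesDirection (e : Module.Basis (Fin 4) ℝ V) (l : V) (u : ℕ → V) : Prop :=
  ∃ a : ℕ → ℝ, ∀ i, Filter.Tendsto (fun n => e.repr (u n - a n • l) i) Filter.atTop (nhds 0)

/-- There is a fundamental direction, it is unique, and `(q,q) → -ξ²` as the velocity vector of the
observer approaches it. -/
def TendsAlongFundamental (g : V →ₗ[ℝ] V →ₗ[ℝ] ℝ) (e : Module.Basis (Fin 4) ℝ V)
    (W : V →ₗ[ℝ] V →ₗ[ℝ] V →ₗ[ℝ] V →ₗ[ℝ] ℝ) : Prop :=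
  ∃ l : V, IsFundamental g W l ∧
    (∀ l' : V, IsFundamental g W l' → ∃ c : ℝ, l' = c • l) ∧
    ∀ u : ℕ → V, (∀ n, IsObserver g (u n)) → ApproachesDirection e l u →
      Filter.Tendsto (fun n => qq e W (u n)) Filter.atTop (nhds (-xi e W ^ 2))

end

end BelRobinson

/-! ### Self-dual bivectors and the Hodge dual in components -/

namespace BelRobinson

noncomputable section

open Matrix

variable {V : Type*} [AddCommGroup V] [Module ℝ V]

/-! The tensor W + i*W is self-dual in both pairs, so it is the quadratic form of the complex
symmetric trace-free matrix Q = E + iH on self-dual bivectors (`weylC_eq`). A change of orthonormal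
frame conjugates Q by a complex orthogonal matrix. This keeps traces and the characteristic
polynomial but not the Frobenius norm, and the observer enters (q,q) only through such a norm.

Let P be the matrix Q in a frame of the observer u. The components of q are Hermitian products of
rows of P, and a polynomial identity for symmetric trace-free matrices gives -16 (q,q) = 3‖P²‖² -
|tr Q²|²/2 (`qq_eq`). The same identity for the diagonal matrix of eigenvalues gives 16 ξ² = 3
Σ|ρ_k|⁴ - |tr Q²|²/2 (`normSq_sum_identity`). Hence (q,q) = -ξ² - (3/16)(‖P²‖² - Σ|ρ_k|⁴), and
Schur's inequality for P² makes the bracket nonnegative (`schur_sq`, `qq_le`). Equality forces Q² to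
be diagonalizable, which fails for type II; in type III all ρ_k vanish but Q² does not; in type N Q²
= 0.

The Bel-Robinson tensor is Q ⊗ Q̄ carried over to trace-free symmetric tensors by a map that is
isometric up to a factor, so (T,T) = |tr Q²|² (`belRobinsonSq_eq`). Comparing ξ with α is then the
triangle inequality for Σρ_k². It is an equality when the trace-free eigenvalues are x, x, -2x.

For types I and D, two simple roots of the minimal polynomial have non-null eigenvectors,
orthonormal after scaling. Such a pair of complex vectors is realized by a real Lorentz frame
(`exists_frame_of_orthonormal`), in which P is diagonal, so the Schur gap closes.

For types II and III, Q has a null eigenvector n, and null lines of ℂ³ correspond to null lines of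
V. The line of n corresponds to a fundamental direction exactly when n is an eigenvector
(`isFundamental_nullVec`, `exists_eigenvalue_of_isFundamental`), and `null_eigenvector_unique` gives
uniqueness. As u approaches that line, the terms of P² containing n die out and ‖P²‖² tends to
18|σ|⁴, where σ is the eigenvalue of n; this is the value that yields -ξ² (`tendsto_qq`). -/

/-- The components of the self-dual part of the bivector `x ∧ y`. -/
def bivec (e : Module.Basis (Fin 4) ℝ V) (x y : V) : Fin 3 → ℂ :=
  ![((e.repr x 1 * e.repr y 0 - e.repr x 0 * e.repr y 1 : ℝ) : ℂ)
      + Complex.I * ((e.repr x 2 * e.repr y 3 - e.repr x 3 * e.repr y 2 : ℝ) : ℂ),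
    ((e.repr x 2 * e.repr y 0 - e.repr x 0 * e.repr y 2 : ℝ) : ℂ)
      + Complex.I * ((e.repr x 3 * e.repr y 1 - e.repr x 1 * e.repr y 3 : ℝ) : ℂ),
    ((e.repr x 3 * e.repr y 0 - e.repr x 0 * e.repr y 3 : ℝ) : ℂ)
      + Complex.I * ((e.repr x 1 * e.repr y 2 - e.repr x 2 * e.repr y 1 : ℝ) : ℂ)]

lemma bivec_add_left (e : Module.Basis (Fin 4) ℝ V) (x x' y : V) :
    bivec e (x + x') y = bivec e x y + bivec e x' y := by
  ext i; fin_cases i <;> simp [bivec] <;> ring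

lemma bivec_smul_left (e : Module.Basis (Fin 4) ℝ V) (c : ℝ) (x y : V) :
    bivec e (c • x) y = (c : ℂ) • bivec e x y := by
  ext i; fin_cases i <;> simp [bivec] <;> ring

lemma bivec_swap (e : Module.Basis (Fin 4) ℝ V) (x y : V) : bivec e x y = -bivec e y x := by
  ext i; fin_cases i <;> simp [bivec] <;> ring

lemma bivec_self (e : Module.Basis (Fin 4) ℝ V) (x : V) : bivec e x x = 0 := by
  ext i; fin_cases i <;> simp [bivec] <;> ring

lemma bivec_add_right (e : Module.Basis (Fin 4) ℝ V) (x y y' : V) :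
    bivec e x (y + y') = bivec e x y + bivec e x y' := by
  ext i; fin_cases i <;> simp [bivec] <;> ring

lemma bivec_smul_right (e : Module.Basis (Fin 4) ℝ V) (c : ℝ) (x y : V) :
    bivec e x (c • y) = (c : ℂ) • bivec e x y := by
  ext i; fin_cases i <;> simp [bivec] <;> ring

lemma apply_eq_sum_of_skew (e : Module.Basis (Fin 4) ℝ V) (B : V →ₗ[ℝ] V →ₗ[ℝ] ℝ)
    (hB : ∀ x y, B x y = -B y x) (x y : V) :
    B x y = (e.repr x 1 * e.repr y 0 - e.repr x 0 * e.repr y 1) * B (e 1) (e 0)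
      + (e.repr x 2 * e.repr y 0 - e.repr x 0 * e.repr y 2) * B (e 2) (e 0)
      + (e.repr x 3 * e.repr y 0 - e.repr x 0 * e.repr y 3) * B (e 3) (e 0)
      + (e.repr x 2 * e.repr y 3 - e.repr x 3 * e.repr y 2) * B (e 2) (e 3)
      + (e.repr x 3 * e.repr y 1 - e.repr x 1 * e.repr y 3) * B (e 3) (e 1)
      + (e.repr x 1 * e.repr y 2 - e.repr x 2 * e.repr y 1) * B (e 1) (e 2) := by
  have h0 : ∀ z, B z z = 0 := fun z => by linarith [hB z z]
  conv_lhs => rw [← e.sum_repr x, ← e.sum_repr y]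
  simp only [Fin.sum_univ_four, map_add, map_smul, LinearMap.add_apply, LinearMap.smul_apply,
    smul_eq_mul, h0]
  rw [hB (e 0) (e 1), hB (e 0) (e 2), hB (e 0) (e 3), hB (e 3) (e 2), hB (e 1) (e 3),
    hB (e 2) (e 1)]
  ring

/-- Laplace expansion along pairs: the minors that appear are those that make up `bivec`, so the
volume form can be compared with dot products of bivectors. -/
lemma det_eq (e : Module.Basis (Fin 4) ℝ V) (x y z w : V) :
    e.det ![x, y, z, w] =
      (e.repr x 0 * e.repr y 1 - e.repr x 1 * e.repr y 0)
          * (e.repr z 2 * e.repr w 3 - e.repr z 3 * e.repr w 2)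
        + (e.repr x 0 * e.repr y 2 - e.repr x 2 * e.repr y 0)
          * (e.repr z 3 * e.repr w 1 - e.repr z 1 * e.repr w 3)
        + (e.repr x 0 * e.repr y 3 - e.repr x 3 * e.repr y 0)
          * (e.repr z 1 * e.repr w 2 - e.repr z 2 * e.repr w 1)
        + (e.repr x 2 * e.repr y 3 - e.repr x 3 * e.repr y 2)
          * (e.repr z 0 * e.repr w 1 - e.repr z 1 * e.repr w 0)
        + (e.repr x 3 * e.repr y 1 - e.repr x 1 * e.repr y 3)
          * (e.repr z 0 * e.repr w 2 - e.repr z 2 * e.repr w 0)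
        + (e.repr x 1 * e.repr y 2 - e.repr x 2 * e.repr y 1)
          * (e.repr z 0 * e.repr w 3 - e.repr z 3 * e.repr w 0) := by
  have h1 : ∀ a : Fin 3, (Fin.succAbove (1 : Fin 4) a) = ![0, 2, 3] a := by decide
  have h2 : ∀ a : Fin 3, (Fin.succAbove (2 : Fin 4) a) = ![0, 1, 3] a := by decide
  have h3 : ∀ a : Fin 3, (Fin.succAbove (3 : Fin 4) a) = ![0, 1, 2] a := by decide
  have h4 : ∀ a : Fin 3, (Fin.succAbove (0 : Fin 4) a) = ![1, 2, 3] a := by decide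
  rw [Module.Basis.det_apply, Matrix.det_succ_column_zero]
  simp [Fin.sum_univ_four, Matrix.det_fin_three, Module.Basis.toMatrix_apply, h1, h2, h3, h4]
  ring

lemma dualWeyl_eq (e : Module.Basis (Fin 4) ℝ V) (W : V →ₗ[ℝ] V →ₗ[ℝ] V →ₗ[ℝ] V →ₗ[ℝ] ℝ)
    (hW : ∀ x y z w, W x y z w = -W y x z w) (x y z w : V) :
    dualWeyl e W x y z w =
      -(e.repr x 1 * e.repr y 0 - e.repr x 0 * e.repr y 1) * W (e 2) (e 3) z w
      - (e.repr x 2 * e.repr y 0 - e.repr x 0 * e.repr y 2) * W (e 3) (e 1) z w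
      - (e.repr x 3 * e.repr y 0 - e.repr x 0 * e.repr y 3) * W (e 1) (e 2) z w
      + (e.repr x 2 * e.repr y 3 - e.repr x 3 * e.repr y 2) * W (e 1) (e 0) z w
      + (e.repr x 3 * e.repr y 1 - e.repr x 1 * e.repr y 3) * W (e 2) (e 0) z w
      + (e.repr x 1 * e.repr y 2 - e.repr x 2 * e.repr y 1) * W (e 3) (e 0) z w := by
  have h0 : ∀ a, W a a z w = 0 := fun a => by linarith [hW a a z w]
  simp only [dualWeyl, Fin.sum_univ_four, h0]
  rw [hW (e 0) (e 1), hW (e 0) (e 2), hW (e 0) (e 3), hW (e 3) (e 2), hW (e 1) (e 3),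
    hW (e 2) (e 1)]
  simp only [det_eq, eta]
  simp
  ring

end

end BelRobinson

/-! ### The Weyl tensor as a quadratic form on self-dual bivectors -/

namespace BelRobinson

noncomputable section

open Matrix

variable {V : Type*} [AddCommGroup V] [Module ℝ V]

/-- The octahedron argument: the four cyclic identities combined with skewness in each pair. The
trace condition plays no part. -/
lemma IsWeylTensor.pair_symm {e : Module.Basis (Fin 4) ℝ V}
    {W : V →ₗ[ℝ] V →ₗ[ℝ] V →ₗ[ℝ] V →ₗ[ℝ] ℝ} (hW : IsWeylTensor e W) (x y z w : V) :
    W x y z w = W z w x y := by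
  linarith [hW.cyclic x y z w, hW.cyclic y z w x, hW.cyclic z w x y, hW.cyclic w x y z,
    hW.skew_left x y z w, hW.skew_right x y z w, hW.skew_left x z w y, hW.skew_right x z w y,
    hW.skew_left x w y z, hW.skew_right x w y z, hW.skew_left y z w x, hW.skew_right y z w x,
    hW.skew_left y w x z, hW.skew_right y w x z, hW.skew_left y x z w, hW.skew_right y x z w,
    hW.skew_left z w x y, hW.skew_right z w x y, hW.skew_left z x y w, hW.skew_right z x y w,
    hW.skew_left z y w x, hW.skew_right z y w x, hW.skew_left w x y z, hW.skew_right w x y z,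
    hW.skew_left w y z x, hW.skew_right w y z x, hW.skew_left w z x y, hW.skew_right w z x y]

/-- The complex Weyl tensor `W + i *W`. -/
def weylC (e : Module.Basis (Fin 4) ℝ V) (W : V →ₗ[ℝ] V →ₗ[ℝ] V →ₗ[ℝ] V →ₗ[ℝ] ℝ)
    (x y z w : V) : ℂ :=
  (W x y z w : ℂ) + Complex.I * (dualWeyl e W x y z w : ℂ)

section

variable {e : Module.Basis (Fin 4) ℝ V} {W : V →ₗ[ℝ] V →ₗ[ℝ] V →ₗ[ℝ] V →ₗ[ℝ] ℝ}

/-- Since ** = -1, the value of W + i*W on `e 2`, `e 3` is i times its value on `e 1`, `e 0`, and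
cyclically. Three of the six components therefore suffice. -/
lemma weylC_expand_left (hW : IsWeylTensor e W) (x y z w : V) :
    weylC e W x y z w = bivec e x y 0 * weylC e W (e 1) (e 0) z w
      + bivec e x y 1 * weylC e W (e 2) (e 0) z w
      + bivec e x y 2 * weylC e W (e 3) (e 0) z w := by
  have h := apply_eq_sum_of_skew e
    (LinearMap.mk₂ ℝ (fun x y => W x y z w) (by simp) (by simp) (by simp) (by simp))
    (fun x y => hW.skew_left x y z w) x y
  simp only [LinearMap.mk₂_apply] at h
  simp only [weylC, h, dualWeyl_eq e W hW.skew_left]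
  simp [bivec]
  linear_combination ((((e.repr x 2 : ℂ) * e.repr y 3 - e.repr x 3 * e.repr y 2) * W (e 2) (e 3) z w
    + ((e.repr x 3 : ℂ) * e.repr y 1 - e.repr x 1 * e.repr y 3) * W (e 3) (e 1) z w
    + ((e.repr x 1 : ℂ) * e.repr y 2 - e.repr x 2 * e.repr y 1) * W (e 1) (e 2) z w))
      * Complex.I_sq

lemma trace_components (hW : IsWeylTensor e W) :
    W (e 1) (e 0) (e 1) (e 0) + W (e 2) (e 0) (e 2) (e 0) + W (e 3) (e 0) (e 3) (e 0) = 0 := by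
  have h := hW.trace_zero (e 0) (e 0)
  simp [Fin.sum_univ_four, eta] at h
  linarith [hW.skew_left (e 0) (e 0) (e 0) (e 0)]

/-- The spatial trace conditions, together with tr E = 0, determine the purely spatial components by
E. With `mixed_components`, this says that the left and right duals of W agree. -/
lemma pair_components (hW : IsWeylTensor e W) :
    W (e 2) (e 3) (e 2) (e 3) = -W (e 1) (e 0) (e 1) (e 0) ∧
    W (e 3) (e 1) (e 3) (e 1) = -W (e 2) (e 0) (e 2) (e 0) ∧
    W (e 1) (e 2) (e 1) (e 2) = -W (e 3) (e 0) (e 3) (e 0) ∧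
    W (e 2) (e 3) (e 3) (e 1) = -W (e 1) (e 0) (e 2) (e 0) ∧
    W (e 2) (e 3) (e 1) (e 2) = -W (e 1) (e 0) (e 3) (e 0) ∧
    W (e 3) (e 1) (e 1) (e 2) = -W (e 2) (e 0) (e 3) (e 0) := by
  have sw : ∀ x y z w, W x y z w = W y x w z := fun x y z w => by
    rw [hW.skew_left, hW.skew_right, neg_neg]
  have h0 := trace_components hW
  have z : ∀ x z w, W x x z w = 0 := fun x z w => by linarith [hW.skew_left x x z w]
  have z' : ∀ x y z, W x y z z = 0 := fun x y z => by linarith [hW.skew_right x y z z]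
  have h11 := hW.trace_zero (e 1) (e 1)
  have h22 := hW.trace_zero (e 2) (e 2)
  have h33 := hW.trace_zero (e 3) (e 3)
  have h12 := hW.trace_zero (e 1) (e 2)
  have h13 := hW.trace_zero (e 1) (e 3)
  have h23 := hW.trace_zero (e 2) (e 3)
  simp [Fin.sum_univ_four, eta, z, z'] at h11 h22 h33 h12 h13 h23
  have a1 := sw (e 1) (e 0) (e 1) (e 0)
  have a2 := sw (e 2) (e 0) (e 2) (e 0)
  have a3 := sw (e 3) (e 0) (e 3) (e 0)
  have b1 := sw (e 1) (e 2) (e 1) (e 2)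
  have b2 := sw (e 2) (e 3) (e 2) (e 3)
  have b3 := sw (e 3) (e 1) (e 3) (e 1)
  have c1 := sw (e 1) (e 0) (e 2) (e 0)
  have c2 := sw (e 1) (e 0) (e 3) (e 0)
  have c3 := sw (e 2) (e 0) (e 3) (e 0)
  have d1 := hW.skew_right (e 2) (e 3) (e 3) (e 1)
  have d2 := hW.skew_right (e 2) (e 3) (e 1) (e 2)
  have d3 := hW.skew_right (e 3) (e 1) (e 1) (e 2)
  have d1' := hW.pair_symm (e 2) (e 3) (e 1) (e 3)
  have d1'' := sw (e 3) (e 1) (e 3) (e 2)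
  have d1''' := hW.pair_symm (e 3) (e 1) (e 3) (e 2)
  have d2' := sw (e 2) (e 3) (e 2) (e 1)
  have d2'' := hW.pair_symm (e 2) (e 3) (e 2) (e 1)
  have d3' := hW.pair_symm (e 3) (e 1) (e 2) (e 1)
  have d3'' := sw (e 1) (e 2) (e 1) (e 3)
  have d3''' := hW.pair_symm (e 1) (e 2) (e 1) (e 3)
  refine ⟨?_, ?_, ?_, ?_, ?_, ?_⟩ <;> linarith

/-- The traces with one time index make H symmetric; the cyclic identity makes it trace-free. -/
lemma mixed_components (hW : IsWeylTensor e W) :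
    W (e 2) (e 3) (e 2) (e 0) = W (e 3) (e 1) (e 1) (e 0) ∧
    W (e 2) (e 3) (e 3) (e 0) = W (e 1) (e 2) (e 1) (e 0) ∧
    W (e 3) (e 1) (e 3) (e 0) = W (e 1) (e 2) (e 2) (e 0) ∧
    W (e 2) (e 3) (e 1) (e 0) + W (e 3) (e 1) (e 2) (e 0) + W (e 1) (e 2) (e 3) (e 0) = 0 := by
  have z : ∀ x z w, W x x z w = 0 := fun x z w => by linarith [hW.skew_left x x z w]
  have z' : ∀ x y z, W x y z z = 0 := fun x y z => by linarith [hW.skew_right x y z z]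
  have h1 := hW.trace_zero (e 1) (e 0)
  have h2 := hW.trace_zero (e 2) (e 0)
  have h3 := hW.trace_zero (e 3) (e 0)
  simp [Fin.sum_univ_four, eta, z, z'] at h1 h2 h3
  have c := hW.cyclic (e 0) (e 1) (e 2) (e 3)
  have p1 := hW.pair_symm (e 0) (e 1) (e 2) (e 3)
  have p2 := hW.pair_symm (e 0) (e 2) (e 3) (e 1)
  have p3 := hW.pair_symm (e 0) (e 3) (e 1) (e 2)
  have q1 := hW.skew_right (e 2) (e 3) (e 0) (e 1)
  have q2 := hW.skew_right (e 3) (e 1) (e 0) (e 2)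
  have q3 := hW.skew_right (e 1) (e 2) (e 0) (e 3)
  have r1 := hW.skew_left (e 2) (e 1) (e 2) (e 0)
  have r2 := hW.skew_left (e 3) (e 2) (e 3) (e 0)
  have r3 := hW.skew_left (e 1) (e 3) (e 1) (e 0)
  refine ⟨?_, ?_, ?_, ?_⟩ <;> linarith

lemma dualWeyl_basis (hW : IsWeylTensor e W) (z w : V) :
    dualWeyl e W (e 1) (e 0) z w = -W (e 2) (e 3) z w ∧
    dualWeyl e W (e 2) (e 0) z w = -W (e 3) (e 1) z w ∧
    dualWeyl e W (e 3) (e 0) z w = -W (e 1) (e 2) z w := by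
  refine ⟨?_, ?_, ?_⟩ <;> simp [dualWeyl_eq e W hW.skew_left]

lemma weylMatrix_transpose (hW : IsWeylTensor e W) : (weylMatrix e W)ᵀ = weylMatrix e W := by
  obtain ⟨h1, h2, h3, -⟩ := mixed_components hW
  have p1 := hW.pair_symm (e 1) (e 0) (e 2) (e 0)
  have p2 := hW.pair_symm (e 1) (e 0) (e 3) (e 0)
  have p3 := hW.pair_symm (e 2) (e 0) (e 3) (e 0)
  have d := dualWeyl_basis hW
  ext i j
  fin_cases i <;> fin_cases j <;>
    simp [weylMatrix, (d _ _).1, (d _ _).2.1, (d _ _).2.2, h1, h2, h3, p1, p2, p3]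

lemma weylMatrix_trace (hW : IsWeylTensor e W) : (weylMatrix e W).trace = 0 := by
  obtain ⟨-, -, -, h⟩ := mixed_components hW
  have h' := trace_components hW
  have d := dualWeyl_basis hW
  simp only [Matrix.trace_fin_three]
  apply Complex.ext
  · simp [weylMatrix]; linarith
  · simp [weylMatrix, (d _ _).1, (d _ _).2.1, (d _ _).2.2]; linarith

/-- Self-duality in the second pair. The dual is taken on the first pair only, so this needs the
trace conditions. -/
lemma weylC_basis (hW : IsWeylTensor e W) (i : Fin 3) (z w : V) :
    weylC e W (e i.succ) (e 0) z w = (weylMatrix e W *ᵥ bivec e z w) i := by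
  obtain ⟨a1, a2, a3, a4, a5, a6⟩ := pair_components hW
  obtain ⟨b1, b2, b3, b4⟩ := mixed_components hW
  have d := dualWeyl_basis hW
  have p1 := hW.pair_symm (e 1) (e 0) (e 2) (e 0)
  have p2 := hW.pair_symm (e 1) (e 0) (e 3) (e 0)
  have p3 := hW.pair_symm (e 2) (e 0) (e 3) (e 0)
  have q1 := hW.pair_symm (e 3) (e 1) (e 2) (e 3)
  have q2 := hW.pair_symm (e 1) (e 2) (e 2) (e 3)
  have q3 := hW.pair_symm (e 1) (e 2) (e 3) (e 1)
  have r : ∀ i : Fin 4, W (e i) (e 0) (e 2) (e 3) = W (e 2) (e 3) (e i) (e 0) :=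
    fun i => hW.pair_symm _ _ _ _
  have r' : ∀ i : Fin 4, W (e i) (e 0) (e 3) (e 1) = W (e 3) (e 1) (e i) (e 0) :=
    fun i => hW.pair_symm _ _ _ _
  have r'' : ∀ i : Fin 4, W (e i) (e 0) (e 1) (e 2) = W (e 1) (e 2) (e i) (e 0) :=
    fun i => hW.pair_symm _ _ _ _
  have ex : ∀ a b, W (e a) (e b) z w = _ := fun a b =>
    apply_eq_sum_of_skew e (W (e a) (e b)) (hW.skew_right _ _) z w
  fin_cases i <;>
  · simp [weylC, weylMatrix, Matrix.mulVec, dotProduct, Fin.sum_univ_three, (d _ _).1,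
      (d _ _).2.1, (d _ _).2.2, bivec]
    rw [ex, ex]
    apply Complex.ext <;>
    · simp [r 1, r 2, r 3, r' 1, r' 2, r' 3, r'' 1, r'' 2, r'' 3, q1, q2, q3, a1, a2,
        a3, a4, a5, a6, b1, b2, b3, p1, p2, p3]
      ring

/-- The complex Weyl tensor is the quadratic form of the Weyl matrix on self-dual bivectors. -/
lemma weylC_eq (hW : IsWeylTensor e W) (x y z w : V) :
    weylC e W x y z w = bivec e x y ⬝ᵥ (weylMatrix e W *ᵥ bivec e z w) := by
  rw [weylC_expand_left hW, dotProduct, Fin.sum_univ_three]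
  simp only [← weylC_basis hW]
  rfl

end

end

end BelRobinson

/-! ### Orthonormal frames as complex orthogonal matrices -/

namespace BelRobinson

noncomputable section

open Matrix

variable {V : Type*} [AddCommGroup V] [Module ℝ V]

lemma eta_mul_self (a : Fin 4) : eta a * eta a = 1 := by
  unfold eta; split_ifs <;> norm_num

section

variable {g : V →ₗ[ℝ] V →ₗ[ℝ] ℝ} {e f : Module.Basis (Fin 4) ℝ V}

lemma IsOrthonormalFrame.apply_eq (he : IsOrthonormalFrame g e) (x y : V) :
    g x y = -(e.repr x 0 * e.repr y 0) + e.repr x 1 * e.repr y 1 + e.repr x 2 * e.repr y 2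
      + e.repr x 3 * e.repr y 3 := by
  conv_lhs => rw [← e.sum_repr x, ← e.sum_repr y]
  simp only [Fin.sum_univ_four, map_add, map_smul, LinearMap.add_apply, LinearMap.smul_apply,
    smul_eq_mul, he _ _, eta]
  simp
  ring

lemma IsOrthonormalFrame.symm (he : IsOrthonormalFrame g e) (x y : V) : g x y = g y x := by
  rw [he.apply_eq, he.apply_eq]; ring

lemma IsOrthonormalFrame.repr_eq (hf : IsOrthonormalFrame g f) (x : V) (a : Fin 4) :
    f.repr x a = eta a * g x (f a) := by
  rw [hf.apply_eq]
  fin_cases a <;> simp [eta]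

/-- The metric on bivectors, and the volume form, through self-dual components. -/
lemma bivec_dotProduct (he : IsOrthonormalFrame g e) (x y z w : V) :
    bivec e x y ⬝ᵥ bivec e z w =
      ((-(g x z * g y w - g x w * g y z) : ℝ) : ℂ) - Complex.I * (e.det ![x, y, z, w] : ℝ) := by
  simp only [he.apply_eq, det_eq, bivec, dotProduct, Fin.sum_univ_three]
  apply Complex.ext <;> simp <;> ring

lemma det_self_right (e : Module.Basis (Fin 4) ℝ V) (x y u : V) : e.det ![x, u, y, u] = 0 := by
  rw [det_eq]; ring

lemma bivec_dotProduct_observer (he : IsOrthonormalFrame g e) (x y u : V) :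
    bivec e x u ⬝ᵥ bivec e y u = ((-(g x y * g u u - g x u * g u y) : ℝ) : ℂ) := by
  rw [bivec_dotProduct he, det_self_right]; simp

/-- The components, in the frame `e`, of the self-dual bivectors of the frame `f`. -/
def frameMatrix (e f : Module.Basis (Fin 4) ℝ V) : Matrix (Fin 3) (Fin 3) ℂ :=
  Matrix.of fun i => bivec e (f i.succ) (f 0)

/-- For bivectors sharing the factor `f 0` the volume term of `bivec_dotProduct` drops out. The
matrix is orthogonal, in general not unitary: traces will not see the frame, Frobenius norms will.
-/
lemma frameMatrix_mul_transpose (he : IsOrthonormalFrame g e) (hf : IsOrthonormalFrame g f) :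
    frameMatrix e f * (frameMatrix e f)ᵀ = 1 := by
  ext i j
  have : (frameMatrix e f * (frameMatrix e f)ᵀ) i j
      = bivec e (f i.succ) (f 0) ⬝ᵥ bivec e (f j.succ) (f 0) := rfl
  rw [this, bivec_dotProduct_observer he]
  simp [hf _ _, eta, Matrix.one_apply, apply_ite Complex.ofReal]

lemma frameMatrix_transpose_mul (he : IsOrthonormalFrame g e) (hf : IsOrthonormalFrame g f) :
    (frameMatrix e f)ᵀ * frameMatrix e f = 1 :=
  mul_eq_one_comm.mp (frameMatrix_mul_transpose he hf)

/-- Every complex vector is expanded in the self-dual bivectors `f_i ∧ f_0`. -/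
lemma eq_sum_bivec (he : IsOrthonormalFrame g e) (hf : IsOrthonormalFrame g f) (v : Fin 3 → ℂ) :
    v = (v ⬝ᵥ bivec e (f 1) (f 0)) • bivec e (f 1) (f 0)
      + (v ⬝ᵥ bivec e (f 2) (f 0)) • bivec e (f 2) (f 0)
      + (v ⬝ᵥ bivec e (f 3) (f 0)) • bivec e (f 3) (f 0) := by
  have h : v = ((frameMatrix e f)ᵀ * frameMatrix e f) *ᵥ v := by
    rw [frameMatrix_transpose_mul he hf, one_mulVec]
  rw [← mulVec_mulVec] at h
  conv_lhs => rw [h]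
  ext i
  simp only [mulVec, dotProduct, Fin.sum_univ_three, Matrix.transpose_apply, frameMatrix,
    Matrix.of_apply, Pi.add_apply, Pi.smul_apply, smul_eq_mul]
  simp only [Fin.succ_zero_eq_one, Fin.succ_one_eq_two, show (Fin.succ 2 : Fin 4) = 3 from rfl]
  ring

/-- `ε = 1` if the frame `f` is positively oriented in `e`, and `ε = -1` if not. -/
def IsOriented (e f : Module.Basis (Fin 4) ℝ V) (ε : ℝ) : Prop :=
  ε ^ 2 = 1 ∧
  bivec e (f 2) (f 3) = (Complex.I * ε) • bivec e (f 1) (f 0) ∧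
  bivec e (f 3) (f 1) = (Complex.I * ε) • bivec e (f 2) (f 0) ∧
  bivec e (f 1) (f 2) = (Complex.I * ε) • bivec e (f 3) (f 0)

/-- Each spatial bivector f_j ∧ f_k is orthogonal to two of the three f_i ∧ f_0, hence a multiple of
the remaining one. The factor is read off the volume form. -/
lemma exists_isOriented (he : IsOrthonormalFrame g e) (hf : IsOrthonormalFrame g f) :
    ∃ ε, IsOriented e f ε := by
  have d1 : e.det ![f 2, f 3, f 1, f 0] = e.det ![f 1, f 2, f 3, f 0] := by
    rw [det_eq, det_eq]; ring
  have d2 : e.det ![f 3, f 1, f 2, f 0] = e.det ![f 1, f 2, f 3, f 0] := by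
    rw [det_eq, det_eq]; ring
  have r1 : ∀ x y z, e.det ![x, y, x, z] = 0 := fun x y z => by rw [det_eq]; ring
  have r2 : ∀ x y z, e.det ![x, y, y, z] = 0 := fun x y z => by rw [det_eq]; ring
  have k1 : bivec e (f 2) (f 3)
      = (Complex.I * (-e.det ![f 1, f 2, f 3, f 0] : ℝ)) • bivec e (f 1) (f 0) := by
    rw [eq_sum_bivec he hf (bivec e (f 2) (f 3))]
    simp [bivec_dotProduct he, hf _ _, r1, r2, d1]
  have k2 : bivec e (f 3) (f 1)
      = (Complex.I * (-e.det ![f 1, f 2, f 3, f 0] : ℝ)) • bivec e (f 2) (f 0) := by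
    rw [eq_sum_bivec he hf (bivec e (f 3) (f 1))]
    simp [bivec_dotProduct he, hf _ _, r1, r2, d2]
  have k3 : bivec e (f 1) (f 2)
      = (Complex.I * (-e.det ![f 1, f 2, f 3, f 0] : ℝ)) • bivec e (f 3) (f 0) := by
    rw [eq_sum_bivec he hf (bivec e (f 1) (f 2))]
    simp [bivec_dotProduct he, hf _ _, r1, r2]
  refine ⟨-e.det ![f 1, f 2, f 3, f 0], ?_, k1, k2, k3⟩
  -- The square of f_1 ∧ f_2 is -1 by the metric and (iε)² by `k3`.
  have h := bivec_dotProduct he (f 1) (f 2) (f 1) (f 2)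
  rw [k3, r1] at h
  simp [bivec_dotProduct_observer he, hf _ _, eta, -Complex.ofReal_neg] at h
  have h' : (((-e.det ![f 1, f 2, f 3, f 0]) ^ 2 : ℝ) : ℂ) = ((1 : ℝ) : ℂ) := by
    push_cast at h ⊢
    linear_combination -h + (e.det ![f 1, f 2, f 3, f 0] : ℂ) ^ 2 * Complex.I_sq
  exact_mod_cast h'

/-- Contractions of indices do not depend on the orthonormal frame. -/
lemma sum_eta_mul (he : IsOrthonormalFrame g e) (hf : IsOrthonormalFrame g f) {φ ψ : V → ℂ}
    (hφ : IsLinearMap ℝ φ) (hψ : IsLinearMap ℝ ψ) :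
    ∑ a, (eta a : ℂ) * (φ (e a) * ψ (e a)) = ∑ a, (eta a : ℂ) * (φ (f a) * ψ (f a)) := by
  have hx : ∀ (h : V → ℂ), IsLinearMap ℝ h → ∀ (k : Module.Basis (Fin 4) ℝ V),
      IsOrthonormalFrame g k → ∀ x, h x = ∑ a, (eta a : ℂ) * (g x (k a) : ℂ) * h (k a) := by
    intro h hh k hk x
    conv_lhs => rw [← k.sum_repr x]
    rw [← hh.mk'_apply, map_sum]
    refine Finset.sum_congr rfl fun a _ => ?_
    rw [map_smul, hh.mk'_apply, hk.repr_eq]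
    simp
  calc ∑ a, (eta a : ℂ) * (φ (e a) * ψ (e a))
      = ∑ a, ∑ b, (eta a : ℂ) * ((eta b * (g (e a) (f b) : ℂ) * φ (f b)) * ψ (e a)) := by
        refine Finset.sum_congr rfl fun a _ => ?_
        conv_lhs => rw [hx φ hφ f hf (e a)]
        rw [Finset.sum_mul, Finset.mul_sum]
    _ = ∑ b, ∑ a, (eta b : ℂ) * φ (f b) * (eta a * (g (f b) (e a) : ℂ) * ψ (e a)) := by
        rw [Finset.sum_comm]
        refine Finset.sum_congr rfl fun b _ => Finset.sum_congr rfl fun a _ => ?_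
        rw [he.symm (e a) (f b)]; ring
    _ = _ := by
        refine Finset.sum_congr rfl fun b _ => ?_
        rw [← Finset.mul_sum, ← hx ψ hψ e he (f b), mul_assoc]

end

end

end BelRobinson

/-! ### The Bel-Robinson tensor and `q` in a frame of the observer -/

namespace BelRobinson

noncomputable section

open Matrix

/-- The square of the Frobenius norm. -/
def frobSq (M : Matrix (Fin 3) (Fin 3) ℂ) : ℝ := ∑ i, ∑ j, Complex.normSq (M i j)

variable {V : Type*} [AddCommGroup V] [Module ℝ V]

section

variable {g : V →ₗ[ℝ] V →ₗ[ℝ] ℝ} {e f : Module.Basis (Fin 4) ℝ V}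
  {W : V →ₗ[ℝ] V →ₗ[ℝ] V →ₗ[ℝ] V →ₗ[ℝ] ℝ}

lemma isLinearMap_weylC_two (hW : IsWeylTensor e W) (x z w : V) :
    IsLinearMap ℝ fun y => weylC e W x y z w := by
  constructor
  · intro y y'; simp [weylC_eq hW, bivec_add_right, add_dotProduct]
  · intro c y; simp [weylC_eq hW, bivec_smul_right, smul_dotProduct]

lemma isLinearMap_weylC_four (hW : IsWeylTensor e W) (x y z : V) :
    IsLinearMap ℝ fun w => weylC e W x y z w := by
  constructor
  · intro w w'; simp [weylC_eq hW, bivec_add_right, mulVec_add, dotProduct_add]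
  · intro c w; simp [weylC_eq hW, bivec_smul_right, mulVec_smul, dotProduct_smul]

lemma isLinearMap_conj {φ : V → ℂ} (h : IsLinearMap ℝ φ) :
    IsLinearMap ℝ fun x => starRingEnd ℂ (φ x) :=
  ⟨fun x y => by simp [h.map_add], fun c x => by simp [h.map_smul]⟩

/-- The Bel-Robinson tensor, with the contractions taken in any orthonormal frame. -/
lemma belRobinson_eq (he : IsOrthonormalFrame g e) (hf : IsOrthonormalFrame g f)
    (hW : IsWeylTensor e W) (x y z w : V) :
    belRobinson e W x y z w = (1 / 4) * (∑ r, ∑ s, (eta r : ℂ) * (eta s *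
      (weylC e W x (f r) z (f s) * starRingEnd ℂ (weylC e W y (f r) w (f s))))).re := by
  -- WW' + *W*W' is the real part of (W + i*W) times the conjugate of (W' + i*W').
  have h1 : belRobinson e W x y z w = (1 / 4) * (∑ r, ∑ s, (eta r : ℂ) * (eta s *
      (weylC e W x (e r) z (e s) * starRingEnd ℂ (weylC e W y (e r) w (e s))))).re := by
    simp only [belRobinson, Complex.re_sum]
    refine congrArg _ (Finset.sum_congr rfl fun r _ => Finset.sum_congr rfl fun s _ => ?_)
    simp [weylC]
    ring
  rw [h1]
  refine congrArg (fun c : ℂ => 1 / 4 * c.re) ?_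
  calc ∑ r, ∑ s, (eta r : ℂ) * (eta s *
      (weylC e W x (e r) z (e s) * starRingEnd ℂ (weylC e W y (e r) w (e s))))
      = ∑ r, ∑ s, (eta r : ℂ) * (eta s *
      (weylC e W x (e r) z (f s) * starRingEnd ℂ (weylC e W y (e r) w (f s)))) := by
        refine Finset.sum_congr rfl fun r _ => ?_
        rw [← Finset.mul_sum, ← Finset.mul_sum]
        refine congrArg (fun c => (eta r : ℂ) * c) ?_
        exact sum_eta_mul he hf (isLinearMap_weylC_four hW x (e r) z)
          (isLinearMap_conj (isLinearMap_weylC_four hW y (e r) w))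
    _ = ∑ s, ∑ r, (eta s : ℂ) * (eta r *
      (weylC e W x (e r) z (f s) * starRingEnd ℂ (weylC e W y (e r) w (f s)))) := by
        rw [Finset.sum_comm]
        refine Finset.sum_congr rfl fun r _ => Finset.sum_congr rfl fun s _ => by ring
    _ = ∑ s, ∑ r, (eta s : ℂ) * (eta r *
      (weylC e W x (f r) z (f s) * starRingEnd ℂ (weylC e W y (f r) w (f s)))) := by
        refine Finset.sum_congr rfl fun s _ => ?_
        rw [← Finset.mul_sum, ← Finset.mul_sum]
        refine congrArg (fun c => (eta s : ℂ) * c) ?_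
        have h := sum_eta_mul he hf (isLinearMap_weylC_two hW x z (f s))
          (isLinearMap_conj (isLinearMap_weylC_two hW y w (f s)))
        beta_reduce at h ⊢
        exact h
    _ = _ := by
        rw [Finset.sum_comm]
        refine Finset.sum_congr rfl fun r _ => Finset.sum_congr rfl fun s _ => by ring

lemma isLinearMap_superMomentum (hW : IsWeylTensor e W) (u : V) :
    IsLinearMap ℝ fun x => (superMomentum e W u x : ℂ) := by
  have ha : ∀ x x' y z w,
      dualWeyl e W (x + x') y z w = dualWeyl e W x y z w + dualWeyl e W x' y z w := by
    intro x x' y z w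
    simp only [dualWeyl_eq e W hW.skew_left, map_add, Finsupp.add_apply]; ring
  have hs : ∀ (c : ℝ) x y z w, dualWeyl e W (c • x) y z w = c * dualWeyl e W x y z w := by
    intro c x y z w
    simp only [dualWeyl_eq e W hW.skew_left, map_smul, Finsupp.smul_apply, smul_eq_mul]; ring
  constructor
  · intro x x'
    rw [← Complex.ofReal_add, Complex.ofReal_inj]
    simp only [superMomentum, belRobinson]
    rw [← neg_add, ← mul_add, ← Finset.sum_add_distrib]
    refine congrArg (fun c => -(1 / 4 * c)) (Finset.sum_congr rfl fun r _ => ?_)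
    rw [← Finset.sum_add_distrib]
    refine Finset.sum_congr rfl fun s _ => ?_
    simp only [ha, map_add, LinearMap.add_apply]; ring
  · intro c x
    rw [Complex.real_smul, ← Complex.ofReal_mul, Complex.ofReal_inj]
    simp only [superMomentum, belRobinson]
    rw [mul_neg, mul_left_comm c, Finset.mul_sum _ _ c]
    refine congrArg (fun c => -(1 / 4 * c)) (Finset.sum_congr rfl fun r _ => ?_)
    rw [Finset.mul_sum]
    refine Finset.sum_congr rfl fun s _ => ?_
    simp only [hs, map_smul, LinearMap.smul_apply, smul_eq_mul]; ring

lemma qq_eq_frame (he : IsOrthonormalFrame g e) (hf : IsOrthonormalFrame g f)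
    (hW : IsWeylTensor e W) (u : V) :
    qq e W u = ∑ a, eta a * superMomentum e W u (f a) ^ 2 := by
  have h := sum_eta_mul he hf (isLinearMap_superMomentum hW u) (isLinearMap_superMomentum hW u)
  simp only [qq, pow_two]
  exact_mod_cast h

/-- The Weyl matrix in the frame `f`. -/
def frameWeyl (e f : Module.Basis (Fin 4) ℝ V) (W : V →ₗ[ℝ] V →ₗ[ℝ] V →ₗ[ℝ] V →ₗ[ℝ] ℝ) :
    Matrix (Fin 3) (Fin 3) ℂ :=
  frameMatrix e f * weylMatrix e W * (frameMatrix e f)ᵀ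

lemma frameMatrix_mul_mul_apply (S : Matrix (Fin 3) (Fin 3) ℂ) (i j : Fin 3) :
    (frameMatrix e f * S * (frameMatrix e f)ᵀ) i j =
      bivec e (f i.succ) (f 0) ⬝ᵥ (S *ᵥ bivec e (f j.succ) (f 0)) := by
  have : (frameMatrix e f)ᵀ.col j = bivec e (f j.succ) (f 0) := rfl
  rw [Matrix.mul_assoc, Matrix.mul_apply]
  simp only [dotProduct]
  refine Finset.sum_congr rfl fun k _ => ?_
  rw [← this, ← Matrix.mulVec_single_one, mulVec_mulVec, mulVec_single_one]
  rfl

lemma frameWeyl_apply (i j : Fin 3) : frameWeyl e f W i j =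
    bivec e (f i.succ) (f 0) ⬝ᵥ (weylMatrix e W *ᵥ bivec e (f j.succ) (f 0)) :=
  frameMatrix_mul_mul_apply _ i j

lemma frameWeyl_eq_weylC (hW : IsWeylTensor e W) (i j : Fin 3) : frameWeyl e f W i j =
    weylC e W (f i.succ) (f 0) (f j.succ) (f 0) := by
  rw [frameWeyl_apply, weylC_eq hW]

lemma frameWeyl_transpose (hW : IsWeylTensor e W) : (frameWeyl e f W)ᵀ = frameWeyl e f W := by
  simp [frameWeyl, Matrix.transpose_mul, weylMatrix_transpose hW, Matrix.mul_assoc]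

lemma frameWeyl_trace (he : IsOrthonormalFrame g e) (hf : IsOrthonormalFrame g f)
    (hW : IsWeylTensor e W) : (frameWeyl e f W).trace = 0 := by
  rw [frameWeyl, Matrix.trace_mul_comm, ← Matrix.mul_assoc, frameMatrix_transpose_mul he hf,
    Matrix.one_mul, weylMatrix_trace hW]

lemma frameWeyl_sq (he : IsOrthonormalFrame g e) (hf : IsOrthonormalFrame g f) :
    frameWeyl e f W ^ 2 = frameMatrix e f * weylMatrix e W ^ 2 * (frameMatrix e f)ᵀ := by
  rw [frameWeyl, pow_two, pow_two]
  simp only [Matrix.mul_assoc]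
  rw [← Matrix.mul_assoc (frameMatrix e f)ᵀ, frameMatrix_transpose_mul he hf, Matrix.one_mul]

lemma frameWeyl_sq_trace (he : IsOrthonormalFrame g e) (hf : IsOrthonormalFrame g f) :
    (frameWeyl e f W ^ 2).trace = (weylMatrix e W ^ 2).trace := by
  rw [frameWeyl_sq he hf, Matrix.trace_mul_comm, ← Matrix.mul_assoc,
    frameMatrix_transpose_mul he hf, Matrix.one_mul]

/-- Every bivector of the frame is 0 or ±1, ±iε times some f_i ∧ f_0, so only entries of `P`
survive. The energy component collects the norms of the rows, the super-Poynting components the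
Hermitian products of different rows. -/
lemma superMomentum_frame (he : IsOrthonormalFrame g e) (hf : IsOrthonormalFrame g f)
    (hW : IsWeylTensor e W) {ε : ℝ} (hε : IsOriented e f ε) {P : Matrix (Fin 3) (Fin 3) ℂ}
    (hP : frameWeyl e f W = P) :
    superMomentum e W (f 0) (f 0) = -(1 / 4) * frobSq P ∧
    superMomentum e W (f 0) (f 1) = ε / 2 * ∑ s, (P 1 s * starRingEnd ℂ (P 2 s)).im ∧
    superMomentum e W (f 0) (f 2) = ε / 2 * ∑ s, (P 2 s * starRingEnd ℂ (P 0 s)).im ∧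
    superMomentum e W (f 0) (f 3) = ε / 2 * ∑ s, (P 0 s * starRingEnd ℂ (P 1 s)).im := by
  obtain ⟨-, h23, h31, h12⟩ := hε
  have hP' : ∀ i j : Fin 3, bivec e (f i.succ) (f 0) ⬝ᵥ
      (weylMatrix e W *ᵥ bivec e (f j.succ) (f 0)) = P i j := by
    intro i j; rw [← hP, frameWeyl_apply]
  have p00 := hP' 0 0
  have p01 := hP' 0 1
  have p02 := hP' 0 2
  have p10 := hP' 1 0
  have p11 := hP' 1 1
  have p12 := hP' 1 2
  have p20 := hP' 2 0
  have p21 := hP' 2 1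
  have p22 := hP' 2 2
  simp only [Fin.succ_zero_eq_one, Fin.succ_one_eq_two, show (Fin.succ 2 : Fin 4) = 3 from rfl]
    at p00 p01 p02 p10 p11 p12 p20 p21 p22
  have h32 := bivec_swap e (f 3) (f 2)
  have h13 := bivec_swap e (f 1) (f 3)
  have h21 := bivec_swap e (f 2) (f 1)
  rw [h23] at h32
  rw [h31] at h13
  rw [h12] at h21
  have h01 := bivec_swap e (f 0) (f 1)
  have h02 := bivec_swap e (f 0) (f 2)
  have h03 := bivec_swap e (f 0) (f 3)
  refine ⟨?_, ?_, ?_, ?_⟩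
  on_goal 1 =>
    simp only [superMomentum, belRobinson_eq he hf hW, weylC_eq hW, Fin.sum_univ_four,
      bivec_self, h01, h02, h03, mulVec_neg, mulVec_zero, dotProduct_zero, neg_dotProduct,
      dotProduct_neg, p00, p01, p02, p10, p11, p12, p20, p21, p22, frobSq, Fin.sum_univ_three]
    simp [eta, Complex.normSq_apply]
  all_goals
    simp only [superMomentum, belRobinson_eq he hf hW, weylC_eq hW, Fin.sum_univ_four,
      bivec_self, h01, h02, h03, h12, h23, h31, h32, h13, h21, mulVec_neg,
      mulVec_zero, dotProduct_zero, zero_dotProduct, neg_dotProduct, dotProduct_neg,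
      smul_dotProduct, p00, p01, p02, p10, p11, p12, p20, p21, p22,
      Fin.sum_univ_three]
    simp [eta]
    ring

/-- A polynomial identity in the real and imaginary parts of the five free entries of a symmetric
trace-free matrix. On its right side the trace is frame independent, so only ‖P²‖ still knows the
observer. -/
lemma sq_identity (P : Matrix (Fin 3) (Fin 3) ℂ) (hs : Pᵀ = P) (ht : P.trace = 0) :
    (frobSq P) ^ 2 - 4 * ((∑ s, (P 1 s * starRingEnd ℂ (P 2 s)).im) ^ 2
      + (∑ s, (P 2 s * starRingEnd ℂ (P 0 s)).im) ^ 2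
      + (∑ s, (P 0 s * starRingEnd ℂ (P 1 s)).im) ^ 2)
    = 3 * frobSq (P ^ 2) - (1 / 2) * Complex.normSq (P ^ 2).trace := by
  have h10 : P 1 0 = P 0 1 := congrFun (congrFun hs 0) 1
  have h20 : P 2 0 = P 0 2 := congrFun (congrFun hs 0) 2
  have h21 : P 2 1 = P 1 2 := congrFun (congrFun hs 1) 2
  have h22 : P 2 2 = -P 0 0 - P 1 1 := by
    rw [Matrix.trace_fin_three] at ht; linear_combination ht
  simp only [frobSq, pow_two P, Matrix.trace_fin_three, Matrix.mul_apply, Fin.sum_univ_three, h10,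
    h20, h21, h22, Complex.normSq_apply]
  simp
  ring

/-- The super-Poynting vector has `-16 (q,q) = 3 ‖P²‖² - |tr P²|² / 2`, where `P` is the Weyl matrix
in a frame of the observer. -/
lemma qq_eq (he : IsOrthonormalFrame g e) (hf : IsOrthonormalFrame g f) (hW : IsWeylTensor e W) :
    qq e W (f 0) = -(1 / 16) * (3 * frobSq (frameWeyl e f W ^ 2)
      - (1 / 2) * Complex.normSq (weylMatrix e W ^ 2).trace) := by
  obtain ⟨ε, hε⟩ := exists_isOriented he hf
  obtain ⟨h0, h1, h2, h3⟩ := superMomentum_frame he hf hW hε rfl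
  have h := sq_identity (frameWeyl e f W) (frameWeyl_transpose hW) (frameWeyl_trace he hf hW)
  rw [frameWeyl_sq_trace he hf] at h
  rw [qq_eq_frame he hf hW, Fin.sum_univ_four, h0, h1, h2, h3, ← h]
  -- The orientation of the frame enters only through ε² = 1.
  simp only [mul_pow, div_pow, hε.1]
  simp [eta]
  ring

end

end

end BelRobinson

/-! ### The full contraction (T,T) -/

namespace BelRobinson

noncomputable section

open Matrix

/-- The components of the isomorphism between trace-free symmetric tensors and Hermitian forms on
self-dual bivectors. -/
def soldering : Matrix (Fin 4 × Fin 4) (Fin 3 × Fin 3) ℂ := Matrix.of fun p q =>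
  let x : Fin 4 → ℂ := Pi.single p.1 1
  let y : Fin 4 → ℂ := Pi.single p.2 1
  let d : Fin 3 → ℂ := fun l => x 0 * y l.succ + y 0 * x l.succ
  (if q.1 = q.2 then x 0 * y 0 + x 1 * y 1 + x 2 * y 2 + x 3 * y 3 else 0)
    - (x q.1.succ * y q.2.succ + x q.2.succ * y q.1.succ)
    + Complex.I * (!![0, d 2, -d 1; -d 2, 0, d 0; d 1, -d 0, 0] : Matrix _ _ ℂ) q.1 q.2

/-- The metric on covariant two-tensors. -/
def etaSq : Fin 4 × Fin 4 → ℂ := fun p => eta p.1 * eta p.2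

-- The map is an isometry up to the factor 4, whose square cancels the 1/16 in (T,T). A multiple of
-- the identity is to be expected, since both sides are invariant forms on an irreducible
-- representation; the proof checks all 81 entries.
set_option maxHeartbeats 2000000 in
lemma soldering_orthogonal :
    solderingᵀ * Matrix.diagonal etaSq * soldering = (4 : ℂ) • (1 : Matrix _ _ ℂ) := by
  ext ⟨i, k⟩ ⟨j, l⟩
  rw [Matrix.mul_apply, Fintype.sum_prod_type]
  simp only [Matrix.mul_diagonal, Fin.sum_univ_four, etaSq, eta, soldering, Matrix.transpose_apply,
    Matrix.of_apply]
  fin_cases i <;> fin_cases k <;> fin_cases j <;> fin_cases l <;>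
    norm_num [Pi.single_apply, Matrix.one_apply, Fin.ext_iff]

end

end BelRobinson

namespace BelRobinson

noncomputable section

open Matrix

variable {V : Type*} [AddCommGroup V] [Module ℝ V]

section

variable {g : V →ₗ[ℝ] V →ₗ[ℝ] ℝ} {e f : Module.Basis (Fin 4) ℝ V}
  {W : V →ₗ[ℝ] V →ₗ[ℝ] V →ₗ[ℝ] V →ₗ[ℝ] ℝ}

-- Contracting one index of a self-dual bivector with one of a conjugate bivector is how index pairs
-- of T arise from W + i*W and its conjugate.
set_option maxHeartbeats 2000000 in
lemma soldering_eq (a b : Fin 4) (i k : Fin 3) : soldering (a, b) (i, k) =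
    ∑ r, (eta r : ℂ) * (bivec e (e a) (e r) i * starRingEnd ℂ (bivec e (e b) (e r) k)) := by
  simp only [Fin.sum_univ_four, eta, soldering, Matrix.of_apply, bivec, Module.Basis.repr_self,
    Finsupp.single_apply]
  fin_cases a <;> fin_cases b <;> fin_cases i <;> fin_cases k <;>
    norm_num [Pi.single_apply, Fin.ext_iff]

lemma soldering_conj (p : Fin 4 × Fin 4) (i k : Fin 3) :
    starRingEnd ℂ (soldering p (i, k)) = soldering p (k, i) := by
  have h : ∀ (a b : Fin 4), starRingEnd ℂ ((Pi.single a 1 : Fin 4 → ℂ) b)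
      = (Pi.single a 1 : Fin 4 → ℂ) b := by
    intro a b; rw [Pi.single_apply]; split_ifs <;> simp
  fin_cases i <;> fin_cases k <;> simp [soldering, h] <;> ring

lemma sum_rearrange (A B C D : Fin 4 → Fin 3 → ℂ) (M N : Fin 3 → Fin 3 → ℂ) (c : Fin 4 → ℂ) :
    ∑ i, ∑ k, ∑ j, ∑ l, (∑ r, c r * (A r i * B r k)) * (M i j * N k l)
        * (∑ s, c s * (C s j * D s l))
      = ∑ r, ∑ s, c r * (c s * ((∑ i, A r i * ∑ j, M i j * C s j)
        * (∑ k, B r k * ∑ l, N k l * D s l))) := by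
  have h := Finset.sum_comm (s := (Finset.univ : Finset ((Fin 3 × Fin 3) × (Fin 3 × Fin 3))))
    (t := (Finset.univ : Finset (Fin 4 × Fin 4)))
    (f := fun q p => c p.1 * c p.2 * (A p.1 q.1.1 * M q.1.1 q.2.1 * C p.2 q.2.1)
      * (B p.1 q.1.2 * N q.1.2 q.2.2 * D p.2 q.2.2))
  simp only [Fintype.sum_prod_type] at h
  refine Eq.trans ?_ (h.trans ?_)
  · refine Finset.sum_congr rfl fun i _ => Finset.sum_congr rfl fun k _ =>
      Finset.sum_congr rfl fun j _ => Finset.sum_congr rfl fun l _ => ?_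
    rw [Finset.sum_mul, Finset.sum_mul]
    refine Finset.sum_congr rfl fun r _ => ?_
    rw [Finset.mul_sum]
    exact Finset.sum_congr rfl fun s _ => by ring
  · refine Finset.sum_congr rfl fun r _ => Finset.sum_congr rfl fun s _ => ?_
    simp only [Fin.sum_univ_three]
    ring

/-- The square of the Weyl matrix as a Hermitian form. -/
def weylSq (Q : Matrix (Fin 3) (Fin 3) ℂ) : Matrix (Fin 3 × Fin 3) (Fin 3 × Fin 3) ℂ :=
  Matrix.of fun p q => Q p.1 q.1 * starRingEnd ℂ (Q p.2 q.2)

lemma soldering_weylSq_apply (Q : Matrix (Fin 3) (Fin 3) ℂ) (p q : Fin 4 × Fin 4) :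
    (soldering * weylSq Q * solderingᵀ) p q = ∑ i, ∑ k, ∑ j, ∑ l,
      soldering p (i, k) * (Q i j * starRingEnd ℂ (Q k l)) * soldering q (j, l) := by
  rw [Matrix.mul_assoc, Matrix.mul_apply, Fintype.sum_prod_type]
  refine Finset.sum_congr rfl fun i _ => Finset.sum_congr rfl fun k _ => ?_
  rw [Matrix.mul_apply, Fintype.sum_prod_type, Finset.mul_sum]
  refine Finset.sum_congr rfl fun j _ => ?_
  rw [Finset.mul_sum]
  refine Finset.sum_congr rfl fun l _ => ?_
  simp [weylSq, mul_assoc]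

/-- Conjugation exchanges i with k and j with l, which only permutes the summands. Hence taking the
real part in `belRobinson_eq` loses nothing. -/
lemma soldering_weylSq_im (Q : Matrix (Fin 3) (Fin 3) ℂ) (p q : Fin 4 × Fin 4) :
    ((soldering * weylSq Q * solderingᵀ) p q).im = 0 := by
  rw [← Complex.conj_eq_iff_im, soldering_weylSq_apply]
  simp only [map_sum, map_mul, soldering_conj, Complex.conj_conj]
  rw [Finset.sum_comm]
  refine Finset.sum_congr rfl fun i _ => Finset.sum_congr rfl fun k _ => ?_
  rw [Finset.sum_comm]
  refine Finset.sum_congr rfl fun j _ => Finset.sum_congr rfl fun l _ => ?_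
  ring

lemma belRobinson_basis (he : IsOrthonormalFrame g e) (hW : IsWeylTensor e W) (a b c d : Fin 4) :
    (belRobinson e W (e a) (e b) (e c) (e d) : ℂ) =
      (1 / 4) * (soldering * weylSq (weylMatrix e W) * solderingᵀ) (a, b) (c, d) := by
  have h : (soldering * weylSq (weylMatrix e W) * solderingᵀ) (a, b) (c, d) =
      ∑ r, ∑ s, (eta r : ℂ) * (eta s * (weylC e W (e a) (e r) (e c) (e s)
        * starRingEnd ℂ (weylC e W (e b) (e r) (e d) (e s)))) := by
    rw [soldering_weylSq_apply]
    simp only [soldering_eq (e := e), weylC_eq hW, mulVec, dotProduct, map_sum, map_mul]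
    exact sum_rearrange (fun r i => bivec e (e a) (e r) i)
      (fun r k => starRingEnd ℂ (bivec e (e b) (e r) k)) (fun s j => bivec e (e c) (e s) j)
      (fun s l => starRingEnd ℂ (bivec e (e d) (e s) l)) _ _ (fun r => (eta r : ℂ))
  rw [belRobinson_eq he he hW, ← h]
  apply Complex.ext
  · simp
  · simp [soldering_weylSq_im]

lemma weylSq_trace (Q : Matrix (Fin 3) (Fin 3) ℂ) (hQ : Qᵀ = Q) :
    (weylSq Q * (weylSq Q)ᵀ).trace = Complex.normSq (Q ^ 2).trace := by
  have h : (Q ^ 2).trace = ∑ i, ∑ j, Q i j ^ 2 := by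
    conv_lhs => rw [pow_two]; arg 1; arg 2; rw [← hQ]
    simp [Matrix.trace, Matrix.mul_apply, pow_two]
  have h' : (weylSq Q * (weylSq Q)ᵀ).trace
      = ∑ i, ∑ k, ∑ j, ∑ l, Q i j ^ 2 * starRingEnd ℂ (Q k l) ^ 2 := by
    simp only [Matrix.trace, Matrix.diag_apply, Matrix.mul_apply, Fintype.sum_prod_type,
      Matrix.transpose_apply, weylSq, Matrix.of_apply]
    refine Finset.sum_congr rfl fun i _ => Finset.sum_congr rfl fun k _ =>
      Finset.sum_congr rfl fun j _ => Finset.sum_congr rfl fun l _ => ?_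
    ring
  have h'' : ∀ A B : Fin 3 → Fin 3 → ℂ,
      ∑ i, ∑ k, ∑ j, ∑ l, A i j * B k l = (∑ i, ∑ j, A i j) * ∑ k, ∑ l, B k l := by
    intro A B; simp only [Fin.sum_univ_three]; ring
  rw [← Complex.mul_conj, h, h', h'' (fun i j => Q i j ^ 2) fun k l => starRingEnd ℂ (Q k l) ^ 2]
  simp only [map_sum, map_pow]

/-- The full contraction of the Bel-Robinson tensor is `|tr Q²|²`. -/
lemma belRobinsonSq_eq (he : IsOrthonormalFrame g e) (hW : IsWeylTensor e W) :
    belRobinsonSq e W = Complex.normSq (weylMatrix e W ^ 2).trace := by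
  rw [← Complex.ofReal_inj, ← weylSq_trace _ (weylMatrix_transpose hW)]
  set K := weylSq (weylMatrix e W) with hK
  set D := Matrix.diagonal etaSq with hD
  have h0 : ∀ M : Matrix (Fin 4 × Fin 4) (Fin 4 × Fin 4) ℂ, (D * M * D * Mᵀ).trace
      = ∑ a, ∑ b, ∑ c, ∑ d, etaSq (a, b) * M (a, b) (c, d) * etaSq (c, d) * M (a, b) (c, d) := by
    intro M
    have : D * M * D = Matrix.of fun p q => etaSq p * M p q * etaSq q := by
      ext p q; simp [hD]
    rw [this]
    simp only [Matrix.trace, Matrix.diag_apply, Matrix.mul_apply, Fintype.sum_prod_type,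
      Matrix.transpose_apply, Matrix.of_apply]
  have h1 : ((belRobinsonSq e W : ℝ) : ℂ) = (1 / 16) * (D * (soldering * K * solderingᵀ) * D
      * (soldering * K * solderingᵀ)ᵀ).trace := by
    rw [h0]
    simp only [belRobinsonSq, Complex.ofReal_sum, Finset.mul_sum]
    refine Finset.sum_congr rfl fun a _ => Finset.sum_congr rfl fun b _ =>
      Finset.sum_congr rfl fun c _ => Finset.sum_congr rfl fun d _ => ?_
    push_cast
    rw [belRobinson_basis he hW]
    simp only [etaSq]
    ring
  -- Cyclicity of the trace brings the last factor to the front, so that the soldering matrix occurs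
  -- only in the product known from `soldering_orthogonal`.
  have h2 : (D * (soldering * K * solderingᵀ) * D * (soldering * K * solderingᵀ)ᵀ).trace
      = ((solderingᵀ * D * soldering) * K * (solderingᵀ * D * soldering) * Kᵀ).trace := by
    rw [Matrix.transpose_mul, Matrix.transpose_mul, Matrix.transpose_transpose,
      show D * (soldering * K * solderingᵀ) * D * (soldering * (Kᵀ * solderingᵀ))
        = (D * soldering * K * solderingᵀ * D * soldering * Kᵀ) * solderingᵀ by
          simp only [Matrix.mul_assoc], Matrix.trace_mul_comm]
    simp only [Matrix.mul_assoc]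
  rw [h1, h2, soldering_orthogonal]
  simp [Matrix.trace_smul, smul_smul]
  ring

end

end

end BelRobinson

/-! ### Schur triangularization and Schur's inequality for a square -/

namespace BelRobinson

noncomputable section

open Matrix

section Schur

open Module

/-- Schur triangularization in dimension three. -/
lemma exists_orthonormalBasis_triangular {E : Type*} [NormedAddCommGroup E]
    [InnerProductSpace ℂ E] [Fact (finrank ℂ E = 2 + 1)] (T : E →ₗ[ℂ] E) :
    ∃ b : OrthonormalBasis (Fin 3) ℂ E,
      inner ℂ (b 1) (T (b 0)) = 0 ∧ inner ℂ (b 2) (T (b 0)) = 0 ∧ inner ℂ (b 2) (T (b 1)) = 0 := by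
  have hE : finrank ℂ E = 3 := Fact.out
  have : FiniteDimensional ℂ E := .of_fact_finrank_eq_succ 2
  have : Nontrivial E := nontrivial_of_finrank_pos (R := ℂ) (by omega)
  -- An eigenvector of the adjoint has a T-invariant orthogonal plane. It becomes the last basis
  -- vector, and an eigenvector of T in that plane the first.
  obtain ⟨ν, hν⟩ := Module.End.exists_eigenvalue (LinearMap.adjoint T)
  obtain ⟨w, hw⟩ := hν.exists_hasEigenvector
  have hTw : ∀ x, inner ℂ w (T x) = starRingEnd ℂ ν * inner ℂ w x := by
    intro x
    rw [← LinearMap.adjoint_inner_left, hw.apply_eq_smul, inner_smul_left]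
  set K := (ℂ ∙ w)ᗮ with hK
  have hKT : ∀ x ∈ K, T x ∈ K := by
    intro x hx
    rw [hK, Submodule.mem_orthogonal_singleton_iff_inner_right] at hx ⊢
    rw [hTw, hx, mul_zero]
  have hfin : finrank ℂ K = 2 := Submodule.finrank_orthogonal_span_singleton hw.2
  have : Nontrivial K := nontrivial_of_finrank_pos (R := ℂ) (by omega)
  obtain ⟨μ, hμ⟩ := Module.End.exists_eigenvalue (T.restrict hKT)
  obtain ⟨z, hz⟩ := hμ.exists_hasEigenvector
  have hTz : T (z : E) = μ • (z : E) := by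
    have := congrArg Subtype.val hz.apply_eq_smul
    simpa using this
  have hz0 : (z : E) ≠ 0 := fun h => hz.2 (Subtype.ext h)
  have hwz : inner ℂ w (z : E) = 0 := Submodule.mem_orthogonal_singleton_iff_inner_right.mp z.2
  let v : Fin 3 → E := ![(‖(z : E)‖ : ℂ)⁻¹ • (z : E), 0, (‖w‖ : ℂ)⁻¹ • w]
  have hv : Orthonormal ℂ (({0, 2} : Set (Fin 3)).domRestrict v) := by
    have hzw : inner ℂ (z : E) w = 0 := by rw [← inner_conj_symm, hwz, map_zero]
    constructor
    · rintro ⟨i, hi⟩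
      rcases hi with rfl | rfl
      · exact norm_smul_inv_norm hz0
      · exact norm_smul_inv_norm hw.2
    · rintro ⟨i, hi⟩ ⟨j, hj⟩ hij
      rcases hi with rfl | rfl <;> rcases hj with rfl | rfl
      · exact absurd rfl hij
      · simp [v, inner_smul_left, inner_smul_right, hzw]
      · simp [v, inner_smul_left, inner_smul_right, hwz]
      · exact absurd rfl hij
  obtain ⟨b, hb⟩ := hv.exists_orthonormalBasis_extension_of_card_eq (by simp [hE])
  have hb0 : b 0 = (‖(z : E)‖ : ℂ)⁻¹ • (z : E) := hb 0 (by simp)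
  have hb2 : b 2 = (‖w‖ : ℂ)⁻¹ • w := hb 2 (by simp)
  have hTb : T (b 0) = μ • b 0 := by rw [hb0, map_smul, hTz, smul_comm]
  have ho : ∀ i j, i ≠ j → inner ℂ (b i) (b j) = 0 := fun i j h => b.orthonormal.2 h
  refine ⟨b, ?_, ?_, ?_⟩
  · rw [hTb, inner_smul_right, ho _ _ (by decide), mul_zero]
  · rw [hTb, inner_smul_right, ho _ _ (by decide), mul_zero]
  · have h : inner ℂ w (b 1) = 0 := by
      have h := ho 2 1 (by decide)
      rw [hb2, inner_smul_left] at h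
      simpa [hw.2] using h
    rw [hb2, inner_smul_left, hTw, h, mul_zero, mul_zero]

lemma exists_unitary_triangular (A : Matrix (Fin 3) (Fin 3) ℂ) :
    ∃ U T : Matrix (Fin 3) (Fin 3) ℂ, Uᴴ * U = 1 ∧ A = U * T * Uᴴ ∧
      T 1 0 = 0 ∧ T 2 0 = 0 ∧ T 2 1 = 0 := by
  have : Fact (finrank ℂ (EuclideanSpace ℂ (Fin 3)) = 2 + 1) := ⟨by simp⟩
  obtain ⟨b, h10, h20, h21⟩ := exists_orthonormalBasis_triangular (toEuclideanLin A)
  let U : Matrix (Fin 3) (Fin 3) ℂ := Matrix.of fun i j => b j i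
  have hU : Uᴴ * U = 1 := by
    ext i j
    have h := orthonormal_iff_ite.mp b.orthonormal i j
    rw [Matrix.one_apply, ← h, Matrix.mul_apply, PiLp.inner_apply]
    simp [U, mul_comm]
  have hU' : U * Uᴴ = 1 := mul_eq_one_comm.mp hU
  have hT : ∀ i j, (Uᴴ * A * U) i j = inner ℂ (b i) (toEuclideanLin A (b j)) := by
    intro i j
    rw [Matrix.mul_assoc, Matrix.mul_apply, PiLp.inner_apply]
    refine Finset.sum_congr rfl fun k _ => ?_
    simp [U, Matrix.mul_apply, toLpLin_apply, mulVec, dotProduct, mul_comm]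
  refine ⟨U, Uᴴ * A * U, hU, ?_, ?_, ?_, ?_⟩
  · simp only [Matrix.mul_assoc, hU', Matrix.mul_one]
    rw [← Matrix.mul_assoc, hU', Matrix.one_mul]
  · rw [hT, h10]
  · rw [hT, h20]
  · rw [hT, h21]

end Schur

lemma frobSq_eq_trace (M : Matrix (Fin 3) (Fin 3) ℂ) : (frobSq M : ℂ) = (M * Mᴴ).trace := by
  simp [frobSq, Matrix.trace, Matrix.mul_apply, Complex.mul_conj]

lemma frobSq_unitary_conj {U M : Matrix (Fin 3) (Fin 3) ℂ} (hU : Uᴴ * U = 1) :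
    frobSq (U * M * Uᴴ) = frobSq M := by
  rw [← Complex.ofReal_inj, frobSq_eq_trace, frobSq_eq_trace]
  simp only [conjTranspose_mul, conjTranspose_conjTranspose]
  rw [show U * M * Uᴴ * (U * (Mᴴ * Uᴴ)) = U * (M * (Uᴴ * U) * Mᴴ * Uᴴ) by
    simp only [Matrix.mul_assoc], hU, Matrix.mul_one, Matrix.trace_mul_comm, Matrix.mul_assoc, hU,
    Matrix.mul_one]

open Polynomial in
/-- Schur's inequality for the square of a matrix, with its case of equality. -/
lemma schur_sq (A : Matrix (Fin 3) (Fin 3) ℂ) : ∃ a b c : ℂ,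
    A.charpoly = (X - C a) * (X - C b) * (X - C c) ∧
    A.trace = a + b + c ∧ (A ^ 2).trace = a ^ 2 + b ^ 2 + c ^ 2 ∧
    Complex.normSq (a ^ 2) + Complex.normSq (b ^ 2) + Complex.normSq (c ^ 2) ≤ frobSq (A ^ 2) ∧
    (Complex.normSq (a ^ 2) + Complex.normSq (b ^ 2) + Complex.normSq (c ^ 2) = frobSq (A ^ 2) →
      ∀ s t : ℂ, (a ^ 2 = s ∨ a ^ 2 = t) → (b ^ 2 = s ∨ b ^ 2 = t) → (c ^ 2 = s ∨ c ^ 2 = t) →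
        (A ^ 2 - s • 1) * (A ^ 2 - t • 1) = 0) := by
  obtain ⟨U, T, hU, hA, h10, h20, h21⟩ := exists_unitary_triangular A
  have hU' : U * Uᴴ = 1 := mul_eq_one_comm.mp hU
  have hA2 : A ^ 2 = U * T ^ 2 * Uᴴ := by
    rw [hA, pow_two, pow_two, show U * T * Uᴴ * (U * T * Uᴴ) = U * (T * (Uᴴ * U) * T) * Uᴴ by
      simp only [Matrix.mul_assoc], hU, Matrix.mul_one]
  have hT2 : T ^ 2 = !![T 0 0 ^ 2, T 0 0 * T 0 1 + T 0 1 * T 1 1,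
      T 0 0 * T 0 2 + T 0 1 * T 1 2 + T 0 2 * T 2 2;
      0, T 1 1 ^ 2, T 1 1 * T 1 2 + T 1 2 * T 2 2; 0, 0, T 2 2 ^ 2] := by
    rw [pow_two]
    ext i j
    fin_cases i <;> fin_cases j <;>
      simp [Matrix.mul_apply, Fin.sum_univ_three, h10, h20, h21, pow_two]
  have hchar : A.charpoly = (X - C (T 0 0)) * (X - C (T 1 1)) * (X - C (T 2 2)) := by
    rw [hA, Matrix.charpoly_mul_comm, ← Matrix.mul_assoc, hU, Matrix.one_mul,
      Matrix.charpoly, Matrix.det_fin_three]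
    simp [h10, h20, h21]
  have htr : A.trace = T 0 0 + T 1 1 + T 2 2 := by
    rw [hA, Matrix.trace_mul_comm, ← Matrix.mul_assoc, hU, Matrix.one_mul, Matrix.trace_fin_three]
  have htr2 : (A ^ 2).trace = T 0 0 ^ 2 + T 1 1 ^ 2 + T 2 2 ^ 2 := by
    rw [hA2, Matrix.trace_mul_comm, ← Matrix.mul_assoc, hU, Matrix.one_mul, Matrix.trace_fin_three,
      hT2]
    simp
  have hfrob : frobSq (A ^ 2) = frobSq (T ^ 2) := by rw [hA2, frobSq_unitary_conj hU]
  -- The gap in Schur's inequality is the sum over the entries of T² above the diagonal; equality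
  -- makes T² diagonal.
  have hsum : frobSq (T ^ 2) = Complex.normSq (T 0 0 ^ 2) + Complex.normSq (T 1 1 ^ 2)
      + Complex.normSq (T 2 2 ^ 2) + (Complex.normSq ((T ^ 2) 0 1) + Complex.normSq ((T ^ 2) 0 2)
      + Complex.normSq ((T ^ 2) 1 2)) := by
    rw [hT2]
    simp [frobSq, Fin.sum_univ_three]
    ring
  have n1 := Complex.normSq_nonneg ((T ^ 2) 0 1)
  have n2 := Complex.normSq_nonneg ((T ^ 2) 0 2)
  have n3 := Complex.normSq_nonneg ((T ^ 2) 1 2)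
  refine ⟨T 0 0, T 1 1, T 2 2, hchar, htr, htr2, by linarith, fun h s t ha hb hc => ?_⟩
  have z1 : (T ^ 2) 0 1 = 0 := Complex.normSq_eq_zero.mp (by linarith)
  have z2 : (T ^ 2) 0 2 = 0 := Complex.normSq_eq_zero.mp (by linarith)
  have z3 : (T ^ 2) 1 2 = 0 := Complex.normSq_eq_zero.mp (by linarith)
  have hd : T ^ 2 = Matrix.diagonal ![T 0 0 ^ 2, T 1 1 ^ 2, T 2 2 ^ 2] := by
    rw [hT2] at z1 z2 z3
    simp at z1 z2 z3
    rw [hT2]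
    ext i j
    fin_cases i <;> fin_cases j <;> simp [z1, z2, z3]
  have hs : ∀ r : ℂ, A ^ 2 - r • 1 = U * (T ^ 2 - r • 1) * Uᴴ := by
    intro r
    rw [hA2, Matrix.mul_sub, Matrix.sub_mul, Matrix.mul_smul, Matrix.smul_mul, Matrix.mul_one, hU']
  rw [hs, hs, show U * (T ^ 2 - s • 1) * Uᴴ * (U * (T ^ 2 - t • 1) * Uᴴ)
    = U * ((T ^ 2 - s • 1) * (Uᴴ * U) * (T ^ 2 - t • 1)) * Uᴴ by simp only [Matrix.mul_assoc], hU,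
    Matrix.mul_one]
  have h0 : (T ^ 2 - s • 1) * (T ^ 2 - t • 1) = 0 := by
    rw [hd, ← Matrix.diagonal_one, ← Matrix.diagonal_smul, ← Matrix.diagonal_smul,
      Matrix.diagonal_sub, Matrix.diagonal_sub, Matrix.diagonal_mul_diagonal,
      ← Matrix.diagonal_zero]
    congr 1
    ext i
    fin_cases i
    · rcases ha with h | h <;> simp [h]
    · rcases hb with h | h <;> simp [h]
    · rcases hc with h | h <;> simp [h]
  rw [h0, Matrix.mul_zero, Matrix.zero_mul]

end

end BelRobinson

/-! ### Frames through an observer and the super-energy inequality -/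

namespace BelRobinson

noncomputable section

open Matrix

variable {V : Type*} [AddCommGroup V] [Module ℝ V]

section

variable {g : V →ₗ[ℝ] V →ₗ[ℝ] ℝ} {e f : Module.Basis (Fin 4) ℝ V}
  {W : V →ₗ[ℝ] V →ₗ[ℝ] V →ₗ[ℝ] V →ₗ[ℝ] ℝ}

lemma exists_basis_of_orthonormal (g : V →ₗ[ℝ] V →ₗ[ℝ] ℝ) (e : Module.Basis (Fin 4) ℝ V) (v : Fin 4 → V)
    (hv : ∀ a b, g (v a) (v b) = if a = b then eta a else 0) :
    ∃ f : Module.Basis (Fin 4) ℝ V, IsOrthonormalFrame g f ∧ ⇑f = v := by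
  have hli : LinearIndependent ℝ v := by
    rw [Fintype.linearIndependent_iff]
    intro c hc a
    have h : g (∑ b, c b • v b) (v a) = 0 := by rw [hc]; simp
    simp [map_sum, hv] at h
    rcases h with h | h
    · exact h
    · have := eta_mul_self a; rw [h] at this; norm_num at this
  refine ⟨basisOfLinearIndependentOfCardEqFinrank hli
    (by rw [Module.finrank_eq_card_basis e]), ?_, by simp⟩
  intro a b
  simp [hv]

/-- The pure boost that takes `e 0` to `u` sends e_i to e_i + u_i/(1 + u_0) (e_0 + u). The sign
condition keeps the denominator positive. -/
lemma exists_frame_of_nonneg (he : IsOrthonormalFrame g e) {u : V} (hu : g u u = -1)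
    (h0 : 0 ≤ e.repr u 0) :
    ∃ f : Module.Basis (Fin 4) ℝ V, IsOrthonormalFrame g f ∧ f 0 = u := by
  let c : Fin 3 → ℝ := fun i => e.repr u i.succ / (1 + e.repr u 0)
  let v : Fin 4 → V := Fin.cons u fun i : Fin 3 => e i.succ + c i • (e 0 + u)
  have hc : ∀ i, c i * (1 + e.repr u 0) = e.repr u i.succ := fun i =>
    div_mul_cancel₀ _ (by linarith)
  have g0u : g (e 0) u = -e.repr u 0 := by rw [he.apply_eq]; simp
  have gu0 : g u (e 0) = -e.repr u 0 := by rw [he.symm, g0u]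
  have giu : ∀ i : Fin 3, g (e i.succ) u = e.repr u i.succ := by
    intro i; rw [he.apply_eq]; fin_cases i <;> simp
  have gui : ∀ i : Fin 3, g u (e i.succ) = e.repr u i.succ := by
    intro i; rw [he.symm, giu]
  have hsu : ∀ i : Fin 3, g (e i.succ + c i • (e 0 + u)) u = 0 := by
    intro i
    simp only [map_add, map_smul, LinearMap.add_apply, LinearMap.smul_apply, smul_eq_mul, giu,
      g0u, hu]
    linear_combination -hc i
  have hv : ∀ a b, g (v a) (v b) = if a = b then eta a else 0 := by
    intro a b
    refine Fin.cases ?_ (fun i => ?_) a <;> refine Fin.cases ?_ (fun j => ?_) b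
    · simp [v, hu, eta]
    · simp only [v, Fin.cons_zero, Fin.cons_succ]
      rw [he.symm, hsu]; simp [(Fin.succ_ne_zero j).symm]
    · simp only [v, Fin.cons_zero, Fin.cons_succ]
      rw [hsu]; simp
    · simp only [v, Fin.cons_succ]
      simp only [map_add, map_smul, LinearMap.add_apply, LinearMap.smul_apply, smul_eq_mul, giu,
        g0u, hu, gu0, gui, he _ _]
      simp [eta, (Fin.succ_ne_zero _).symm]
      linear_combination -c j * hc i - c i * hc j
  obtain ⟨f, hf, hfv⟩ := exists_basis_of_orthonormal g e v hv
  exact ⟨f, hf, by rw [hfv]; rfl⟩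

/-- Every observer belongs to an orthonormal frame. -/
lemma exists_frame (he : IsOrthonormalFrame g e) {u : V} (hu : IsObserver g u) :
    ∃ f : Module.Basis (Fin 4) ℝ V, IsOrthonormalFrame g f ∧ f 0 = u := by
  rcases le_total 0 (e.repr u 0) with h | h
  · exact exists_frame_of_nonneg he hu h
  · obtain ⟨f, hf, hfu⟩ := exists_frame_of_nonneg he (u := -u) (by rw [← hu]; simp)
      (by simpa using h)
    obtain ⟨k, hk, hkv⟩ := exists_basis_of_orthonormal g e ![-f 0, f 1, f 2, f 3] (by
      intro a b
      fin_cases a <;> fin_cases b <;> simp [hf _ _, eta])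
    exact ⟨k, hk, by rw [hkv]; simp [hfu]⟩

/-- Every observer belongs to a positively oriented orthonormal frame. -/
lemma exists_oriented_frame (he : IsOrthonormalFrame g e) {u : V} (hu : IsObserver g u) :
    ∃ f : Module.Basis (Fin 4) ℝ V, IsOrthonormalFrame g f ∧ f 0 = u ∧ IsOriented e f 1 := by
  obtain ⟨f, hf, hfu⟩ := exists_frame he hu
  obtain ⟨ε, hε⟩ := exists_isOriented he hf
  rcases sq_eq_one_iff.mp hε.1 with rfl | rfl
  · exact ⟨f, hf, hfu, hε⟩
  -- Reversing one spatial leg reverses the orientation and keeps the observer.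
  · obtain ⟨k, hk, hkv⟩ := exists_basis_of_orthonormal g e ![f 0, f 1, f 2, -f 3] (by
      intro a b
      fin_cases a <;> fin_cases b <;> simp [hf _ _, eta])
    have hn : ∀ x y, bivec e (-x) y = -bivec e x y := fun x y => by
      simpa using bivec_smul_left e (-1) x y
    have hn' : ∀ x y, bivec e x (-y) = -bivec e x y := fun x y => by
      simpa using bivec_smul_right e (-1) x y
    obtain ⟨-, h1, h2, h3⟩ := hε
    refine ⟨k, hk, by simp [hkv, hfu], by norm_num, ?_, ?_, ?_⟩ <;> simp [hkv, hn, hn', h1, h2, h3]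

end

lemma frobSq_eq_zero {M : Matrix (Fin 3) (Fin 3) ℂ} (h : frobSq M = 0) : M = 0 := by
  have h1 := (Finset.sum_eq_zero_iff_of_nonneg fun i _ =>
    Finset.sum_nonneg fun j _ => Complex.normSq_nonneg (M i j)).mp h
  ext i j
  have h2 := (Finset.sum_eq_zero_iff_of_nonneg fun j _ => Complex.normSq_nonneg (M i j)).mp
    (h1 i (Finset.mem_univ _)) j (Finset.mem_univ _)
  exact Complex.normSq_eq_zero.mp h2

lemma frobSq_nonneg (M : Matrix (Fin 3) (Fin 3) ℂ) : 0 ≤ frobSq M :=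
  Finset.sum_nonneg fun _ _ => Finset.sum_nonneg fun _ _ => Complex.normSq_nonneg _

section

variable {g : V →ₗ[ℝ] V →ₗ[ℝ] ℝ} {e f : Module.Basis (Fin 4) ℝ V}
  {W : V →ₗ[ℝ] V →ₗ[ℝ] V →ₗ[ℝ] V →ₗ[ℝ] ℝ}

lemma frameWeyl_charpoly (he : IsOrthonormalFrame g e) (hf : IsOrthonormalFrame g f) :
    (frameWeyl e f W).charpoly = (weylMatrix e W).charpoly := by
  rw [frameWeyl, Matrix.charpoly_mul_comm, ← Matrix.mul_assoc, frameMatrix_transpose_mul he hf,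
    Matrix.one_mul]

lemma weylMatrix_sq_eq_frame (he : IsOrthonormalFrame g e) (hf : IsOrthonormalFrame g f) :
    weylMatrix e W ^ 2 = (frameMatrix e f)ᵀ * frameWeyl e f W ^ 2 * frameMatrix e f := by
  have h := frameMatrix_transpose_mul he hf
  rw [frameWeyl_sq he hf, show (frameMatrix e f)ᵀ * (frameMatrix e f * weylMatrix e W ^ 2
    * (frameMatrix e f)ᵀ) * frameMatrix e f = ((frameMatrix e f)ᵀ * frameMatrix e f)
      * weylMatrix e W ^ 2 * ((frameMatrix e f)ᵀ * frameMatrix e f) by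
        simp only [Matrix.mul_assoc], h, Matrix.one_mul, Matrix.mul_one]

open Polynomial in
lemma xi_eq {a b c : ℂ} (h : (weylMatrix e W).charpoly = (X - C a) * (X - C b) * (X - C c)) :
    xi e W = (1 / 4) * (Complex.normSq a + Complex.normSq b + Complex.normSq c) := by
  have hr : (weylMatrix e W).charpoly.roots = {a, b, c} := by
    rw [h, roots_mul, roots_mul, roots_X_sub_C, roots_X_sub_C, roots_X_sub_C]
    · rfl
    · exact mul_ne_zero (X_sub_C_ne_zero _) (X_sub_C_ne_zero _)
    · exact mul_ne_zero (mul_ne_zero (X_sub_C_ne_zero _) (X_sub_C_ne_zero _)) (X_sub_C_ne_zero _)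
  rw [xi, hr]
  simp [Complex.normSq_eq_norm_sq]
  ring

lemma alpha_sq (he : IsOrthonormalFrame g e) (hW : IsWeylTensor e W) :
    alpha e W ^ 2 = (1 / 4) * Complex.normSq (weylMatrix e W ^ 2).trace := by
  rw [alpha, mul_pow, belRobinsonSq_eq he hW, Real.sq_sqrt (Complex.normSq_nonneg _)]
  ring

/-- This is `sq_identity` for a diagonal matrix, whose rows have no Hermitian products with each
other. The difference of the two identities is three times the gap in Schur's inequality. -/
lemma normSq_sum_identity {a b c : ℂ} (h : a + b + c = 0) :
    (Complex.normSq a + Complex.normSq b + Complex.normSq c) ^ 2 =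
      3 * (Complex.normSq (a ^ 2) + Complex.normSq (b ^ 2) + Complex.normSq (c ^ 2))
        - (1 / 2) * Complex.normSq (a ^ 2 + b ^ 2 + c ^ 2) := by
  obtain rfl : c = -a - b := by linear_combination h
  simp only [Complex.normSq_apply, pow_two]
  simp
  ring

/-- The eigenvalues of the Weyl matrix. -/
lemma exists_roots (e : Module.Basis (Fin 4) ℝ V) (hW : IsWeylTensor e W) : ∃ a b c : ℂ,
    (weylMatrix e W).charpoly = (Polynomial.X - Polynomial.C a) * (Polynomial.X - Polynomial.C b)
      * (Polynomial.X - Polynomial.C c) ∧ a + b + c = 0 ∧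
    (weylMatrix e W ^ 2).trace = a ^ 2 + b ^ 2 + c ^ 2 := by
  obtain ⟨a, b, c, h1, h2, h3, -⟩ := schur_sq (weylMatrix e W)
  exact ⟨a, b, c, h1, by rw [← h2, weylMatrix_trace hW], h3⟩

/-- The super-energy inequality, with its case of equality. -/
lemma qq_le (he : IsOrthonormalFrame g e) (hW : IsWeylTensor e W) {u : V} (hu : IsObserver g u) :
    ∃ a b c : ℂ, (weylMatrix e W).charpoly = (Polynomial.X - Polynomial.C a)
      * (Polynomial.X - Polynomial.C b) * (Polynomial.X - Polynomial.C c) ∧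
    qq e W u ≤ -xi e W ^ 2 ∧
    (qq e W u = -xi e W ^ 2 → ∀ s t : ℂ, (a ^ 2 = s ∨ a ^ 2 = t) → (b ^ 2 = s ∨ b ^ 2 = t) →
      (c ^ 2 = s ∨ c ^ 2 = t) → (weylMatrix e W ^ 2 - s • 1) * (weylMatrix e W ^ 2 - t • 1) = 0) := by
  obtain ⟨f, hf, rfl⟩ := exists_frame he hu
  obtain ⟨a, b, c, h1, h2, h3, h4, h5⟩ := schur_sq (frameWeyl e f W)
  rw [frameWeyl_charpoly he hf] at h1
  rw [frameWeyl_trace he hf hW] at h2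
  rw [frameWeyl_sq_trace he hf] at h3
  have hid := normSq_sum_identity h2.symm
  have hq := qq_eq (f := f) he hf hW
  rw [h3] at hq
  have hx := xi_eq h1
  refine ⟨a, b, c, h1, ?_, fun heq s t ha hb hc => ?_⟩
  · rw [hq, hx]; nlinarith
  · have hO := frameMatrix_transpose_mul he hf
    have hO' := frameMatrix_mul_transpose he hf
    have h := h5 (by rw [hq, hx] at heq; nlinarith) s t ha hb hc
    have hs : ∀ r : ℂ, weylMatrix e W ^ 2 - r • 1
        = (frameMatrix e f)ᵀ * (frameWeyl e f W ^ 2 - r • 1) * frameMatrix e f := by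
      intro r
      rw [weylMatrix_sq_eq_frame he hf, Matrix.mul_sub, Matrix.sub_mul, Matrix.mul_smul,
        Matrix.smul_mul, Matrix.mul_one, hO]
    rw [hs, hs, show ∀ A B C : Matrix (Fin 3) (Fin 3) ℂ, A * B * (frameMatrix e f) *
      ((frameMatrix e f)ᵀ * C * frameMatrix e f)
      = A * (B * (frameMatrix e f * (frameMatrix e f)ᵀ) * C) * frameMatrix e f by
        intro A B C; simp only [Matrix.mul_assoc], hO', Matrix.mul_one, h]
    simp

/-- In a principal frame P is diagonal with the eigenvalues as entries, so the Schur gap is zero and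
`normSq_sum_identity` gives the value. -/
lemma qq_of_principal (he : IsOrthonormalFrame g e) (hW : IsWeylTensor e W) {u : V}
    (hu : IsPrincipalObserver g e W u) : qq e W u = -xi e W ^ 2 := by
  obtain ⟨f, hf, rfl, h⟩ := hu
  obtain ⟨d, hd⟩ : ∃ d, frameWeyl e f W = Matrix.diagonal d := by
    refine ⟨fun i => frameWeyl e f W i i, ?_⟩
    ext i j
    by_cases hij : i = j
    · subst hij; simp
    · rw [Matrix.diagonal_apply_ne _ hij, frameWeyl_eq_weylC hW, weylC, (h i j hij).1,
        (h i j hij).2]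
      simp
  have ht := frameWeyl_trace he hf hW
  have ht2 := frameWeyl_sq_trace (W := W) he hf
  have hc := frameWeyl_charpoly (W := W) he hf
  have hd2 : frameWeyl e f W ^ 2 = Matrix.diagonal fun i => d i ^ 2 := by
    rw [hd, pow_two, Matrix.diagonal_mul_diagonal]
    simp only [pow_two]
  rw [hd, Matrix.charpoly, Matrix.det_fin_three] at hc
  simp at hc
  rw [hd, Matrix.trace_fin_three] at ht
  simp only [Matrix.diagonal_apply_eq] at ht
  rw [hd2, Matrix.trace_fin_three] at ht2
  simp only [Matrix.diagonal_apply_eq] at ht2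
  have hfr : frobSq (Matrix.diagonal fun i => d i ^ 2) = Complex.normSq (d 0 ^ 2)
      + Complex.normSq (d 1 ^ 2) + Complex.normSq (d 2 ^ 2) := by
    simp [frobSq, Fin.sum_univ_three]
  rw [qq_eq he hf hW, xi_eq hc.symm, mul_pow, normSq_sum_identity ht, hd2, ← ht2, hfr]
  ring

end

end

end BelRobinson

/-! ### Eigenvalues and the inequalities for each Petrov type -/

namespace BelRobinson

noncomputable section

open Matrix Polynomial

lemma eval_eq_zero_of_charpoly {Q : Matrix (Fin 3) (Fin 3) ℂ} {a : ℂ} (ha : Q.charpoly.eval a = 0)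
    {p : ℂ[X]} (hp : aeval Q p = 0) : p.eval a = 0 := by
  rw [Matrix.eval_charpoly] at ha
  obtain ⟨v, hv, h⟩ := Matrix.exists_mulVec_eq_zero_iff.mpr ha
  have hQ : Matrix.toLin' Q v = a • v := by
    have h' : a • v - Q *ᵥ v = 0 := by
      rw [← h, Matrix.sub_mulVec, Matrix.scalar_apply, ← Matrix.smul_one_eq_diagonal,
        Matrix.smul_mulVec, Matrix.one_mulVec]
    rw [Matrix.toLin'_apply]
    exact (sub_eq_zero.mp h').symm
  have he : Module.End.HasEigenvector (Matrix.toLin' Q) a v :=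
    ⟨Module.End.mem_eigenspace_iff.mpr hQ, hv⟩
  have h1 := Module.End.aeval_apply_of_hasEigenvector (p := p) he
  have h2 : aeval (Matrix.toLin' Q) p = 0 := by
    have := Polynomial.aeval_algHom_apply (Matrix.toLinAlgEquiv' (R := ℂ) (n := Fin 3)).toAlgHom Q p
    rw [hp, map_zero] at this
    exact this
  rw [h2, LinearMap.zero_apply] at h1
  exact (smul_eq_zero.mp h1.symm).resolve_right hv

lemma charpoly_eval_eq_zero {Q : Matrix (Fin 3) (Fin 3) ℂ} {p : ℂ}
    (hp : (minpoly ℂ Q).eval p = 0) : Q.charpoly.eval p = 0 := by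
  obtain ⟨k, hk⟩ := Matrix.minpoly_dvd_charpoly Q
  rw [hk, eval_mul, hp, zero_mul]

/-- Two of the three numbers coincide, so they are x, x, -2x: the squares sum to 6x² and the squared
moduli to 6|x|². If the former vanishes, so do all three numbers, and two different values cannot
both occur. -/
lemma normSq_sum_sq_of_two_values {a b c p q : ℂ} (hpq : p ≠ q) (h0 : a + b + c = 0)
    (ha : a = p ∨ a = q) (hb : b = p ∨ b = q) (hc : c = p ∨ c = q) :
    (Complex.normSq a + Complex.normSq b + Complex.normSq c) ^ 2
      = Complex.normSq (a ^ 2 + b ^ 2 + c ^ 2) ∧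
    ((p = a ∨ p = b ∨ p = c) → (q = a ∨ q = b ∨ q = c) → a ^ 2 + b ^ 2 + c ^ 2 ≠ 0) := by
  have key : ∀ x y : ℂ, x + x + y = 0 → (Complex.normSq x + Complex.normSq x + Complex.normSq y) ^ 2
      = Complex.normSq (x ^ 2 + x ^ 2 + y ^ 2) ∧ (x ^ 2 + x ^ 2 + y ^ 2 = 0 → x = 0 ∧ y = 0) := by
    intro x y h
    obtain rfl : y = -2 * x := by linear_combination h
    have e1 : x ^ 2 + x ^ 2 + (-2 * x) ^ 2 = 6 * (x * x) := by ring
    rw [e1]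
    refine ⟨?_, fun h => ?_⟩
    · simp only [map_mul]
      norm_num [Complex.normSq_apply (-2), Complex.normSq_apply 6]
      ring
    · have : x = 0 := by simpa using h
      simp [this]
  have hab : a = b ∨ b = c ∨ a = c := by
    rcases ha with rfl | rfl <;> rcases hb with rfl | rfl <;> rcases hc with rfl | rfl <;> simp
  rcases hab with rfl | rfl | rfl
  · obtain ⟨k1, k2⟩ := key a c h0
    refine ⟨k1, fun hp hq h => hpq ?_⟩
    obtain ⟨rfl, rfl⟩ := k2 h
    simp at hp hq; rw [hp, hq]
  · obtain ⟨k1, k2⟩ := key b a (by linear_combination h0)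
    refine ⟨by rw [show a ^ 2 + b ^ 2 + b ^ 2 = b ^ 2 + b ^ 2 + a ^ 2 by ring, ← k1]; ring,
      fun hp hq h => hpq ?_⟩
    obtain ⟨rfl, rfl⟩ := k2 (by linear_combination h)
    simp at hp hq; rw [hp, hq]
  · obtain ⟨k1, k2⟩ := key a b (by linear_combination h0)
    refine ⟨by rw [show a ^ 2 + b ^ 2 + a ^ 2 = a ^ 2 + a ^ 2 + b ^ 2 by ring, ← k1]; ring,
      fun hp hq h => hpq ?_⟩
    obtain ⟨rfl, rfl⟩ := k2 (by linear_combination h)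
    simp at hp hq; rw [hp, hq]

variable {V : Type*} [AddCommGroup V] [Module ℝ V]

section

variable {g : V →ₗ[ℝ] V →ₗ[ℝ] ℝ} {e : Module.Basis (Fin 4) ℝ V}
  {W : V →ₗ[ℝ] V →ₗ[ℝ] V →ₗ[ℝ] V →ₗ[ℝ] ℝ}

lemma eval_root {a b c x : ℂ} (hx : x = a ∨ x = b ∨ x = c) :
    ((X - C a) * (X - C b) * (X - C c)).eval x = 0 := by
  rcases hx with rfl | rfl | rfl <;> simp

lemma root_of_eval {a b c x : ℂ} (h : ((X - C a) * (X - C b) * (X - C c)).eval x = 0) :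
    x = a ∨ x = b ∨ x = c := by
  simpa [sub_eq_zero, or_assoc] using h

lemma mem_of_minpoly_two {p q : ℂ}
    (hm : ∀ z, (minpoly ℂ (weylMatrix e W)).eval z = 0 ↔ z = p ∨ z = q) {a b c : ℂ}
    (h : (weylMatrix e W).charpoly = (X - C a) * (X - C b) * (X - C c)) :
    (a = p ∨ a = q) ∧ (b = p ∨ b = q) ∧ (c = p ∨ c = q) ∧ (p = a ∨ p = b ∨ p = c) ∧
      (q = a ∨ q = b ∨ q = c) := by
  have hr : ∀ x, (x = a ∨ x = b ∨ x = c) → x = p ∨ x = q := fun x hx =>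
    (hm x).mp (eval_eq_zero_of_charpoly (by rw [h]; exact eval_root hx) (minpoly.aeval _ _))
  have hl : ∀ x, (x = p ∨ x = q) → x = a ∨ x = b ∨ x = c := fun x hx =>
    root_of_eval (by rw [← h]; exact charpoly_eval_eq_zero ((hm x).mpr hx))
  exact ⟨hr a (by simp), hr b (by simp), hr c (by simp), hl p (by simp), hl q (by simp)⟩

/-- The invariants of a Weyl tensor with exactly two different eigenvalues. -/
lemma xi_sq_of_minpoly_two (he : IsOrthonormalFrame g e) (hW : IsWeylTensor e W) {p q : ℂ}
    (hpq : p ≠ q) (hm : ∀ z, (minpoly ℂ (weylMatrix e W)).eval z = 0 ↔ z = p ∨ z = q) :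
    -xi e W ^ 2 = -(1 / 4) * alpha e W ^ 2 ∧ -(1 / 4) * alpha e W ^ 2 < 0 := by
  obtain ⟨a, b, c, hc, h0, ht⟩ := exists_roots e hW
  obtain ⟨ha, hb, hc', hp, hq⟩ := mem_of_minpoly_two hm hc
  obtain ⟨h1, h2⟩ := normSq_sum_sq_of_two_values hpq h0 ha hb hc'
  have h3 := Complex.normSq_pos.mpr (h2 hp hq)
  rw [alpha_sq he hW, xi_eq hc, ht, mul_pow, h1]
  constructor <;> linarith

lemma alpha_sq_le_xi_sq (he : IsOrthonormalFrame g e) (hW : IsWeylTensor e W) :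
    -xi e W ^ 2 ≤ -(1 / 4) * alpha e W ^ 2 := by
  obtain ⟨a, b, c, hc, h0, ht⟩ := exists_roots e hW
  rw [alpha_sq he hW, xi_eq hc, ht]
  have h : ‖a ^ 2 + b ^ 2 + c ^ 2‖ ≤ ‖a‖ ^ 2 + ‖b‖ ^ 2 + ‖c‖ ^ 2 := by
    refine (norm_add₃_le).trans ?_
    simp
  have h' := pow_le_pow_left₀ (norm_nonneg _) h 2
  simp only [Complex.normSq_eq_norm_sq]
  nlinarith

lemma sq_eq_zero_of_isTypeN (h : IsTypeN e W) : weylMatrix e W ^ 2 = 0 := by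
  have := minpoly.aeval ℂ (weylMatrix e W)
  rw [h] at this
  simpa using this

lemma typeN (he : IsOrthonormalFrame g e) (hW : IsWeylTensor e W) (h : IsTypeN e W) {u : V}
    (hu : IsObserver g u) :
    qq e W u = -xi e W ^ 2 ∧ -xi e W ^ 2 = -(1 / 4) * alpha e W ^ 2 ∧
      -(1 / 4) * alpha e W ^ 2 = 0 := by
  have h2 := sq_eq_zero_of_isTypeN h
  have hα : alpha e W ^ 2 = 0 := by rw [alpha_sq he hW, h2]; simp
  obtain ⟨_, _, _, -, hle, -⟩ := qq_le he hW hu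
  obtain ⟨f, hf, rfl⟩ := exists_frame he hu
  have hq : qq e W (f 0) = 0 := by
    rw [qq_eq he hf hW, frameWeyl_sq he hf, h2]; simp [frobSq]
  -- Squeezed from 0 = (q,q) ≤ -ξ², without looking at the eigenvalues.
  have hx : xi e W ^ 2 = 0 := le_antisymm (by linarith) (sq_nonneg _)
  rw [hq, hx, hα]; norm_num

lemma xi_eq_zero_of_isTypeIII (h : IsTypeIII e W) (hW : IsWeylTensor e W) : xi e W = 0 := by
  obtain ⟨a, b, c, hc, -, -⟩ := exists_roots e hW
  have hr : ∀ x, (x = a ∨ x = b ∨ x = c) → x = 0 := fun x hx => by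
    have := eval_eq_zero_of_charpoly (by rw [hc]; exact eval_root hx)
      (minpoly.aeval ℂ (weylMatrix e W))
    rw [h] at this
    simpa using this
  rw [xi_eq hc, hr a (by simp), hr b (by simp), hr c (by simp)]
  simp

lemma sq_ne_zero_of_isTypeIII (h : IsTypeIII e W) : weylMatrix e W ^ 2 ≠ 0 := by
  intro h2
  have hd := minpoly.dvd ℂ (weylMatrix e W) (p := X ^ 2) (by simpa using h2)
  rw [h] at hd
  have := natDegree_le_of_dvd hd (by simp)
  simp at this

/-- All eigenvalues vanish, hence ξ, α and tr Q² do, and (q,q) = -(3/16)‖P²‖². This is negative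
because Q² ≠ 0. -/
lemma typeIII (he : IsOrthonormalFrame g e) (hW : IsWeylTensor e W) (h : IsTypeIII e W) {u : V}
    (hu : IsObserver g u) :
    qq e W u < -xi e W ^ 2 ∧ -xi e W ^ 2 = -(1 / 4) * alpha e W ^ 2 ∧
      -(1 / 4) * alpha e W ^ 2 = 0 := by
  have hx := xi_eq_zero_of_isTypeIII h hW
  have h2 := alpha_sq_le_xi_sq he hW
  have hα : alpha e W ^ 2 = 0 := le_antisymm (by rw [hx] at h2; linarith) (sq_nonneg _)
  have ht : Complex.normSq (weylMatrix e W ^ 2).trace = 0 := by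
    rw [alpha_sq he hW] at hα; linarith
  obtain ⟨f, hf, rfl⟩ := exists_frame he hu
  have hpos : 0 < frobSq (frameWeyl e f W ^ 2) := by
    refine lt_of_le_of_ne (frobSq_nonneg _) fun h0 => sq_ne_zero_of_isTypeIII h ?_
    rw [weylMatrix_sq_eq_frame he hf, frobSq_eq_zero h0.symm]; simp
  refine ⟨?_, ?_, ?_⟩
  · rw [qq_eq he hf hW, ht, hx]; linarith
  · rw [hα, hx]; norm_num
  · rw [hα]; norm_num

/-- The eigenvalues of a non-diagonalizable Weyl matrix with two different eigenvalues. -/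
lemma add_eq_zero_of_minpoly (hW : IsWeylTensor e W) {p q : ℂ}
    (hm : minpoly ℂ (weylMatrix e W) = (X - C p) ^ 2 * (X - C q)) : p + p + q = 0 := by
  have hmc : (weylMatrix e W).charpoly = minpoly ℂ (weylMatrix e W) := by
    refine eq_of_monic_of_dvd_of_natDegree_le (minpoly.monic (Matrix.isIntegral _))
      (Matrix.charpoly_monic _) (Matrix.minpoly_dvd_charpoly _) ?_
    rw [Matrix.charpoly_natDegree_eq_dim, hm, natDegree_mul
      (pow_ne_zero _ (X_sub_C_ne_zero _)) (X_sub_C_ne_zero _), natDegree_pow]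
    simp
  obtain ⟨a, b, c, hc, h0, -⟩ := exists_roots e hW
  have he : ∀ z : ℂ, (z - a) * (z - b) * (z - c) = (z - p) ^ 2 * (z - q) := by
    intro z
    have h1 := congrArg (fun r => r.eval z) (hc.symm.trans (hmc.trans hm))
    simpa using h1
  -- The second difference at 0 extracts the coefficient of z² from both monic cubics.
  linear_combination h0 + (he 1 + he (-1) - 2 * he 0) / 2

/-- Equality would make (x² - p²)(x² - q²) annihilate Q. Since q = -2p with p ≠ 0, this polynomial
has p as a simple root, whereas the minimal polynomial has it as a double one. -/
lemma typeII (he : IsOrthonormalFrame g e) (hW : IsWeylTensor e W) (h : IsTypeII e W) {u : V}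
    (hu : IsObserver g u) :
    qq e W u < -xi e W ^ 2 ∧ -xi e W ^ 2 = -(1 / 4) * alpha e W ^ 2 ∧
      -(1 / 4) * alpha e W ^ 2 < 0 := by
  obtain ⟨p, q, hpq, hm⟩ := h
  have hm' : ∀ z, (minpoly ℂ (weylMatrix e W)).eval z = 0 ↔ z = p ∨ z = q := by
    intro z; simp [hm, sub_eq_zero]
  refine ⟨?_, xi_sq_of_minpoly_two he hW hpq hm'⟩
  obtain ⟨a, b, c, hc, hle, heq⟩ := qq_le he hW hu
  refine lt_of_le_of_ne hle fun h0 => ?_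
  obtain ⟨ha, hb, hc', hp, hq⟩ := mem_of_minpoly_two hm' hc
  have hsum := add_eq_zero_of_minpoly hW hm
  have sq : ∀ z, (z = p ∨ z = q) → z ^ 2 = p ^ 2 ∨ z ^ 2 = q ^ 2 := by
    rintro z (rfl | rfl) <;> simp
  have hz := heq h0 (p ^ 2) (q ^ 2) (sq a ha) (sq b hb) (sq c hc')
  have hd := minpoly.dvd ℂ (weylMatrix e W) (p := (X ^ 2 - C (p ^ 2)) * (X ^ 2 - C (q ^ 2))) (by
    rw [map_mul, map_sub, map_sub, aeval_C, aeval_C, map_pow, aeval_X, Algebra.algebraMap_eq_smul_one,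
      Algebra.algebraMap_eq_smul_one, hz])
  obtain ⟨k, hk⟩ := hd
  have hk' : (X - C p) * ((X + C p) * (X ^ 2 - C (q ^ 2))) = (X - C p) * ((X - C p) * (X - C q) * k) := by
    rw [hm] at hk
    rw [map_pow C p] at hk
    linear_combination hk
  have h1 := congrArg (fun r => r.eval p) (mul_left_cancel₀ (X_sub_C_ne_zero p) hk')
  simp only [eval_mul, eval_add, eval_sub, eval_X, eval_C, eval_pow, sub_self, zero_mul] at h1
  obtain rfl : q = -2 * p := by linear_combination hsum
  -- One factor x - p cancelled, the value at p is 2p(p² - 4p²) = -6p³.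
  have hp0 : p = 0 := by
    have : p ^ 3 = 0 := by linear_combination (-1 / 6) * h1
    simpa using this
  exact hpq (by rw [hp0]; simp)

end

end

end BelRobinson

/-! ### Non-null eigenvectors and principal observers -/

namespace BelRobinson

noncomputable section

open Matrix Polynomial

section Eigenvectors

lemma aeval_transpose {Q : Matrix (Fin 3) (Fin 3) ℂ} (hQ : Qᵀ = Q) (r : ℂ[X]) :
    (aeval Q r)ᵀ = aeval Q r := by
  induction r using Polynomial.induction_on' with
  | add p q hp hq => rw [map_add, Matrix.transpose_add, hp, hq]
  | monomial n a => simp [aeval_monomial, Algebra.algebraMap_eq_smul_one, Matrix.transpose_pow, hQ]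

lemma exists_dotProduct_mulVec_ne_zero {M : Matrix (Fin 3) (Fin 3) ℂ} (hM : Mᵀ = M) (h0 : M ≠ 0) :
    ∃ x : Fin 3 → ℂ, x ⬝ᵥ (M *ᵥ x) ≠ 0 := by
  by_contra! h
  refine h0 (Matrix.ext fun i j => ?_)
  have hs : M j i = M i j := congrFun (congrFun hM i) j
  have hd : ∀ i, M i i = 0 := fun i => by simpa using h (Pi.single i 1)
  have h1 := h (Pi.single i 1 + Pi.single j 1)
  simp [Matrix.mulVec_add, hd, hs] at h1
  simpa using h1

lemma dotProduct_mulVec_comm {M : Matrix (Fin 3) (Fin 3) ℂ} (hM : Mᵀ = M) (x y : Fin 3 → ℂ) :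
    x ⬝ᵥ (M *ᵥ y) = (M *ᵥ x) ⬝ᵥ y := by
  rw [Matrix.dotProduct_mulVec, ← Matrix.mulVec_transpose, hM]

/-- A simple root of the minimal polynomial of a complex symmetric matrix has an eigenvector that is
not null. -/
lemma exists_unit_eigenvector {Q : Matrix (Fin 3) (Fin 3) ℂ} (hQ : Qᵀ = Q) {a : ℂ} {r : ℂ[X]}
    (hm : minpoly ℂ Q = (X - C a) * r) (hr : r.eval a ≠ 0) :
    ∃ v : Fin 3 → ℂ, v ⬝ᵥ v = 1 ∧ Q *ᵥ v = a • v := by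
  have hr0 : r ≠ 0 := by rintro rfl; simp at hr
  -- M = r(Q) is a nonzero symmetric multiple of a projector, M² = r(a) M, with range in the
  -- eigenspace of a. So (Mx)·(Mx) = r(a) x·Mx, which is nonzero for a suitable x and can be scaled
  -- to 1.
  set M := aeval Q r with hM
  have hMs : Mᵀ = M := aeval_transpose hQ r
  have hM0 : M ≠ 0 := by
    intro h
    have := natDegree_le_of_dvd (minpoly.dvd ℂ Q h) hr0
    rw [hm, natDegree_mul (X_sub_C_ne_zero a) hr0] at this
    simp at this
  have hQM : Q * M = a • M := by
    have h := minpoly.aeval ℂ Q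
    rw [hm, map_mul, map_sub, aeval_X, aeval_C, Matrix.sub_mul, sub_eq_zero,
      Algebra.algebraMap_eq_smul_one, Matrix.smul_mul, Matrix.one_mul] at h
    exact h
  have hMM : M * M = r.eval a • M := by
    obtain ⟨k, hk⟩ := X_sub_C_dvd_sub_C_eval (a := a) (p := r)
    have h : aeval Q ((r - C (r.eval a)) * r) = 0 := by
      rw [hk, show (X - C a) * k * r = minpoly ℂ Q * k by rw [hm]; ring, map_mul, minpoly.aeval,
        Matrix.zero_mul]
    rw [map_mul, map_sub, aeval_C, Matrix.sub_mul, sub_eq_zero,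
      Algebra.algebraMap_eq_smul_one, Matrix.smul_mul, Matrix.one_mul] at h
    exact h
  obtain ⟨x, hx⟩ := exists_dotProduct_mulVec_ne_zero hMs hM0
  have hxx : (M *ᵥ x) ⬝ᵥ (M *ᵥ x) = r.eval a * (x ⬝ᵥ (M *ᵥ x)) := by
    rw [← dotProduct_mulVec_comm hMs, Matrix.mulVec_mulVec, hMM, Matrix.smul_mulVec,
      dotProduct_smul, smul_eq_mul]
  obtain ⟨z, hz⟩ := IsAlgClosed.exists_pow_nat_eq ((r.eval a * (x ⬝ᵥ (M *ᵥ x)))⁻¹) two_pos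
  refine ⟨z • (M *ᵥ x), ?_, ?_⟩
  · rw [smul_dotProduct, dotProduct_smul, hxx, smul_eq_mul, smul_eq_mul, ← mul_assoc, ← pow_two, hz]
    exact inv_mul_cancel₀ (mul_ne_zero hr hx)
  · rw [Matrix.mulVec_smul, Matrix.mulVec_mulVec, hQM, Matrix.smul_mulVec, smul_comm]

lemma dotProduct_eigenvectors {Q : Matrix (Fin 3) (Fin 3) ℂ} (hQ : Qᵀ = Q) {a b : ℂ} (hab : a ≠ b)
    {v w : Fin 3 → ℂ} (hv : Q *ᵥ v = a • v) (hw : Q *ᵥ w = b • w) : v ⬝ᵥ w = 0 := by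
  have h := dotProduct_mulVec_comm hQ v w
  rw [hv, hw, dotProduct_smul, smul_dotProduct, smul_eq_mul, smul_eq_mul] at h
  have h' : (a - b) * (v ⬝ᵥ w) = 0 := by linear_combination -h
  exact (mul_eq_zero.mp h').resolve_left (sub_ne_zero.mpr hab)

end Eigenvectors

variable {V : Type*} [AddCommGroup V] [Module ℝ V]

section

variable {g : V →ₗ[ℝ] V →ₗ[ℝ] ℝ} {e f : Module.Basis (Fin 4) ℝ V}
  {W : V →ₗ[ℝ] V →ₗ[ℝ] V →ₗ[ℝ] V →ₗ[ℝ] ℝ}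

/-- The vector with given components. -/
def ofComponents (e : Module.Basis (Fin 4) ℝ V) (c : Fin 4 → ℝ) : V := e.equivFun.symm c

@[simp] lemma repr_ofComponents (e : Module.Basis (Fin 4) ℝ V) (c : Fin 4 → ℝ) (a : Fin 4) :
    e.repr (ofComponents e c) a = c a := by
  rw [ofComponents, ← Module.Basis.equivFun_apply, LinearEquiv.apply_symm_apply]

/-- Positive orientation is needed: for ε = -1 the coordinates in `f` would appear conjugated. -/
lemma IsOriented.bivec_eq (hf : IsOriented e f 1) (x y : V) :
    bivec e x y = bivec f x y 0 • bivec e (f 1) (f 0) + bivec f x y 1 • bivec e (f 2) (f 0)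
      + bivec f x y 2 • bivec e (f 3) (f 0) := by
  obtain ⟨-, h1, h2, h3⟩ := hf
  have h4 := bivec_swap e (f 3) (f 2)
  have h5 := bivec_swap e (f 1) (f 3)
  have h6 := bivec_swap e (f 2) (f 1)
  rw [h1] at h4
  rw [h2] at h5
  rw [h3] at h6
  conv_lhs => rw [← f.sum_repr x, ← f.sum_repr y]
  simp only [Fin.sum_univ_four, bivec_add_left, bivec_add_right, bivec_smul_left, bivec_smul_right,
    bivec_self, h1, h2, h3, h4, h5, h6, bivec_swap e (f 0) (f 1), bivec_swap e (f 0) (f 2),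
    bivec_swap e (f 0) (f 3)]
  generalize bivec e (f 1) (f 0) = b1
  generalize bivec e (f 2) (f 0) = b2
  generalize bivec e (f 3) (f 0) = b3
  ext i
  simp [bivec]
  ring

lemma dotProduct_eq_frame (he : IsOrthonormalFrame g e) (hf : IsOrthonormalFrame g f)
    (v w : Fin 3 → ℂ) :
    v ⬝ᵥ w = (v ⬝ᵥ bivec e (f 1) (f 0)) * (w ⬝ᵥ bivec e (f 1) (f 0))
      + (v ⬝ᵥ bivec e (f 2) (f 0)) * (w ⬝ᵥ bivec e (f 2) (f 0))
      + (v ⬝ᵥ bivec e (f 3) (f 0)) * (w ⬝ᵥ bivec e (f 3) (f 0)) := by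
  conv_lhs => rw [eq_sum_bivec he hf w]
  simp only [dotProduct_add, dotProduct_smul, smul_eq_mul]
  ring

/-- The bivector `v` has no magnetic part for `u`. -/
lemma im_dotProduct_bivec (v : Fin 3 → ℂ) (x u : V) : (v ⬝ᵥ bivec e x u).im =
    e.repr x 1 * (e.repr u 0 * (v 0).im + e.repr u 2 * (v 2).re - e.repr u 3 * (v 1).re)
    + e.repr x 2 * (e.repr u 0 * (v 1).im + e.repr u 3 * (v 0).re - e.repr u 1 * (v 2).re)
    + e.repr x 3 * (e.repr u 0 * (v 2).im + e.repr u 1 * (v 1).re - e.repr u 2 * (v 0).re)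
    - e.repr x 0 * (e.repr u 1 * (v 0).im + e.repr u 2 * (v 1).im + e.repr u 3 * (v 2).im) := by
  simp [bivec, dotProduct, Fin.sum_univ_three]
  ring

/-- Write v = p + iq, so p·q = 0 and |p|² - |q|² = 1. As for an electromagnetic field with E·B = 0
and |E| > |B|, the drift observer u = (|p|, -(p × q)/|p|) sees no magnetic part. -/
lemma exists_observer_real_one (he : IsOrthonormalFrame g e) {v : Fin 3 → ℂ} (hv : v ⬝ᵥ v = 1) :
    ∃ u, IsObserver g u ∧ ∀ x, (v ⬝ᵥ bivec e x u).im = 0 := by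
  have hre := congrArg Complex.re hv
  have him := congrArg Complex.im hv
  simp [dotProduct, Fin.sum_univ_three] at hre him
  obtain ⟨N, hN⟩ : ∃ N, N = (v 0).re ^ 2 + (v 1).re ^ 2 + (v 2).re ^ 2 := ⟨_, rfl⟩
  have hN1 : 1 ≤ N := by nlinarith [sq_nonneg (v 0).im, sq_nonneg (v 1).im, sq_nonneg (v 2).im]
  set r := Real.sqrt N with hr
  have hr2 : r ^ 2 = N := Real.sq_sqrt (by linarith)
  have hr0 : r ≠ 0 := by rintro h; rw [h] at hr2; norm_num at hr2; linarith
  have hpq : (v 0).re * (v 0).im + (v 1).re * (v 1).im + (v 2).re * (v 2).im = 0 := by linarith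
  refine ⟨ofComponents e ![r, -((v 1).re * (v 2).im - (v 2).re * (v 1).im) / r,
    -((v 2).re * (v 0).im - (v 0).re * (v 2).im) / r,
    -((v 0).re * (v 1).im - (v 1).re * (v 0).im) / r], ?_, fun x => ?_⟩
  · rw [IsObserver, he.apply_eq]
    simp
    field_simp
    rw [show r ^ 4 = N ^ 2 by rw [← hr2]; ring]
    linear_combination hr2 - ((v 0).im ^ 2 + (v 1).im ^ 2 + (v 2).im ^ 2) * hN - N * (hre + hN)
      - ((v 0).re * (v 0).im + (v 1).re * (v 1).im + (v 2).re * (v 2).im) * hpq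
  · rw [im_dotProduct_bivec]
    simp
    field_simp
    linear_combination e.repr x 1 * ((v 0).im * (hr2 + hN) + (v 0).re * hpq)
      + e.repr x 2 * ((v 1).im * (hr2 + hN) + (v 1).re * hpq)
      + e.repr x 3 * ((v 2).im * (hr2 + hN) + (v 2).re * hpq)

/-- Let v be the real unit vector n and w = p + iq. Then q is orthogonal to n and p, hence parallel
to m = n × p. A boost along n leaves v real and can remove the imaginary part of w; its size is k =
q·m, with k² = N(N - 1) and N = |p|². -/
lemma exists_observer_real_of_real (he : IsOrthonormalFrame g e) {v w : Fin 3 → ℂ}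
    (hv : v ⬝ᵥ v = 1) (hw : w ⬝ᵥ w = 1) (hvw : v ⬝ᵥ w = 0) (hr : ∀ i, (v i).im = 0) :
    ∃ u, IsObserver g u ∧ (∀ x, (v ⬝ᵥ bivec e x u).im = 0) ∧
      ∀ x, (w ⬝ᵥ bivec e x u).im = 0 := by
  have h1 := congrArg Complex.re hv
  have h2 := congrArg Complex.re hw
  have h3 := congrArg Complex.im hw
  have h4 := congrArg Complex.re hvw
  have h5 := congrArg Complex.im hvw
  simp [dotProduct, Fin.sum_univ_three, hr] at h1 h2 h3 h4 h5
  simp only [IsObserver, he.apply_eq, im_dotProduct_bivec, hr]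
  generalize (v 0).re = n1 at *
  generalize (v 1).re = n2 at *
  generalize (v 2).re = n3 at *
  generalize (w 0).re = p1 at *
  generalize (w 1).re = p2 at *
  generalize (w 2).re = p3 at *
  generalize (w 0).im = q1 at *
  generalize (w 1).im = q2 at *
  generalize (w 2).im = q3 at *
  obtain ⟨N, hN⟩ : ∃ N, N = p1 ^ 2 + p2 ^ 2 + p3 ^ 2 := ⟨_, rfl⟩
  have hN1 : 1 ≤ N := by nlinarith [sq_nonneg q1, sq_nonneg q2, sq_nonneg q3]
  obtain ⟨r, hr⟩ : ∃ r, r = Real.sqrt N := ⟨_, rfl⟩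
  have hr2 : r ^ 2 = N := by rw [hr]; exact Real.sq_sqrt (by linarith)
  have hr0 : r ≠ 0 := by rintro h; rw [h] at hr2; norm_num at hr2; linarith
  have hpq : p1 * q1 + p2 * q2 + p3 * q3 = 0 := by linarith
  obtain ⟨m1, hm1⟩ : ∃ m, m = n2 * p3 - n3 * p2 := ⟨_, rfl⟩
  obtain ⟨m2, hm2⟩ : ∃ m, m = n3 * p1 - n1 * p3 := ⟨_, rfl⟩
  obtain ⟨m3, hm3⟩ : ∃ m, m = n1 * p2 - n2 * p1 := ⟨_, rfl⟩
  obtain ⟨k, hk⟩ : ∃ k, k = q1 * m1 + q2 * m2 + q3 * m3 := ⟨_, rfl⟩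
  have hmm : m1 ^ 2 + m2 ^ 2 + m3 ^ 2 = N := by
    rw [hm1, hm2, hm3, hN]
    linear_combination (p1 ^ 2 + p2 ^ 2 + p3 ^ 2) * h1 - (n1 * p1 + n2 * p2 + n3 * p3) * h4
  have c1 : q2 * m3 - q3 * m2 = 0 := by
    rw [hm2, hm3]; linear_combination n1 * hpq - p1 * h5
  have c2 : q3 * m1 - q1 * m3 = 0 := by
    rw [hm1, hm3]; linear_combination n2 * hpq - p2 * h5
  have c3 : q1 * m2 - q2 * m1 = 0 := by
    rw [hm1, hm2]; linear_combination n3 * hpq - p3 * h5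
  have d1 : N * q1 = k * m1 := by rw [← hmm, hk]; linear_combination m2 * c3 - m3 * c2
  have d2 : N * q2 = k * m2 := by rw [← hmm, hk]; linear_combination m3 * c1 - m1 * c3
  have d3 : N * q3 = k * m3 := by rw [← hmm, hk]; linear_combination m1 * c2 - m2 * c1
  have hkk : k ^ 2 = N * (N - 1) := by
    have h0 : N * k ^ 2 = N * (N * (N - 1)) := by
      linear_combination -k ^ 2 * hmm - N ^ 2 * (hN + h2) - (k * m1 + N * q1) * d1
        - (k * m2 + N * q2) * d2 - (k * m3 + N * q3) * d3
    exact mul_left_cancel₀ (by linarith) h0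
  refine ⟨ofComponents e ![r, -(k / r) * n1, -(k / r) * n2, -(k / r) * n3], ?_, fun x => ?_,
    fun x => ?_⟩
  · simp
    field_simp
    rw [show r ^ 4 = N ^ 2 by rw [← hr2]; ring]
    linear_combination hkk + k ^ 2 * h1 + hr2
  · simp; ring
  · simp
    field_simp
    linear_combination e.repr x 1 * (d1 + q1 * hr2 + k * hm1)
      + e.repr x 2 * (d2 + q2 * hr2 + k * hm2) + e.repr x 3 * (d3 + q3 * hr2 + k * hm3)
      + k * e.repr x 0 * h5

/-- Two orthonormal complex vectors are real for a common observer. -/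
lemma exists_observer_real_two (he : IsOrthonormalFrame g e) {v w : Fin 3 → ℂ}
    (hv : v ⬝ᵥ v = 1) (hw : w ⬝ᵥ w = 1) (hvw : v ⬝ᵥ w = 0) :
    ∃ u, IsObserver g u ∧ (∀ x, (v ⬝ᵥ bivec e x u).im = 0) ∧
      ∀ x, (w ⬝ᵥ bivec e x u).im = 0 := by
  -- First make `v` real, then work in the coordinates of that observer's frame and boost along `v`.
  obtain ⟨u, hu, hvu⟩ := exists_observer_real_one he hv
  obtain ⟨f, hf, rfl, ho⟩ := exists_oriented_frame he hu
  let c : (Fin 3 → ℂ) → Fin 3 → ℂ := fun v => ![v ⬝ᵥ bivec e (f 1) (f 0),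
    v ⬝ᵥ bivec e (f 2) (f 0), v ⬝ᵥ bivec e (f 3) (f 0)]
  have hc : ∀ v w, c v ⬝ᵥ c w = v ⬝ᵥ w := by
    intro v w
    rw [dotProduct_eq_frame he hf v w]
    simp [c, dotProduct, Fin.sum_univ_three]
  have hb : ∀ v x y, v ⬝ᵥ bivec e x y = c v ⬝ᵥ bivec f x y := by
    intro v x y
    rw [ho.bivec_eq x y]
    simp only [dotProduct_add, dotProduct_smul, smul_eq_mul]
    simp only [c, dotProduct, Fin.sum_univ_three, Matrix.cons_val]
    ring
  obtain ⟨u', hu', h1, h2⟩ := exists_observer_real_of_real hf (v := c v) (w := c w)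
    (by rw [hc, hv]) (by rw [hc, hw]) (by rw [hc, hvw]) (by
      intro i; fin_cases i <;> simp [c, hvu])
  exact ⟨u', hu', fun x => by rw [hb, h1], fun x => by rw [hb, h2]⟩

/-- Two orthonormal complex vectors are the self-dual bivectors of an orthonormal frame. -/
lemma exists_frame_of_orthonormal (he : IsOrthonormalFrame g e) {v w : Fin 3 → ℂ}
    (hv : v ⬝ᵥ v = 1) (hw : w ⬝ᵥ w = 1) (hvw : v ⬝ᵥ w = 0) :
    ∃ f : Module.Basis (Fin 4) ℝ V, IsOrthonormalFrame g f ∧ bivec e (f 1) (f 0) = v ∧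
      bivec e (f 2) (f 0) = w := by
  obtain ⟨u, hu, hv', hw'⟩ := exists_observer_real_two he hv hw hvw
  obtain ⟨k, hk, rfl⟩ := exists_frame he hu
  have hcast : ∀ z : ℂ, z.im = 0 → z = (z.re : ℂ) := fun z hz => by
    apply Complex.ext <;> simp [hz]
  have ev := eq_sum_bivec he hk v
  have ew := eq_sum_bivec he hk w
  have hvv := dotProduct_eq_frame he hk v v
  have hww := dotProduct_eq_frame he hk w w
  have hvw' := dotProduct_eq_frame he hk v w
  rw [hcast _ (hv' (k 1)), hcast _ (hv' (k 2)), hcast _ (hv' (k 3))] at ev hvv hvw'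
  rw [hcast _ (hw' (k 1)), hcast _ (hw' (k 2)), hcast _ (hw' (k 3))] at ew hww hvw'
  rw [hv] at hvv
  rw [hw] at hww
  rw [hvw] at hvw'
  generalize (v ⬝ᵥ bivec e (k 1) (k 0)).re = a1 at *
  generalize (v ⬝ᵥ bivec e (k 2) (k 0)).re = a2 at *
  generalize (v ⬝ᵥ bivec e (k 3) (k 0)).re = a3 at *
  generalize (w ⬝ᵥ bivec e (k 1) (k 0)).re = b1 at *
  generalize (w ⬝ᵥ bivec e (k 2) (k 0)).re = b2 at *
  generalize (w ⬝ᵥ bivec e (k 3) (k 0)).re = b3 at *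
  have r1 : 1 = a1 * a1 + a2 * a2 + a3 * a3 := by exact_mod_cast hvv
  have r2 : 1 = b1 * b1 + b2 * b2 + b3 * b3 := by exact_mod_cast hww
  have r3 : 0 = a1 * b1 + a2 * b2 + a3 * b3 := by exact_mod_cast hvw'
  -- For this observer `v` and `w` have real coefficients, so they come from two orthonormal spatial
  -- vectors; the third leg is their cross product.
  obtain ⟨f, hf, hfv⟩ := exists_basis_of_orthonormal g e ![k 0, a1 • k 1 + a2 • k 2 + a3 • k 3,
      b1 • k 1 + b2 • k 2 + b3 • k 3, (a2 * b3 - a3 * b2) • k 1 + (a3 * b1 - a1 * b3) • k 2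
        + (a1 * b2 - a2 * b1) • k 3] (by
    intro i j
    fin_cases i <;> fin_cases j <;>
      simp [hk _ _, eta]
    · linear_combination -r1
    · linear_combination -r3
    · ring
    · linear_combination -r3
    · linear_combination -r2
    · ring
    · ring
    · ring
    · linear_combination -r1 * (b1 * b1 + b2 * b2 + b3 * b3) - r2
        + r3 * (a1 * b1 + a2 * b2 + a3 * b3))
  refine ⟨f, hf, ?_, ?_⟩
  · rw [ev]; simp [hfv, bivec_add_left, bivec_smul_left]
  · rw [ew]; simp [hfv, bivec_add_left, bivec_smul_left]

/-- Two orthonormal eigenvectors are enough: symmetry makes the third axis diagonal as well. The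
cofactor `r` lets types I and D share the argument. -/
lemma exists_principal (he : IsOrthonormalFrame g e) (hW : IsWeylTensor e W) {a b : ℂ}
    (hab : a ≠ b) {r : ℂ[X]} (hm : minpoly ℂ (weylMatrix e W) = (X - C a) * ((X - C b) * r))
    (ha : r.eval a ≠ 0) (hb : r.eval b ≠ 0) : ∃ u, IsPrincipalObserver g e W u := by
  have hQ := weylMatrix_transpose hW
  obtain ⟨v, hv, hQv⟩ := exists_unit_eigenvector hQ hm (by simp [ha, sub_eq_zero, hab])
  obtain ⟨w, hw, hQw⟩ := exists_unit_eigenvector hQ (a := b) (r := (X - C a) * r)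
    (by rw [hm]; ring) (by simp [hb, sub_eq_zero, hab.symm])
  have hvw := dotProduct_eigenvectors hQ hab hQv hQw
  obtain ⟨f, hf, h1, h2⟩ := exists_frame_of_orthonormal he hv hw hvw
  refine ⟨f 0, f, hf, rfl, ?_⟩
  have hP := frameWeyl_transpose (f := f) hW
  have hO : ∀ i j : Fin 3, i ≠ j →
      bivec e (f i.succ) (f 0) ⬝ᵥ bivec e (f j.succ) (f 0) = 0 := by
    intro i j hij
    rw [bivec_dotProduct_observer he]; simp [hf _ _, hij]
  have h0 : ∀ j : Fin 3, j ≠ 0 → frameWeyl e f W 0 j = 0 := by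
    intro j hj
    rw [frameWeyl_apply, dotProduct_mulVec_comm hQ, Fin.succ_zero_eq_one, h1, hQv,
      smul_dotProduct, ← h1, ← Fin.succ_zero_eq_one, hO 0 j hj.symm, smul_zero]
  have h0' : ∀ j : Fin 3, j ≠ 1 → frameWeyl e f W 1 j = 0 := by
    intro j hj
    rw [frameWeyl_apply, dotProduct_mulVec_comm hQ, Fin.succ_one_eq_two, h2, hQw,
      smul_dotProduct, ← h2, ← Fin.succ_one_eq_two, hO 1 j hj.symm, smul_zero]
  have hs : ∀ i j, frameWeyl e f W i j = frameWeyl e f W j i := fun i j =>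
    congrFun (congrFun hP j) i
  have hz : ∀ i j : Fin 3, i ≠ j → frameWeyl e f W i j = 0 := by
    intro i j hij
    fin_cases i
    · exact h0 j hij.symm
    · exact h0' j hij.symm
    · rw [hs]
      fin_cases j
      · exact h0 2 (by decide)
      · exact h0' 2 (by decide)
      · exact absurd rfl hij
  intro i j hij
  have h := hz i j hij
  rw [frameWeyl_eq_weylC hW, weylC] at h
  have hre := congrArg Complex.re h
  have him := congrArg Complex.im h
  simp at hre him
  exact ⟨hre, him⟩

lemma exists_principal_of_isTypeD (he : IsOrthonormalFrame g e) (hW : IsWeylTensor e W)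
    (h : IsTypeD e W) : ∃ u, IsPrincipalObserver g e W u := by
  obtain ⟨a, b, hab, hm⟩ := h
  exact exists_principal he hW hab (r := 1) (by rw [hm, mul_one]) (by simp) (by simp)

lemma exists_principal_of_isTypeI (he : IsOrthonormalFrame g e) (hW : IsWeylTensor e W)
    (h : IsTypeI e W) : ∃ u, IsPrincipalObserver g e W u := by
  obtain ⟨a, b, c, hab, hac, hbc, hm⟩ := h
  exact exists_principal he hW hab (r := X - C c) (by rw [hm, mul_assoc])
    (by simp [sub_eq_zero, hac]) (by simp [sub_eq_zero, hbc])

end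

end

end BelRobinson

/-! ### Null vectors of ℂ³ and null eigenvectors -/

namespace BelRobinson

noncomputable section

open Matrix

/-- A complex null vector, normalized so that its real and imaginary parts are unit vectors. -/
def IsNullUnit (n : Fin 3 → ℂ) : Prop := n ⬝ᵥ n = 0 ∧ n ⬝ᵥ star n = 2

/-- The cross product of the real and imaginary parts. -/
def nullNormal (n : Fin 3 → ℂ) : Fin 3 → ℂ :=
  ![(((n 1).re * (n 2).im - (n 2).re * (n 1).im : ℝ) : ℂ),
    (((n 2).re * (n 0).im - (n 0).re * (n 2).im : ℝ) : ℂ),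
    (((n 0).re * (n 1).im - (n 1).re * (n 0).im : ℝ) : ℂ)]

section

variable {n : Fin 3 → ℂ}

lemma IsNullUnit.real_eqs (hn : IsNullUnit n) :
    (n 0).re ^ 2 + (n 1).re ^ 2 + (n 2).re ^ 2 = 1 ∧
    (n 0).im ^ 2 + (n 1).im ^ 2 + (n 2).im ^ 2 = 1 ∧
    (n 0).re * (n 0).im + (n 1).re * (n 1).im + (n 2).re * (n 2).im = 0 := by
  have h1 := congrArg Complex.re hn.1
  have h2 := congrArg Complex.im hn.1
  have h3 := congrArg Complex.re hn.2
  simp [dotProduct, Fin.sum_univ_three] at h1 h2 h3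
  refine ⟨by linarith, by linarith, by linarith⟩

lemma nullNormal_self (hn : IsNullUnit n) : nullNormal n ⬝ᵥ nullNormal n = 1 := by
  obtain ⟨h1, h2, h3⟩ := hn.real_eqs
  simp only [dotProduct, Fin.sum_univ_three, nullNormal, Matrix.cons_val]
  norm_cast
  linear_combination ((n 0).im ^ 2 + (n 1).im ^ 2 + (n 2).im ^ 2) * h1 + h2
    - ((n 0).re * (n 0).im + (n 1).re * (n 1).im + (n 2).re * (n 2).im) * h3

lemma dotProduct_nullNormal (n : Fin 3 → ℂ) : n ⬝ᵥ nullNormal n = 0 := by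
  simp [dotProduct, Fin.sum_univ_three, nullNormal, Complex.ext_iff]
  constructor <;> ring

lemma star_dotProduct_nullNormal (n : Fin 3 → ℂ) : star n ⬝ᵥ nullNormal n = 0 := by
  simp [dotProduct, Fin.sum_univ_three, nullNormal, Complex.ext_iff]
  constructor <;> ring

/-- Every vector is expanded in a null vector, its conjugate and the normal of both. -/
lemma null_expansion (hn : IsNullUnit n) (w : Fin 3 → ℂ) :
    w = (1 / 2 * (w ⬝ᵥ star n)) • n + (1 / 2 * (w ⬝ᵥ n)) • star n
      + (w ⬝ᵥ nullNormal n) • nullNormal n := by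
  obtain ⟨h1, h2, h3⟩ := hn.real_eqs
  -- The rows Re n, Im n and their cross product are orthonormal; the expansion is the
  -- orthonormality of the columns.
  let M : Matrix (Fin 3) (Fin 3) ℝ := !![(n 0).re, (n 1).re, (n 2).re;
    (n 0).im, (n 1).im, (n 2).im; (n 1).re * (n 2).im - (n 2).re * (n 1).im,
    (n 2).re * (n 0).im - (n 0).re * (n 2).im, (n 0).re * (n 1).im - (n 1).re * (n 0).im]
  have hM : M * Mᵀ = 1 := by
    ext i j
    fin_cases i <;> fin_cases j <;> simp [M, Matrix.mul_apply, Fin.sum_univ_three]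
    · linear_combination h1
    · linear_combination h3
    · ring
    · linear_combination h3
    · linear_combination h2
    · ring
    · ring
    · ring
    · linear_combination ((n 0).im ^ 2 + (n 1).im ^ 2 + (n 2).im ^ 2) * h1 + h2
        - ((n 0).re * (n 0).im + (n 1).re * (n 1).im + (n 2).re * (n 2).im) * h3
  have hM' : Mᵀ * M = 1 := mul_eq_one_comm.mp hM
  have hc : ∀ i j, ((M 0 i : ℂ) * M 0 j + M 1 i * M 1 j + M 2 i * M 2 j)
      = (1 : Matrix (Fin 3) (Fin 3) ℂ) i j := by
    intro i j
    have h := congrFun (congrFun hM' i) j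
    rw [Matrix.mul_apply, Fin.sum_univ_three] at h
    have h' : ((M 0 i * M 0 j + M 1 i * M 1 j + M 2 i * M 2 j : ℝ) : ℂ)
        = ((1 : Matrix (Fin 3) (Fin 3) ℝ) i j : ℝ) := congrArg _ h
    rw [Matrix.one_apply] at h' ⊢
    push_cast at h'
    rw [h']
    split_ifs <;> simp
  have hn' : ∀ i, n i = M 0 i + M 1 i * Complex.I := by
    intro i; fin_cases i <;> simp [M]
  have hs : ∀ i, star n i = M 0 i - M 1 i * Complex.I := by
    intro i; rw [Pi.star_apply, hn' i]; simp; ring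
  have hm : ∀ i, nullNormal n i = M 2 i := by
    intro i; fin_cases i <;> simp [M, nullNormal]
  have hw : ∀ i, w i = (1 : Matrix (Fin 3) (Fin 3) ℂ) i 0 * w 0
      + (1 : Matrix (Fin 3) (Fin 3) ℂ) i 1 * w 1 + (1 : Matrix (Fin 3) (Fin 3) ℂ) i 2 * w 2 := by
    intro i; fin_cases i <;> simp [Matrix.one_apply]
  ext i
  simp only [Pi.add_apply, Pi.smul_apply, smul_eq_mul, dotProduct, Fin.sum_univ_three, hn', hs, hm]
  conv_lhs => rw [hw i, ← hc i 0, ← hc i 1, ← hc i 2]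
  linear_combination (-(M 1 0 : ℂ) * M 1 i * w 0 - M 1 1 * M 1 i * w 1 - M 1 2 * M 1 i * w 2)
    * -Complex.I_sq

/-- The factor is a phase, which rotates Re n and Im n within their plane. -/
lemma IsNullUnit.of_smul {c : ℂ} {n' : Fin 3 → ℂ} (hn : IsNullUnit n) (hn' : IsNullUnit n')
    (h : n' = c • n) : nullNormal n' = nullNormal n := by
  have hc : c * starRingEnd ℂ c = 1 := by
    have h2 := hn'.2
    rw [h, star_smul, smul_dotProduct, dotProduct_smul, hn.2] at h2
    simp at h2
    linear_combination h2 / 2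
  have hc' : c.re * c.re + c.im * c.im = 1 := by
    rw [Complex.mul_conj, Complex.normSq_apply] at hc; exact_mod_cast hc
  ext i
  fin_cases i <;> simp [nullNormal, h, -Complex.ofReal_sub, -Complex.ofReal_mul, Complex.ext_iff]
  · linear_combination ((n 1).re * (n 2).im - (n 2).re * (n 1).im) * hc'
  · linear_combination ((n 2).re * (n 0).im - (n 0).re * (n 2).im) * hc'
  · linear_combination ((n 0).re * (n 1).im - (n 1).re * (n 0).im) * hc'

lemma exists_isNullUnit_smul {v : Fin 3 → ℂ} (hv : v ⬝ᵥ v = 0) (h0 : v ≠ 0) :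
    ∃ c : ℂ, IsNullUnit (c • v) := by
  obtain ⟨s, hs⟩ : ∃ s : ℝ, s = Complex.normSq (v 0) + Complex.normSq (v 1)
    + Complex.normSq (v 2) := ⟨_, rfl⟩
  have hvs : v ⬝ᵥ star v = s := by
    rw [hs]; simp [dotProduct, Fin.sum_univ_three, Complex.mul_conj]
  have hpos : 0 < s := by
    have n0 := Complex.normSq_nonneg (v 0)
    have n1 := Complex.normSq_nonneg (v 1)
    have n2 := Complex.normSq_nonneg (v 2)
    refine lt_of_le_of_ne (by linarith) fun h => h0 ?_
    ext i
    fin_cases i <;> exact Complex.normSq_eq_zero.mp (by dsimp; linarith)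
  refine ⟨(Real.sqrt (2 / s) : ℝ), ?_, ?_⟩
  · rw [smul_dotProduct, dotProduct_smul, hv]; simp
  · rw [star_smul, smul_dotProduct, dotProduct_smul, hvs]
    simp only [smul_eq_mul, Complex.star_def, Complex.conj_ofReal, ← mul_assoc]
    norm_cast
    rw [Real.mul_self_sqrt (by positivity)]
    field_simp

end

section

variable {n : Fin 3 → ℂ} {S : Matrix (Fin 3) (Fin 3) ℂ} {σ : ℂ}

/-- In the basis n, m, n̄, with m the normal, symmetry makes S triangular: Sm·n = m·Sn = 0. The
n̄-coefficient of Sn̄ is again σ, the trace leaves tr S - 2σ for m, and symmetry ties the two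
off-diagonal terms to one `d`. -/
lemma mulVec_of_null_eigenvector (hn : IsNullUnit n) (hS : Sᵀ = S) (hSn : S *ᵥ n = σ • n) :
    ∃ c d : ℂ, S *ᵥ nullNormal n = (S.trace - 2 * σ) • nullNormal n + d • n ∧
      S *ᵥ star n = σ • star n + (2 * c) • n + (2 * d) • nullNormal n := by
  have hc := dotProduct_mulVec_comm hS
  have hnm := dotProduct_nullNormal n
  have hsm := star_dotProduct_nullNormal n
  have e1 : (S *ᵥ nullNormal n) ⬝ᵥ n = 0 := by
    rw [← hc, hSn, dotProduct_smul, dotProduct_comm, hnm, smul_zero]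
  have e2 : (S *ᵥ star n) ⬝ᵥ n = 2 * σ := by
    rw [← hc, hSn, dotProduct_smul, dotProduct_comm, hn.2, smul_eq_mul, mul_comm]
  have e3 : (S *ᵥ star n) ⬝ᵥ nullNormal n = (S *ᵥ nullNormal n) ⬝ᵥ star n := by
    rw [← hc, dotProduct_comm]
  have htr : S.trace = 2 * σ + (S *ᵥ nullNormal n) ⬝ᵥ nullNormal n := by
    have hcol : ∀ j, S *ᵥ Pi.single j 1 = (1 / 2 * star n j) • (S *ᵥ n)
        + (1 / 2 * n j) • (S *ᵥ star n) + nullNormal n j • (S *ᵥ nullNormal n) := by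
      intro j
      conv_lhs => rw [null_expansion hn (Pi.single j 1)]
      simp [Matrix.mulVec_add, Matrix.mulVec_smul]
    have hjj : ∀ j, S j j = 1 / 2 * star n j * (S *ᵥ n) j + 1 / 2 * n j * (S *ᵥ star n) j
        + nullNormal n j * (S *ᵥ nullNormal n) j := by
      intro j
      have := congrFun (hcol j) j
      simpa using this
    have : S.trace = 1 / 2 * (star n ⬝ᵥ (S *ᵥ n)) + 1 / 2 * ((S *ᵥ star n) ⬝ᵥ n)
        + (S *ᵥ nullNormal n) ⬝ᵥ nullNormal n := by
      rw [Matrix.trace_fin_three, hjj 0, hjj 1, hjj 2]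
      simp only [dotProduct, Fin.sum_univ_three]
      ring
    rw [this, e2, hSn, dotProduct_smul, dotProduct_comm, hn.2, smul_eq_mul]
    ring
  refine ⟨1 / 4 * ((S *ᵥ star n) ⬝ᵥ star n), 1 / 2 * ((S *ᵥ nullNormal n) ⬝ᵥ star n), ?_, ?_⟩
  · conv_lhs => rw [null_expansion hn (S *ᵥ nullNormal n)]
    rw [e1, htr]
    simp [add_comm]
  · conv_lhs => rw [null_expansion hn (S *ᵥ star n)]
    rw [e2, e3]
    ext i
    simp
    ring

/-- The quadratic form of a symmetric matrix with a null eigenvector. -/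
lemma dotProduct_mulVec_of_null_eigenvector (hn : IsNullUnit n) (hS : Sᵀ = S)
    (hSn : S *ᵥ n = σ • n) : ∃ c d : ℂ, ∀ x y : Fin 3 → ℂ, x ⬝ᵥ (S *ᵥ y) = σ * (x ⬝ᵥ y)
      + (S.trace - 3 * σ) * ((x ⬝ᵥ nullNormal n) * (y ⬝ᵥ nullNormal n))
      + c * ((x ⬝ᵥ n) * (y ⬝ᵥ n))
      + d * ((x ⬝ᵥ n) * (y ⬝ᵥ nullNormal n) + (x ⬝ᵥ nullNormal n) * (y ⬝ᵥ n)) := by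
  obtain ⟨c, d, h1, h2⟩ := mulVec_of_null_eigenvector hn hS hSn
  refine ⟨c, d, fun x y => ?_⟩
  conv_lhs => rw [null_expansion hn y]
  conv_rhs => arg 1; arg 1; arg 1; rw [null_expansion hn y]
  simp only [Matrix.mulVec_add, Matrix.mulVec_smul, hSn, h1, h2, dotProduct_add, dotProduct_smul,
    smul_eq_mul]
  ring

/-- The trace of the square of a trace-free symmetric matrix with a null eigenvector. -/
lemma trace_sq_of_null_eigenvector (hn : IsNullUnit n) (hS : Sᵀ = S) (ht : S.trace = 0)
    (hSn : S *ᵥ n = σ • n) : (S ^ 2).trace = 6 * σ ^ 2 := by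
  obtain ⟨c, d, h1, h2⟩ := mulVec_of_null_eigenvector hn hS hSn
  have hS2 : (S ^ 2)ᵀ = S ^ 2 := by rw [Matrix.transpose_pow, hS]
  have hSn2 : S ^ 2 *ᵥ n = σ ^ 2 • n := by
    rw [pow_two, ← Matrix.mulVec_mulVec, hSn, Matrix.mulVec_smul, hSn, smul_smul, pow_two]
  obtain ⟨c', d', h1', -⟩ := mulVec_of_null_eigenvector hn hS2 hSn2
  rw [ht] at h1
  have h3 : S ^ 2 *ᵥ nullNormal n = (4 * σ ^ 2) • nullNormal n + (-σ * d) • n := by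
    rw [pow_two, ← Matrix.mulVec_mulVec, h1, Matrix.mulVec_add, Matrix.mulVec_smul,
      Matrix.mulVec_smul, h1, hSn]
    ext i
    simp
    ring
  rw [h1'] at h3
  -- The m-component of S²m is tr S² - 2σ² by the general formula and (-2σ)² by direct computation.
  have h4 := congrArg (fun v => v ⬝ᵥ nullNormal n) h3
  simp [add_dotProduct, smul_dotProduct, nullNormal_self hn, dotProduct_nullNormal] at h4
  linear_combination h4

/-- Null eigenvectors are unique up to a scalar factor if `(S - σ)(S + 2σ) ≠ 0`. -/
lemma null_eigenvector_unique (hn : IsNullUnit n) (hS : Sᵀ = S) (ht : S.trace = 0)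
    (hSn : S *ᵥ n = σ • n) (hN : (S - σ • 1) * (S + (2 * σ) • 1) ≠ 0) {n' : Fin 3 → ℂ}
    (hn' : n' ⬝ᵥ n' = 0) {τ : ℂ} (hSn' : S *ᵥ n' = τ • n') : ∃ c : ℂ, n' = c • n := by
  obtain ⟨c, d, h1, h2⟩ := mulVec_of_null_eigenvector hn hS hSn
  rw [ht] at h1
  have hex := null_expansion hn n'
  have hnn' : n' ⬝ᵥ n = 0 := by
    by_contra h0
    have hτ : τ = σ := by
      have h := dotProduct_mulVec_comm hS n' n
      rw [hSn, hSn', dotProduct_smul, smul_dotProduct, smul_eq_mul, smul_eq_mul] at h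
      exact (mul_right_cancel₀ h0 h).symm
    set γ := n' ⬝ᵥ nullNormal n
    set β := n' ⬝ᵥ n
    have h3 : (β * c + γ * d) • n + (β * d - 3 * σ * γ) • nullNormal n = 0 := by
      rw [hτ, hex] at hSn'
      simp only [Matrix.mulVec_add, Matrix.mulVec_smul, hSn, h1, h2] at hSn'
      ext i
      have := congrFun hSn' i
      simp at this ⊢
      linear_combination this
    have h4 := congrArg (fun v => v ⬝ᵥ nullNormal n) h3
    have h5 := congrArg (fun v => v ⬝ᵥ star n) h3
    simp only [add_dotProduct, smul_dotProduct, nullNormal_self hn, dotProduct_nullNormal, hn.2,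
      dotProduct_comm (nullNormal n) (star n), star_dotProduct_nullNormal, zero_dotProduct,
      smul_eq_mul] at h4 h5
    -- A second null eigenvector with n'·n ≠ 0 forces this relation, which makes (S - σ)(S + 2σ)
    -- vanish on n, m and n̄, against `hN`. So n'·n = 0, and nullness then removes the m-component
    -- of n'.
    have h6 : 3 * σ * c + d ^ 2 = 0 := by
      refine (mul_eq_zero.mp ?_).resolve_left h0
      linear_combination (3 * σ / 2) * h5 + d * h4
    refine hN ?_
    have hN1 : ((S - σ • 1) * (S + (2 * σ) • 1)) *ᵥ n = 0 := by
      rw [← Matrix.mulVec_mulVec]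
      simp only [Matrix.add_mulVec, Matrix.sub_mulVec, Matrix.smul_mulVec, Matrix.one_mulVec,
        Matrix.mulVec_add, Matrix.mulVec_smul, hSn]
      ext i; simp
    have hN2 : ((S - σ • 1) * (S + (2 * σ) • 1)) *ᵥ nullNormal n = 0 := by
      rw [← Matrix.mulVec_mulVec]
      simp only [Matrix.add_mulVec, Matrix.sub_mulVec, Matrix.smul_mulVec, Matrix.one_mulVec,
        Matrix.mulVec_add, Matrix.mulVec_smul, hSn, h1]
      ext i; simp
    have hN3 : ((S - σ • 1) * (S + (2 * σ) • 1)) *ᵥ star n = 0 := by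
      rw [← Matrix.mulVec_mulVec]
      simp only [Matrix.add_mulVec, Matrix.sub_mulVec, Matrix.smul_mulVec, Matrix.one_mulVec,
        Matrix.mulVec_add, Matrix.mulVec_smul, hSn, h1, h2]
      ext i
      simp
      linear_combination 2 * n i * h6
    refine Matrix.ext_of_mulVec_single fun j => ?_
    rw [null_expansion hn (Pi.single j 1), Matrix.mulVec_add, Matrix.mulVec_add,
      Matrix.mulVec_smul, Matrix.mulVec_smul, Matrix.mulVec_smul, hN1, hN2, hN3]
    simp
  rw [hnn'] at hex
  have hγ : n' ⬝ᵥ nullNormal n = 0 := by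
    have h := hn'
    rw [hex] at h
    simp [add_dotProduct, dotProduct_add, hn.1, nullNormal_self hn, dotProduct_nullNormal,
      dotProduct_comm (nullNormal n) n] at h
    exact h
  rw [hγ] at hex
  exact ⟨1 / 2 * (n' ⬝ᵥ star n), by conv_lhs => rw [hex]
                                    simp⟩

end

end

end BelRobinson

/-! ### Null directions of spacetime and fundamental vectors -/

namespace BelRobinson

noncomputable section

open Matrix

variable {V : Type*} [AddCommGroup V] [Module ℝ V]

section

variable {n : Fin 3 → ℂ}

lemma nullNormal_ofReal (n : Fin 3 → ℂ) (i : Fin 3) :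
    nullNormal n i = ((nullNormal n i).re : ℂ) := by
  fin_cases i <;> simp [nullNormal]

lemma nullNormal_re_self (hn : IsNullUnit n) :
    (nullNormal n 0).re ^ 2 + (nullNormal n 1).re ^ 2 + (nullNormal n 2).re ^ 2 = 1 := by
  have h := nullNormal_self hn
  rw [dotProduct, Fin.sum_univ_three, nullNormal_ofReal n 0, nullNormal_ofReal n 1,
    nullNormal_ofReal n 2] at h
  have h' : (nullNormal n 0).re * (nullNormal n 0).re + (nullNormal n 1).re * (nullNormal n 1).re
    + (nullNormal n 2).re * (nullNormal n 2).re = 1 := by exact_mod_cast h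
  linear_combination h'

/-- The cross products of the normal of a null vector with its real and imaginary parts. -/
lemma nullNormal_cross (hn : IsNullUnit n) :
    (nullNormal n 1).re * (n 2).re - (nullNormal n 2).re * (n 1).re = (n 0).im ∧
    (nullNormal n 2).re * (n 0).re - (nullNormal n 0).re * (n 2).re = (n 1).im ∧
    (nullNormal n 0).re * (n 1).re - (nullNormal n 1).re * (n 0).re = (n 2).im ∧
    (nullNormal n 1).re * (n 2).im - (nullNormal n 2).re * (n 1).im = -(n 0).re ∧
    (nullNormal n 2).re * (n 0).im - (nullNormal n 0).re * (n 2).im = -(n 1).re ∧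
    (nullNormal n 0).re * (n 1).im - (nullNormal n 1).re * (n 0).im = -(n 2).re := by
  obtain ⟨h1, h2, h3⟩ := hn.real_eqs
  have e0 : (nullNormal n 0).re = (n 1).re * (n 2).im - (n 2).re * (n 1).im :=
    Complex.ofReal_re _
  have e1 : (nullNormal n 1).re = (n 2).re * (n 0).im - (n 0).re * (n 2).im :=
    Complex.ofReal_re _
  have e2 : (nullNormal n 2).re = (n 0).re * (n 1).im - (n 1).re * (n 0).im :=
    Complex.ofReal_re _
  rw [e0, e1, e2]
  refine ⟨?_, ?_, ?_, ?_, ?_, ?_⟩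
  · linear_combination (n 0).im * h1 - (n 0).re * h3
  · linear_combination (n 1).im * h1 - (n 1).re * h3
  · linear_combination (n 2).im * h1 - (n 2).re * h3
  · linear_combination (n 0).im * h3 - (n 0).re * h2
  · linear_combination (n 1).im * h3 - (n 1).re * h2
  · linear_combination (n 2).im * h3 - (n 2).re * h2

/-- A real unit vector is the normal of a complex null vector. -/
lemma exists_nullNormal_eq (m0 m1 m2 : ℝ) (hm : m0 ^ 2 + m1 ^ 2 + m2 ^ 2 = 1) :
    ∃ n, IsNullUnit n ∧ (nullNormal n 0).re = m0 ∧ (nullNormal n 1).re = m1 ∧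
      (nullNormal n 2).re = m2 := by
  obtain ⟨p0, p1, p2, hp, hpm⟩ : ∃ p0 p1 p2 : ℝ, p0 ^ 2 + p1 ^ 2 + p2 ^ 2 = 1 ∧
      p0 * m0 + p1 * m1 + p2 * m2 = 0 := by
    by_cases h : m0 ^ 2 + m1 ^ 2 = 0
    · have h0 : m0 = 0 := by nlinarith [sq_nonneg m0, sq_nonneg m1]
      exact ⟨1, 0, 0, by norm_num, by rw [h0]; ring⟩
    · have hpos : 0 < m0 ^ 2 + m1 ^ 2 := lt_of_le_of_ne (by positivity) (Ne.symm h)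
      refine ⟨-m1 / √(m0 ^ 2 + m1 ^ 2), m0 / √(m0 ^ 2 + m1 ^ 2), 0, ?_, by ring⟩
      rw [div_pow, div_pow, Real.sq_sqrt hpos.le]
      field_simp
      ring
  -- n = p + i m × p, where p is a unit vector orthogonal to m.
  refine ⟨![⟨p0, m1 * p2 - m2 * p1⟩, ⟨p1, m2 * p0 - m0 * p2⟩, ⟨p2, m0 * p1 - m1 * p0⟩],
    ⟨?_, ?_⟩, ?_, ?_, ?_⟩
  · apply Complex.ext
    · simp [dotProduct, Fin.sum_univ_three]
      linear_combination (1 - (m0 ^ 2 + m1 ^ 2 + m2 ^ 2)) * hp - hm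
        + (p0 * m0 + p1 * m1 + p2 * m2) * hpm
    · simp [dotProduct, Fin.sum_univ_three]
      ring
  · apply Complex.ext
    · simp [dotProduct, Fin.sum_univ_three]
      linear_combination (1 + (m0 ^ 2 + m1 ^ 2 + m2 ^ 2)) * hp + hm
        - (p0 * m0 + p1 * m1 + p2 * m2) * hpm
    · simp [dotProduct, Fin.sum_univ_three]
      ring
  · simp [nullNormal]
    linear_combination m0 * hp - p0 * hpm
  · simp [nullNormal]
    linear_combination m1 * hp - p1 * hpm
  · simp [nullNormal]
    linear_combination m2 * hp - p2 * hpm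

end

/-- The null vector of spacetime that is represented by a complex null vector. -/
def nullVec (e : Module.Basis (Fin 4) ℝ V) (n : Fin 3 → ℂ) : V :=
  ofComponents e ![1, -(nullNormal n 0).re, -(nullNormal n 1).re, -(nullNormal n 2).re]

section

variable {g : V →ₗ[ℝ] V →ₗ[ℝ] ℝ} {e : Module.Basis (Fin 4) ℝ V}
  {W : V →ₗ[ℝ] V →ₗ[ℝ] V →ₗ[ℝ] V →ₗ[ℝ] ℝ} {n : Fin 3 → ℂ}

lemma dotProduct_bivec_nullVec (hn : IsNullUnit n) (x : V) :
    n ⬝ᵥ bivec e x (nullVec e n) = 0 := by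
  obtain ⟨c1, c2, c3, d1, d2, d3⟩ := nullNormal_cross hn
  have h := dotProduct_nullNormal n
  rw [dotProduct, Fin.sum_univ_three, nullNormal_ofReal n 0, nullNormal_ofReal n 1,
    nullNormal_ofReal n 2] at h
  have hr := congrArg Complex.re h
  have hi := congrArg Complex.im h
  simp at hr hi
  apply Complex.ext
  · simp [dotProduct, Fin.sum_univ_three, bivec, nullVec]
    linear_combination e.repr x 0 * hr + e.repr x 1 * d1 + e.repr x 2 * d2 + e.repr x 3 * d3
  · simp [dotProduct, Fin.sum_univ_three, bivec, nullVec]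
    linear_combination e.repr x 0 * hi - e.repr x 1 * c1 - e.repr x 2 * c2 - e.repr x 3 * c3

lemma nullNormal_dotProduct_bivec_nullVec (he : IsOrthonormalFrame g e) (hn : IsNullUnit n)
    (x : V) :
    nullNormal n ⬝ᵥ bivec e x (nullVec e n) = -(g x (nullVec e n) : ℂ) := by
  have h := congrArg Complex.ofReal (nullNormal_re_self hn)
  push_cast at h
  rw [he.apply_eq, dotProduct, Fin.sum_univ_three, nullNormal_ofReal n 0, nullNormal_ofReal n 1,
    nullNormal_ofReal n 2]
  simp [bivec, nullVec]
  linear_combination (e.repr x 0 : ℂ) * h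

lemma nullVec_null (he : IsOrthonormalFrame g e) (hn : IsNullUnit n) :
    g (nullVec e n) (nullVec e n) = 0 := by
  rw [he.apply_eq]
  simp [nullVec]
  linear_combination nullNormal_re_self hn

lemma nullVec_ne_zero (n : Fin 3 → ℂ) : nullVec e n ≠ 0 := by
  intro h
  have := congrArg (fun v => e.repr v 0) h
  simp [nullVec] at this

lemma exists_eq_smul_nullVec (he : IsOrthonormalFrame g e) {l : V} (h0 : l ≠ 0)
    (hl : g l l = 0) : ∃ n, IsNullUnit n ∧ ∃ c : ℝ, c ≠ 0 ∧ l = c • nullVec e n := by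
  rw [he.apply_eq] at hl
  have hc : e.repr l 0 ≠ 0 := by
    intro h
    rw [h] at hl
    have hz : ∀ a, e.repr l a = 0 := by
      intro a
      have s1 := sq_nonneg (e.repr l 1)
      have s2 := sq_nonneg (e.repr l 2)
      have s3 := sq_nonneg (e.repr l 3)
      fin_cases a
      · exact h
      all_goals exact pow_eq_zero_iff two_ne_zero |>.mp (by dsimp; nlinarith)
    exact h0 (e.repr.map_eq_zero_iff.mp (Finsupp.ext hz))
  obtain ⟨n, hn, h1, h2, h3⟩ := exists_nullNormal_eq (-(e.repr l 1 / e.repr l 0))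
    (-(e.repr l 2 / e.repr l 0)) (-(e.repr l 3 / e.repr l 0)) (by
      field_simp
      linear_combination hl)
  refine ⟨n, hn, e.repr l 0, hc, e.repr.injective (Finsupp.ext fun a => ?_)⟩
  rw [nullVec, h1, h2, h3]
  fin_cases a <;> simp <;> field_simp

lemma IsFundamental.of_smul {l : V} {c : ℝ} (hc : c ≠ 0) (h : IsFundamental g W (c • l)) :
    IsFundamental g W l := by
  obtain ⟨h0, h1, h2⟩ := h
  refine ⟨fun h => h0 (by rw [h, smul_zero]), ?_, fun x y z => ?_⟩
  · simpa [hc] using h1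
  · have := h2 x y z
    simp only [map_smul, LinearMap.smul_apply, smul_eq_mul] at this
    have hc3 : c ^ 3 ≠ 0 := pow_ne_zero _ hc
    refine mul_left_cancel₀ hc3 ?_
    linear_combination this

lemma apply_eq_re_weylC (hW : IsWeylTensor e W) (x y l : V) :
    W x l l y = -(bivec e x l ⬝ᵥ (weylMatrix e W *ᵥ bivec e y l)).re := by
  rw [← weylC_eq hW, hW.skew_right]
  simp [weylC]

/-- On bivectors x ∧ ℓ the product with n vanishes and the product with m is -g(x,ℓ). Of the
quadratic form only 2 Re σ g(x,ℓ) g(ℓ,y) remains, which gives the Debever condition. -/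
lemma isFundamental_nullVec (he : IsOrthonormalFrame g e) (hW : IsWeylTensor e W)
    (hn : IsNullUnit n) {σ : ℂ} (h : weylMatrix e W *ᵥ n = σ • n) :
    IsFundamental g W (nullVec e n) := by
  obtain ⟨c, d, hq⟩ := dotProduct_mulVec_of_null_eigenvector hn (weylMatrix_transpose hW) h
  have key : ∀ x y, W x (nullVec e n) (nullVec e n) y
      = 2 * σ.re * (g x (nullVec e n) * g (nullVec e n) y) := by
    intro x y
    have hs : ∀ x, bivec e x (nullVec e n) ⬝ᵥ n = 0 := fun x => by
      rw [dotProduct_comm, dotProduct_bivec_nullVec hn]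
    have hm : ∀ x, bivec e x (nullVec e n) ⬝ᵥ nullNormal n = -(g x (nullVec e n) : ℂ) := fun x => by
      rw [dotProduct_comm, nullNormal_dotProduct_bivec_nullVec he hn]
    rw [apply_eq_re_weylC hW, hq, hs, hs, hm, hm, bivec_dotProduct_observer he, nullVec_null he hn,
      weylMatrix_trace hW, he.symm (nullVec e n) y]
    simp
    ring
  refine ⟨nullVec_ne_zero n, nullVec_null he hn, fun x y z => ?_⟩
  rw [key, key]; ring

/-- For y ⊥ ℓ the Debever condition kills the real part of the form on x ∧ ℓ and y ∧ ℓ. Taking Re n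
and Im n as y turns y ∧ ℓ into n and -in, so the complex form vanishes. Thus Qn is orthogonal to n
and m, which leaves only a multiple of n. -/
lemma exists_eigenvalue_of_isFundamental (he : IsOrthonormalFrame g e) (hW : IsWeylTensor e W)
    (hn : IsNullUnit n) (h : IsFundamental g W (nullVec e n)) :
    ∃ σ : ℂ, weylMatrix e W *ᵥ n = σ • n := by
  obtain ⟨c1, c2, c3, d1, d2, d3⟩ := nullNormal_cross hn
  obtain ⟨r1, r2⟩ : g (nullVec e n) (e 0) = -1 ∧ bivec e (e 0) (nullVec e n) = nullNormal n := by
    constructor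
    · rw [he.apply_eq]; simp [nullVec]
    · ext i
      rw [nullNormal_ofReal]
      fin_cases i <;> simp [bivec, nullVec]
  have hz : ∀ x y, g (nullVec e n) y = 0 →
      (bivec e x (nullVec e n) ⬝ᵥ (weylMatrix e W *ᵥ bivec e y (nullVec e n))).re = 0 := by
    intro x y hy
    have h1 := h.2.2 x y (e 0)
    rw [hy, r1, apply_eq_re_weylC hW] at h1
    linarith
  have hdot := dotProduct_nullNormal n
  rw [dotProduct, Fin.sum_univ_three, nullNormal_ofReal n 0, nullNormal_ofReal n 1,
    nullNormal_ofReal n 2] at hdot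
  have hr := congrArg Complex.re hdot
  have hi := congrArg Complex.im hdot
  simp at hr hi
  obtain ⟨y1, hy1, hb1⟩ : ∃ y, g (nullVec e n) y = 0 ∧ bivec e y (nullVec e n) = n := by
    refine ⟨ofComponents e ![0, (n 0).re, (n 1).re, (n 2).re], ?_, ?_⟩
    · rw [he.apply_eq]; simp [nullVec]; linear_combination -hr
    · ext i
      fin_cases i <;> apply Complex.ext <;> simp [bivec, nullVec] <;> linarith
  obtain ⟨y2, hy2, hb2⟩ : ∃ y, g (nullVec e n) y = 0 ∧
      bivec e y (nullVec e n) = (-Complex.I) • n := by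
    refine ⟨ofComponents e ![0, (n 0).im, (n 1).im, (n 2).im], ?_, ?_⟩
    · rw [he.apply_eq]; simp [nullVec]; linear_combination -hi
    · ext i
      fin_cases i <;> apply Complex.ext <;> simp [bivec, nullVec] <;> linarith
  have hx : ∀ x, bivec e x (nullVec e n) ⬝ᵥ (weylMatrix e W *ᵥ n) = 0 := by
    intro x
    have e1 := hz x y1 hy1
    have e2 := hz x y2 hy2
    rw [hb1] at e1
    rw [hb2, Matrix.mulVec_smul, dotProduct_smul] at e2
    apply Complex.ext
    · simpa using e1
    · simpa using e2
  have k1 := hx y1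
  have k2 := hx (e 0)
  rw [hb1, dotProduct_comm] at k1
  rw [r2, dotProduct_comm] at k2
  refine ⟨1 / 2 * ((weylMatrix e W *ᵥ n) ⬝ᵥ star n), ?_⟩
  conv_lhs => rw [null_expansion hn (weylMatrix e W *ᵥ n), k1, k2]
  simp

/-- The fundamental direction that belongs to a null eigenvector is unique if
`(Q - σ)(Q + 2σ) ≠ 0`. -/
lemma fundamental_unique (he : IsOrthonormalFrame g e) (hW : IsWeylTensor e W)
    (hn : IsNullUnit n) {σ : ℂ} (h : weylMatrix e W *ᵥ n = σ • n)
    (hN : (weylMatrix e W - σ • 1) * (weylMatrix e W + (2 * σ) • 1) ≠ 0) {l : V}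
    (hl : IsFundamental g W l) : ∃ c : ℝ, l = c • nullVec e n := by
  obtain ⟨n', hn', c, hc, rfl⟩ := exists_eq_smul_nullVec he hl.1 hl.2.1
  obtain ⟨τ, hτ⟩ := exists_eigenvalue_of_isFundamental he hW hn' (hl.of_smul hc)
  obtain ⟨d, hd⟩ := null_eigenvector_unique hn (weylMatrix_transpose hW) (weylMatrix_trace hW) h hN
    hn'.1 hτ
  exact ⟨c, by rw [nullVec, nullVec, hn.of_smul hn' hd]⟩

end

end

end BelRobinson

/-! ### The limit of (q,q) along the fundamental direction -/

namespace BelRobinson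

noncomputable section

open Matrix Filter Topology

variable {V : Type*} [AddCommGroup V] [Module ℝ V]

lemma sum_normSq_one_add (β : Fin 3 → ℂ) (hβ : β ⬝ᵥ β = 1) :
    ∑ i, ∑ j, Complex.normSq ((1 : Matrix (Fin 3) (Fin 3) ℂ) i j + 3 * (β i * β j))
      = 9 + 9 * (∑ i, Complex.normSq (β i)) ^ 2 := by
  have h := congrArg Complex.re hβ
  simp [dotProduct, Fin.sum_univ_three] at h
  simp [Fin.sum_univ_three, Complex.normSq_apply, Matrix.one_apply]
  linear_combination 6 * h

/-- Every term with `α` is o(1), since `β` is bounded. The vectors `β` need not converge, as the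
frames may rotate; only Σ|β_i|² is controlled, and it determines the remaining norm by
`sum_normSq_one_add`: 9 + 9 = 18. -/
lemma tendsto_frobSq {α β : ℕ → Fin 3 → ℂ} (hα : ∀ i, Tendsto (fun k => α k i) atTop (𝓝 0))
    (hβ : ∀ k, β k ⬝ᵥ β k = 1)
    (hB : Tendsto (fun k => ∑ i, Complex.normSq (β k i)) atTop (𝓝 1)) (s c d : ℂ) :
    Tendsto (fun k => frobSq (Matrix.of fun i j => s * ((1 : Matrix (Fin 3) (Fin 3) ℂ) i j
        + 3 * (β k i * β k j)) + (c * (α k i * α k j) + d * (α k i * β k j + β k i * α k j))))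
      atTop (𝓝 (18 * Complex.normSq s)) := by
  have hα' : ∀ i, (fun k => α k i) =o[atTop] (fun _ => (1 : ℝ)) := fun i =>
    (Asymptotics.isLittleO_one_iff ℝ).mpr (hα i)
  have hβ' : ∀ i, (fun k => β k i) =O[atTop] (fun _ => (1 : ℝ)) := by
    intro i
    refine Asymptotics.IsBigO.of_bound 2 ?_
    filter_upwards [hB.eventually (gt_mem_nhds (show (1 : ℝ) < 4 by norm_num))] with k hk
    have h1 : Complex.normSq (β k i) ≤ ∑ i, Complex.normSq (β k i) :=
      Finset.single_le_sum (f := fun i => Complex.normSq (β k i))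
        (fun _ _ => Complex.normSq_nonneg _) (Finset.mem_univ i)
    rw [Complex.normSq_eq_norm_sq] at h1
    rw [norm_one, mul_one]
    nlinarith [norm_nonneg (β k i)]
  have mul_oO : ∀ {x y : ℕ → ℂ}, x =o[atTop] (fun _ => (1 : ℝ)) →
      y =O[atTop] (fun _ => (1 : ℝ)) → (fun k => x k * y k) =o[atTop] (fun _ => (1 : ℝ)) :=
    fun hx hy => by simpa using hx.mul_isBigO hy
  have hR : ∀ i j, (fun k => c * (α k i * α k j) + d * (α k i * β k j + β k i * α k j))
      =o[atTop] (fun _ => (1 : ℝ)) := by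
    intro i j
    refine ((mul_oO (hα' i) (hα' j).isBigO).const_mul_left c).add
      (((mul_oO (hα' i) (hβ' j)).add ?_).const_mul_left d)
    simpa only [mul_comm] using mul_oO (hα' j) (hβ' i)
  have hM : ∀ i j, (fun k => s * ((1 : Matrix (Fin 3) (Fin 3) ℂ) i j + 3 * (β k i * β k j)))
      =O[atTop] (fun _ => (1 : ℝ)) := by
    intro i j
    refine ((Asymptotics.isBigO_const_const _ one_ne_zero _).add ?_).const_mul_left s
    refine Asymptotics.IsBigO.const_mul_left ?_ 3
    simpa using (hβ' i).mul (hβ' j)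
  have hD : ∀ i j, Tendsto (fun k => Complex.normSq
        (s * ((1 : Matrix (Fin 3) (Fin 3) ℂ) i j + 3 * (β k i * β k j))
          + (c * (α k i * α k j) + d * (α k i * β k j + β k i * α k j)))
      - Complex.normSq s * Complex.normSq ((1 : Matrix (Fin 3) (Fin 3) ℂ) i j
          + 3 * (β k i * β k j))) atTop (𝓝 0) := by
    intro i j
    have h1 := (Asymptotics.isLittleO_one_iff ℝ).mp (hR i j)
    have h2 := (Asymptotics.isLittleO_one_iff ℝ).mp (mul_oO
      (x := fun k => starRingEnd ℂ (c * (α k i * α k j) + d * (α k i * β k j + β k i * α k j)))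
      ((Asymptotics.isLittleO_one_iff ℝ).mpr
        (by simpa only [map_zero, Function.comp_def] using
          (Complex.continuous_conj.tendsto 0).comp h1)) (hM i j))
    have h3 := ((Complex.continuous_normSq.tendsto 0).comp h1).add
      (((Complex.continuous_re.tendsto 0).comp h2).const_mul 2)
    simp only [map_zero, Complex.zero_re, mul_zero, add_zero] at h3
    refine h3.congr fun k => ?_
    rw [Complex.normSq_add, Complex.normSq_mul s]
    simp only [Function.comp_apply]
    rw [mul_comm (starRingEnd ℂ _) (s * _)]
    ring
  have hsum := tendsto_finsetSum Finset.univ fun i _ =>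
    tendsto_finsetSum Finset.univ fun j _ => hD i j
  have hlim := hsum.add ((((hB.pow 2).const_mul 9).const_add 9).const_mul (Complex.normSq s))
  simp only [Finset.sum_const_zero, zero_add] at hlim
  refine (hlim.congr fun k => ?_).trans (by norm_num [mul_comm])
  rw [← sum_normSq_one_add _ (hβ k)]
  simp only [Finset.sum_sub_distrib, Finset.mul_sum, frobSq, Matrix.of_apply]
  ring

section

variable {g : V →ₗ[ℝ] V →ₗ[ℝ] ℝ} {e f : Module.Basis (Fin 4) ℝ V}
  {W : V →ₗ[ℝ] V →ₗ[ℝ] V →ₗ[ℝ] V →ₗ[ℝ] ℝ} {n : Fin 3 → ℂ}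

lemma frameWeyl_sq_apply (he : IsOrthonormalFrame g e) (hf : IsOrthonormalFrame g f)
    (i j : Fin 3) : (frameWeyl e f W ^ 2) i j =
      bivec e (f i.succ) (f 0) ⬝ᵥ (weylMatrix e W ^ 2 *ᵥ bivec e (f j.succ) (f 0)) := by
  rw [frameWeyl_sq he hf, frameMatrix_mul_mul_apply]

lemma dotProduct_self_frame (he : IsOrthonormalFrame g e) (hf : IsOrthonormalFrame g f)
    (v : Fin 3 → ℂ) : (fun i : Fin 3 => v ⬝ᵥ bivec e (f i.succ) (f 0)) ⬝ᵥ
      (fun i : Fin 3 => v ⬝ᵥ bivec e (f i.succ) (f 0)) = v ⬝ᵥ v := by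
  conv_rhs => arg 2; rw [eq_sum_bivec he hf v]
  simp [dotProduct_add, dotProduct_smul]
  simp only [dotProduct, Fin.sum_univ_three]
  rfl

lemma tendsto_dotProduct_bivec (e : Module.Basis (Fin 4) ℝ V) (v : Fin 3 → ℂ) (x : V)
    {w : ℕ → V} (hw : ∀ i, Tendsto (fun k => e.repr (w k) i) atTop (𝓝 0)) :
    Tendsto (fun k => v ⬝ᵥ bivec e x (w k)) atTop (𝓝 0) := by
  have hw' : ∀ i, Tendsto (fun k => (e.repr (w k) i : ℂ)) atTop (𝓝 0) := fun i => by
    simpa [Function.comp_def] using (Complex.continuous_ofReal.tendsto 0).comp (hw i)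
  have h : ∀ k, v ⬝ᵥ bivec e x (w k) = ∑ a, (e.repr (w k) a : ℂ) * (v ⬝ᵥ bivec e x (e a)) := by
    intro k
    conv_lhs => rw [← e.sum_repr (w k)]
    simp only [Fin.sum_univ_four, bivec_add_right, bivec_smul_right, dotProduct_add,
      dotProduct_smul, smul_eq_mul]
  simp only [h]
  simpa using tendsto_finsetSum Finset.univ fun a _ =>
    (hw' a).mul_const (v ⬝ᵥ bivec e x (e a))

/-- With the time component zero, the Lorentzian contraction in `f` is a positive sum. Its
invariance moves the estimate from the varying frames of the observers to the fixed frame `e`. -/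
lemma sum_normSq_frame (he : IsOrthonormalFrame g e) (hf : IsOrthonormalFrame g f)
    {φ : V → ℂ} (hφ : IsLinearMap ℝ φ) (h0 : φ (f 0) = 0) :
    ∑ i : Fin 3, Complex.normSq (φ (f i.succ)) = ∑ a, eta a * Complex.normSq (φ (e a)) := by
  have h := sum_eta_mul he hf hφ (isLinearMap_conj hφ)
  simp only [Complex.mul_conj] at h
  have h' : ∑ a, eta a * Complex.normSq (φ (e a)) = ∑ a, eta a * Complex.normSq (φ (f a)) := by
    exact_mod_cast h
  rw [h', Fin.sum_univ_succ (n := 3), h0]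
  simp [eta]

lemma tendsto_qq (he : IsOrthonormalFrame g e) (hW : IsWeylTensor e W) (hn : IsNullUnit n)
    {σ : ℂ} (h : weylMatrix e W *ᵥ n = σ • n) {u : ℕ → V} (hu : ∀ k, IsObserver g (u k))
    (hl : ApproachesDirection e (nullVec e n) u) :
    Tendsto (fun k => qq e W (u k)) atTop
      (𝓝 (-(1 / 16) * Complex.normSq (weylMatrix e W ^ 2).trace)) := by
  choose f hf hfu using fun k => exists_frame he (hu k)
  obtain ⟨a, ha⟩ := hl
  -- No control of `a k` is needed: x ∧ ℓ contributes 0 to the product with n and a real number to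
  -- the product with m.
  have hsplit : ∀ k x, bivec e x (u k)
      = bivec e x (u k - a k • nullVec e n) + (a k : ℂ) • bivec e x (nullVec e n) := by
    intro k x
    rw [← bivec_smul_right, ← bivec_add_right, sub_add_cancel]
  have lin : ∀ (v : Fin 3 → ℂ) (y : V), IsLinearMap ℝ fun x => v ⬝ᵥ bivec e x y := fun v y =>
    ⟨fun x x' => by rw [bivec_add_left, dotProduct_add],
      fun c x => by rw [bivec_smul_left, dotProduct_smul]; simp⟩
  have linIm : ∀ (v : Fin 3 → ℂ) (y : V),
      IsLinearMap ℝ fun x => (((v ⬝ᵥ bivec e x y).im : ℝ) : ℂ) := fun v y =>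
    ⟨fun x x' => by rw [bivec_add_left, dotProduct_add]; simp,
      fun c x => by rw [bivec_smul_left, dotProduct_smul]; simp⟩
  set α : ℕ → Fin 3 → ℂ := fun k i => n ⬝ᵥ bivec e (f k i.succ) (f k 0) with hα
  set β : ℕ → Fin 3 → ℂ := fun k i => nullNormal n ⬝ᵥ bivec e (f k i.succ) (f k 0) with hβ
  have tsum : ∀ (ψ : ℕ → V → ℂ), (∀ x, Tendsto (fun k => ψ k x) atTop (𝓝 0)) →
      Tendsto (fun k => ∑ a, eta a * Complex.normSq (ψ k (e a))) atTop (𝓝 0) := by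
    intro ψ hψ
    simpa using tendsto_finsetSum Finset.univ fun a _ =>
      ((Complex.continuous_normSq.tendsto 0).comp (hψ (e a))).const_mul (eta a)
  have hA : Tendsto (fun k => ∑ i, Complex.normSq (α k i)) atTop (𝓝 0) := by
    refine (tsum (fun k x => n ⬝ᵥ bivec e x (u k)) fun x => ?_).congr fun k => ?_
    · refine (tendsto_dotProduct_bivec e n x ha).congr fun k => ?_
      rw [hsplit, dotProduct_add, dotProduct_smul, dotProduct_bivec_nullVec hn]
      simp
    · rw [← hfu k]
      exact (sum_normSq_frame he (hf k) (lin n (f k 0)) (by simp [bivec_self])).symm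
  have hα0 : ∀ i, Tendsto (fun k => α k i) atTop (𝓝 0) := by
    intro i
    have h1 : Tendsto (fun k => Complex.normSq (α k i)) atTop (𝓝 0) :=
      squeeze_zero (fun _ => Complex.normSq_nonneg _) (fun k =>
        Finset.single_le_sum (f := fun i => Complex.normSq (α k i))
          (fun _ _ => Complex.normSq_nonneg _) (Finset.mem_univ i)) hA
    rw [tendsto_zero_iff_norm_tendsto_zero]
    have h2 := (Real.continuous_sqrt.tendsto 0).comp h1
    rw [Real.sqrt_zero] at h2
    exact h2.congr fun k => by simp [Complex.normSq_eq_norm_sq]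
  have hβ1 : ∀ k, β k ⬝ᵥ β k = 1 := fun k => by
    rw [dotProduct_self_frame he (hf k), nullNormal_self hn]
  have hB : Tendsto (fun k => ∑ i, Complex.normSq (β k i)) atTop (𝓝 1) := by
    have h1 : Tendsto (fun k => ∑ i, Complex.normSq (((β k i).im : ℝ) : ℂ)) atTop (𝓝 0) := by
      refine (tsum (fun k x => (((nullNormal n ⬝ᵥ bivec e x (u k)).im : ℝ) : ℂ))
        fun x => ?_).congr fun k => ?_
      · have h2 := (Complex.continuous_ofReal.tendsto 0).comp
          ((Complex.continuous_im.tendsto 0).comp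
            (tendsto_dotProduct_bivec e (nullNormal n) x ha))
        rw [Complex.ofReal_zero] at h2
        refine h2.congr fun k => ?_
        simp only [Function.comp_apply]
        rw [hsplit k x, dotProduct_add, dotProduct_smul,
          nullNormal_dotProduct_bivec_nullVec he hn]
        simp
      · rw [← hfu k]
        exact (sum_normSq_frame he (hf k) (linIm (nullNormal n) (f k 0))
          (by simp [bivec_self])).symm
    have h2 := (h1.const_mul 2).const_add 1
    rw [mul_zero, add_zero] at h2
    -- From β·β = 1 follows Σ|β_i|² = 1 + 2 Σ(Im β_i)².
    refine h2.congr fun k => ?_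
    have h3 := congrArg Complex.re (hβ1 k)
    simp [dotProduct, Fin.sum_univ_three] at h3
    simp only [Fin.sum_univ_three, Complex.normSq_apply, Complex.ofReal_re, Complex.ofReal_im]
    linear_combination -h3
  have hS2 : (weylMatrix e W ^ 2)ᵀ = weylMatrix e W ^ 2 := by
    rw [Matrix.transpose_pow, weylMatrix_transpose hW]
  have hSn2 : weylMatrix e W ^ 2 *ᵥ n = σ ^ 2 • n := by
    rw [pow_two, ← Matrix.mulVec_mulVec, h, Matrix.mulVec_smul, h, smul_smul, pow_two]
  have htr := trace_sq_of_null_eigenvector hn (weylMatrix_transpose hW) (weylMatrix_trace hW) h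
  obtain ⟨c, d, hq⟩ := dotProduct_mulVec_of_null_eigenvector hn hS2 hSn2
  have hlim := (((tendsto_frobSq hα0 hβ1 hB (σ ^ 2) c d).const_mul 3).sub_const
    ((1 / 2) * Complex.normSq (weylMatrix e W ^ 2).trace)).const_mul (-(1 / 16))
  -- 3·18 - 36/2 = 36, and tr Q² = 6σ².
  have hval : -(1 / 16) * (3 * (18 * Complex.normSq (σ ^ 2))
      - 1 / 2 * Complex.normSq (weylMatrix e W ^ 2).trace)
      = -(1 / 16) * Complex.normSq (weylMatrix e W ^ 2).trace := by
    rw [htr, map_mul, show Complex.normSq 6 = 36 by norm_num [Complex.normSq_apply]]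
    ring
  rw [hval] at hlim
  refine hlim.congr fun k => ?_
  rw [← hfu k, qq_eq he (hf k) hW]
  congr 4
  ext i j
  have hδ : bivec e (f k i.succ) (f k 0) ⬝ᵥ bivec e (f k j.succ) (f k 0)
      = (1 : Matrix (Fin 3) (Fin 3) ℂ) i j := by
    rw [← frameMatrix_mul_transpose he (hf k)]; rfl
  rw [frameWeyl_sq_apply he (hf k), hq, htr, hδ, Matrix.of_apply]
  simp only [hα, hβ, dotProduct_comm _ n, dotProduct_comm _ (nullNormal n)]
  ring

end

end

end BelRobinson

/-! ### The fundamental direction of types II and III; conclusion -/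

namespace BelRobinson

noncomputable section

open Matrix Polynomial

variable {V : Type*} [AddCommGroup V] [Module ℝ V]

/-- N = (S - σ)(S + 2σ) is symmetric with N² = 0, so (Nx)·(Nx) = x·N²x = 0: its range consists of
null eigenvectors. -/
lemma exists_null_eigenvector {S : Matrix (Fin 3) (Fin 3) ℂ} {σ : ℂ} (hS : Sᵀ = S)
    (hN : (S - σ • 1) * (S + (2 * σ) • 1) ≠ 0)
    (h0 : (S - σ • 1) * ((S - σ • 1) * (S + (2 * σ) • 1)) = 0) :
    ∃ n, IsNullUnit n ∧ S *ᵥ n = σ • n := by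
  set N := (S - σ • 1) * (S + (2 * σ) • 1) with hNdef
  have hcomm : (S - σ • 1) * (S + (2 * σ) • 1) = (S + (2 * σ) • 1) * (S - σ • 1) := by
    simp only [mul_add, sub_mul, add_mul, mul_sub, smul_mul_assoc, mul_smul_comm, one_mul, mul_one]
    module
  have hNt : Nᵀ = N := by
    rw [hNdef, Matrix.transpose_mul, Matrix.transpose_add, Matrix.transpose_sub,
      Matrix.transpose_smul, Matrix.transpose_smul, Matrix.transpose_one, hS, hcomm]
  have hNN : N * N = 0 := by
    conv_lhs => arg 1; rw [hNdef, hcomm]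
    rw [Matrix.mul_assoc, h0, Matrix.mul_zero]
  obtain ⟨x, hx⟩ : ∃ x, N *ᵥ x ≠ 0 := by
    by_contra! h
    exact hN (Matrix.ext_of_mulVec_single fun j => by rw [h, Matrix.zero_mulVec])
  have hv : S *ᵥ (N *ᵥ x) = σ • (N *ᵥ x) := by
    have h1 : (S - σ • 1) *ᵥ (N *ᵥ x) = 0 := by
      rw [Matrix.mulVec_mulVec, h0, Matrix.zero_mulVec]
    rw [Matrix.sub_mulVec, Matrix.smul_mulVec, Matrix.one_mulVec] at h1
    exact sub_eq_zero.mp h1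
  have hvv : (N *ᵥ x) ⬝ᵥ (N *ᵥ x) = 0 := by
    rw [← dotProduct_mulVec_comm hNt, Matrix.mulVec_mulVec, hNN, Matrix.zero_mulVec,
      dotProduct_zero]
  obtain ⟨c, hc⟩ := exists_isNullUnit_smul hvv hx
  exact ⟨_, hc, by rw [Matrix.mulVec_smul, hv, smul_comm]⟩

section

variable {g : V →ₗ[ℝ] V →ₗ[ℝ] ℝ} {e : Module.Basis (Fin 4) ℝ V}
  {W : V →ₗ[ℝ] V →ₗ[ℝ] V →ₗ[ℝ] V →ₗ[ℝ] ℝ}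

/-- Covers both types, with σ = 0 for III and σ the double root for II. The limit found is -α²/4,
and `hx` identifies it with -ξ². -/
lemma tendsAlongFundamental (he : IsOrthonormalFrame g e) (hW : IsWeylTensor e W) {σ : ℂ}
    (hN : (weylMatrix e W - σ • 1) * (weylMatrix e W + (2 * σ) • 1) ≠ 0)
    (h0 : (weylMatrix e W - σ • 1) *
      ((weylMatrix e W - σ • 1) * (weylMatrix e W + (2 * σ) • 1)) = 0)
    (hx : -xi e W ^ 2 = -(1 / 4) * alpha e W ^ 2) : TendsAlongFundamental g e W := by
  obtain ⟨n, hn, h⟩ := exists_null_eigenvector (weylMatrix_transpose hW) hN h0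
  refine ⟨nullVec e n, isFundamental_nullVec he hW hn h, fun l hl =>
    fundamental_unique he hW hn h hN hl, fun u hu hl => ?_⟩
  have := tendsto_qq he hW hn h hu hl
  rwa [hx, alpha_sq he hW, ← mul_assoc, show -(1 / 4) * (1 / 4) = (-(1 / 16) : ℝ) by norm_num]

lemma tendsAlongFundamental_of_isTypeIII (he : IsOrthonormalFrame g e) (hW : IsWeylTensor e W)
    (h : IsTypeIII e W) : TendsAlongFundamental g e W := by
  have h3 : weylMatrix e W ^ 3 = 0 := by
    have := minpoly.aeval ℂ (weylMatrix e W)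
    rw [h] at this
    simpa using this
  refine tendsAlongFundamental (σ := 0) he hW ?_ ?_
    (typeIII he hW h (u := e 0) (by simp [IsObserver, he _ _, eta])).2.1
  · simpa [pow_two] using sq_ne_zero_of_isTypeIII h
  · simpa [pow_succ, Matrix.mul_assoc] using h3

lemma tendsAlongFundamental_of_isTypeII (he : IsOrthonormalFrame g e) (hW : IsWeylTensor e W)
    (h : IsTypeII e W) : TendsAlongFundamental g e W := by
  have hx := (typeII he hW h (u := e 0) (by simp [IsObserver, he _ _, eta])).2.1
  obtain ⟨p, q, hpq, hm⟩ := h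
  obtain rfl : q = -(2 * p) := by linear_combination add_eq_zero_of_minpoly hW hm
  have ha : ∀ z : ℂ, aeval (weylMatrix e W) (X - C z) = weylMatrix e W - z • 1 := fun z => by
    rw [map_sub, aeval_X, aeval_C, Algebra.algebraMap_eq_smul_one]
  have hq : weylMatrix e W + (2 * p) • 1 = aeval (weylMatrix e W) (X - C (-(2 * p))) := by
    rw [ha, neg_smul, sub_neg_eq_add]
  refine tendsAlongFundamental (σ := p) he hW ?_ ?_ hx
  · rw [hq, ← ha, ← map_mul]
    intro h0
    have hd := minpoly.dvd ℂ (weylMatrix e W) h0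
    rw [hm] at hd
    have hle := natDegree_le_of_dvd hd (mul_ne_zero (X_sub_C_ne_zero _) (X_sub_C_ne_zero _))
    rw [natDegree_mul (pow_ne_zero _ (X_sub_C_ne_zero _)) (X_sub_C_ne_zero _),
      natDegree_mul (X_sub_C_ne_zero _) (X_sub_C_ne_zero _), natDegree_pow] at hle
    simp only [natDegree_X_sub_C] at hle
    omega
  · rw [hq, ← ha, ← map_mul, ← map_mul, ← mul_assoc, ← pow_two, ← hm, minpoly.aeval]

end

end

end BelRobinson

theorem mainTheorem3 {V : Type*} [AddCommGroup V] [Module ℝ V]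
    (g : V →ₗ[ℝ] V →ₗ[ℝ] ℝ) (e : Module.Basis (Fin 4) ℝ V)
    (he : BelRobinson.IsOrthonormalFrame g e)
    (W : V →ₗ[ℝ] V →ₗ[ℝ] V →ₗ[ℝ] V →ₗ[ℝ] ℝ) (hW : BelRobinson.IsWeylTensor e W) :
    (BelRobinson.IsTypeN e W →
      ∀ u, BelRobinson.IsObserver g u →
        BelRobinson.qq e W u = -BelRobinson.xi e W ^ 2 ∧
        -BelRobinson.xi e W ^ 2 = -(1 / 4) * BelRobinson.alpha e W ^ 2 ∧
        -(1 / 4) * BelRobinson.alpha e W ^ 2 = 0) ∧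
    (BelRobinson.IsTypeIII e W →
      (∀ u, BelRobinson.IsObserver g u →
        BelRobinson.qq e W u < -BelRobinson.xi e W ^ 2 ∧
        -BelRobinson.xi e W ^ 2 = -(1 / 4) * BelRobinson.alpha e W ^ 2 ∧
        -(1 / 4) * BelRobinson.alpha e W ^ 2 = 0) ∧
      BelRobinson.TendsAlongFundamental g e W) ∧
    (BelRobinson.IsTypeII e W →
      (∀ u, BelRobinson.IsObserver g u →
        BelRobinson.qq e W u < -BelRobinson.xi e W ^ 2 ∧
        -BelRobinson.xi e W ^ 2 = -(1 / 4) * BelRobinson.alpha e W ^ 2 ∧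
        -(1 / 4) * BelRobinson.alpha e W ^ 2 < 0) ∧
      BelRobinson.TendsAlongFundamental g e W) ∧
    (BelRobinson.IsTypeD e W →
      (∀ u, BelRobinson.IsObserver g u →
        BelRobinson.qq e W u ≤ -BelRobinson.xi e W ^ 2 ∧
        -BelRobinson.xi e W ^ 2 = -(1 / 4) * BelRobinson.alpha e W ^ 2 ∧
        -(1 / 4) * BelRobinson.alpha e W ^ 2 < 0) ∧
      (∃ u, BelRobinson.IsPrincipalObserver g e W u) ∧
      ∀ u, BelRobinson.IsPrincipalObserver g e W u →
        BelRobinson.qq e W u = -BelRobinson.xi e W ^ 2) ∧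
    (BelRobinson.IsTypeI e W →
      (∀ u, BelRobinson.IsObserver g u →
        BelRobinson.qq e W u ≤ -BelRobinson.xi e W ^ 2 ∧
        -BelRobinson.xi e W ^ 2 ≤ -(1 / 4) * BelRobinson.alpha e W ^ 2 ∧
        -(1 / 4) * BelRobinson.alpha e W ^ 2 ≤ 0) ∧
      (∃ u, BelRobinson.IsPrincipalObserver g e W u) ∧
      ∀ u, BelRobinson.IsPrincipalObserver g e W u →
        BelRobinson.qq e W u = -BelRobinson.xi e W ^ 2) := by
  refine ⟨fun h u hu => BelRobinson.typeN he hW h hu, fun h => ⟨fun u hu =>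
    BelRobinson.typeIII he hW h hu, BelRobinson.tendsAlongFundamental_of_isTypeIII he hW h⟩,
    fun h => ⟨fun u hu => BelRobinson.typeII he hW h hu,
    BelRobinson.tendsAlongFundamental_of_isTypeII he hW h⟩, fun h => ⟨fun u hu => ?_,
    BelRobinson.exists_principal_of_isTypeD he hW h, fun u hu =>
    BelRobinson.qq_of_principal he hW hu⟩, fun h => ⟨fun u hu => ?_,
    BelRobinson.exists_principal_of_isTypeI he hW h, fun u hu =>
    BelRobinson.qq_of_principal he hW hu⟩⟩
  · obtain ⟨p, q, hpq, hm⟩ := h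
    obtain ⟨_, _, _, -, hle, -⟩ := BelRobinson.qq_le he hW hu
    exact ⟨hle, BelRobinson.xi_sq_of_minpoly_two he hW hpq fun z => by
      simp [hm, sub_eq_zero]⟩
  · obtain ⟨_, _, _, -, hle, -⟩ := BelRobinson.qq_le he hW hu
    exact ⟨hle, BelRobinson.alpha_sq_le_xi_sq he hW, by
      nlinarith [sq_nonneg (BelRobinson.alpha e W)]⟩
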